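/- **Setting.** Let $n\ge 2$ agents, linked by a connected undirected graph with neighbourhoods $\mathcal N_i$, have costs $f_i:\mathbb R^p\to\mathbb R$; put $f=\frac1n\sum_i f_i$. For stacked variables $\mathbf x=(x_1,\dots,x_n)$ write $\|\mathbf x\|^2=\sum_i\|x_i\|^2$, $\nabla F(\mathbf x)=(\nabla f_1(x_1),\dots,\nabla f_n(x_n))$ and $\bar x=\frac1n\sum_i x_i$. Assume: * $W=(w_{ij})$ is nonnegative, symmetric and stochastic, and for $i\ne j$, $w_{ij}>0$ if $i,j$ are linked and $w_{ij}=0$ otherwise; $\lambda_2$ is its second largest eigenvalue (with multiplicity). * Each $f_i$ is differentiable with $L$-Lipschitz gradient and $f_i\ge\underline f_i$ on $\mathbb R^p$; $f^{\inf}=\frac1n\sum_i\underline f_i$. * $\mathcal C$ is a randomized compression operator on $\mathbb R^p$ with $\mathbb E[\mathcal C(x)]=x$ and $\mathbb E\|\mathcal C(x)-x\|^2\le C\|x\|^2$ for all $x$, where $C\ge 1/12$; each application of $\mathcal C$ uses randomness that is independent of everything drawn at earlier stages of the algorithm. * At every time $k\ge -1$, conditionally on everything drawn before, the samples $\xi_{i,k}$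 are independent across $i$, and $\nabla f_i(x_{i,k};\xi_{i,k})$ has mean $\nabla f_i(x_{i,k})$ and satisfies $\mathbb E\|\nabla f_i(x_{i,k};\xi_{i,k})-\nabla f_i(x_{i,k})\|^2\le\sigma^2$. **CEDAS** with constant stepsize $\eta$, parameters $\alpha,\gamma$ and deterministic initial values $x_{i,-1},h_{i,0}$: set $d_{i,0}=0$, $(h_w)_{i,0}=\sum_{j\in\mathcal N_i\cup\{i\}}w_{ij}h_{j,0}$, $x_{i,0}=x_{i,-1}-\eta\nabla f_i(x_{i,-1};\xi_{i,-1})$, and for $k=0,1,\dots,K-1$ $$y_{i,k}=x_{i,k}-\eta\nabla f_i(x_{i,k};\xi_{i,k})-d_{i,k},\quad q_{i,k}=\mathcal C(y_{i,k}-h_{i,k}),\quad \hat y_{i,k}=h_{i,k}+q_{i,k},\quad (\hat y_w)_{i,k}=(h_w)_{i,k}+\sum_{j\in\mathcal N_i\cup\{i\}}w_{ij}q_{j,k},$$ $$h_{i,k+1}=(1-\alpha)h_{i,k}+\alpha\hat y_{i,k},\qquad (h_w)_{i,k+1}=(1-\alpha)(h_w)_{i,k}+\alpha(\hat y_w)_{i,k},$$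 $$d_{i,k+1}=d_{i,k}+\tfrac{\gamma}{2}\big(\hat y_{i,k}-(\hat y_w)_{i,k}\big),\qquad x_{i,k+1}=x_{i,k}-\eta\nabla f_i(x_{i,k};\xi_{i,k})-d_{i,k+1}.$$ **Parameters.** $\alpha=\frac1{12C}$, $\gamma=\min\{\frac{\sqrt\alpha}{2\sqrt C},\frac12,\frac{\alpha^2(1-\lambda_2)}{1728C}\}$ and, for the run with horizon $K$, $\eta=\sqrt{n/K}$. A horizon is admissible if $K\ge\max\{\frac{12L^2n}{\alpha},\frac{256nL^2}{\gamma^2(1-\lambda_2)^2}\}$. **Transient time.** For $A>0$ let $K_T(A)$ be the infimum of the positive admissible integers $K_0$ such that for every $K\ge K_0$ the run with horizon $K$ satisfies $$\frac1K\sum_{t=0}^{K-1}\mathbb E\|\nabla f(\bar x_t)\|^2\le\frac{A}{\sqrt{nK}}.$$ **Claim.** For all $L,\sigma,c,q>0$ and $\Delta\ge0$ there are constants $A,B>0$, depending only on these numbers (and not on $n$, $p$, the graph, $W$, $\lambda_2$, $C$, the functions or the random variables), such that whenever $$f(\bar x_{-1})-f^{\inf}\le\Delta,\quad \|\mathbf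 x_{-1}\|^2\le cn^2,\quad \|H_0\|^2\le cn^2,\quad \|\nabla F(\mathbf x_{-1})\|^2\le cn^2,\quad \frac1{1-\lambda_2}\le cn^q,$$ with $\mathbf x_{-1}=(x_{i,-1})_i$ and $H_0=(h_{i,0})_i$, the transient time of CEDAS satisfies $$K_T(A)\le B\,\frac{n^3C^6}{(1-\lambda_2)^4}.$$ -/

import Mathlib

open MeasureTheory ProbabilityTheory
open scoped ENNReal

noncomputable section

namespace CEDAS

/-- The space `ℝ^p` with the Euclidean norm. -/
abbrev Vec (p : ℕ) : Type := EuclideanSpace ℝ (Fin p)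

/-- The average over the agents of the rows of a stacked variable. -/
def avg {n p : ℕ} (x : Fin n → Vec p) : Vec p := (n : ℝ)⁻¹ • ∑ i, x i

/-- The squared norm `‖x‖²` (sum of the squared row norms) of a stacked variable. -/
def stackedNormSq {n p : ℕ} (x : Fin n → Vec p) : ℝ := ∑ i, ‖x i‖ ^ 2

/-! ### The network -/

/-- `W` is a mixing matrix compliant with the connected undirected graph `G`: it is nonnegative,
symmetric and stochastic, and for `i ≠ j` the entry `W i j` is positive if `i` and `j` are linked,
and zero otherwise. -/
structure IsMixingMatrix {n : ℕ} (G : SimpleGraph (Fin n)) (W : Matrix (Fin n) (Fin n) ℝ) :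
    Prop where
  connected : G.Connected
  pos_of_adj : ∀ i j, G.Adj i j → 0 < W i j
  eq_zero_of_not_adj : ∀ i j, i ≠ j → ¬ G.Adj i j → W i j = 0
  nonneg : ∀ i j, 0 ≤ W i j
  symm : W.IsSymm
  row_sum : ∀ i, ∑ j, W i j = 1

open Classical in
/-- The second largest eigenvalue `λ₂` (counted with multiplicity) of a real symmetric matrix of
size at least two. The value is `0` in the cases where this makes no sense. -/
def lambda2 {n : ℕ} (W : Matrix (Fin n) (Fin n) ℝ) : ℝ :=
  if h : W.IsHermitian ∧ 2 ≤ n then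
    h.1.eigenvalues₀ ⟨1, by simpa using Nat.lt_of_succ_le h.2⟩
  else 0

/-! ### The algorithm -/

/-- The variables kept by the agents at the beginning of an iteration: `x` (the solutions), `d`,
`h`, and `hw` (the mixed copy of `h`). -/
structure State (n p : ℕ) where
  x : Fin n → Vec p
  d : Fin n → Vec p
  h : Fin n → Vec p
  hw : Fin n → Vec p

open Classical in
/-- What agent `i` computes from the values `v j` of its neighbours and of itself:
the sum of `W i j • v j` over `j ∈ 𝒩ᵢ ∪ {i}`. -/
def mix {n p : ℕ} (G : SimpleGraph (Fin n)) (W : Matrix (Fin n) (Fin n) ℝ) (v : Fin n → Vec p)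
    (i : Fin n) : Vec p :=
  ∑ j ∈ Finset.univ.filter (fun j => G.Adj i j ∨ j = i), W i j • v j

/-- The outputs of the communication procedure: `yhat`, its mixed copy, and the new `h`, `hw`. -/
structure CommOutput (n p : ℕ) where
  yhat : Fin n → Vec p
  yhatw : Fin n → Vec p
  h : Fin n → Vec p
  hw : Fin n → Vec p

/-- The communication procedure; `c i` is the compressor realised at agent `i`, and the compressed
differences `q` are the only values that are exchanged. -/
def comm {n p : ℕ} (G : SimpleGraph (Fin n)) (W : Matrix (Fin n) (Fin n) ℝ) (α : ℝ)
    (c : Fin n → Vec p → Vec p) (y h hw : Fin n → Vec p) : CommOutput n p :=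
  let q : Fin n → Vec p := fun i => c i (y i - h i)
  let yhat : Fin n → Vec p := fun i => h i + q i
  let yhatw : Fin n → Vec p := fun i => hw i + mix G W q i
  { yhat := yhat
    yhatw := yhatw
    h := fun i => (1 - α) • h i + α • yhat i
    hw := fun i => (1 - α) • hw i + α • yhatw i }

/-- The initialisation; `g i` is the stochastic gradient oracle of agent `i` with the sample drawn
at time `-1`. -/
def initState {n p : ℕ} (G : SimpleGraph (Fin n)) (W : Matrix (Fin n) (Fin n) ℝ) (η : ℝ)
    (xInit hInit : Fin n → Vec p) (g : Fin n → Vec p → Vec p) : State n p where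
  x := fun i => xInit i - η • g i (xInit i)
  d := fun _ => 0
  h := hInit
  hw := mix G W hInit

/-- One iteration; `g i` is the stochastic gradient oracle of agent `i` with the sample drawn in
this iteration, and `c i` is the compressor as realised at agent `i` in this iteration. -/
def step {n p : ℕ} (G : SimpleGraph (Fin n)) (W : Matrix (Fin n) (Fin n) ℝ) (α γ η : ℝ)
    (g c : Fin n → Vec p → Vec p) (z : State n p) : State n p :=
  let y : Fin n → Vec p := fun i => z.x i - η • g i (z.x i) - z.d i
  let out := comm G W α c y z.h z.hw
  let dNew : Fin n → Vec p := fun i => z.d i + (γ / 2) • (out.yhat i - out.yhatw i)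
  { x := fun i => z.x i - η • g i (z.x i) - dNew i
    d := dNew
    h := out.h
    hw := out.hw }

/-- The state at time `k ≥ 0`, for realised gradient samples `ξ` and compressor seeds `s`.
The sample `ξ t i` is the one that agent `i` draws at time `t - 1` (so `ξ 0` belongs to the
initialisation), and `s k i` is the seed of its compressor at time `k`. -/
def state {n p : ℕ} {Ξ S : Type*} (G : SimpleGraph (Fin n)) (W : Matrix (Fin n) (Fin n) ℝ)
    (α γ η : ℝ) (xInit hInit : Fin n → Vec p) (oracle : Fin n → Vec p → Ξ → Vec p)
    (compress : Vec p → S → Vec p) (ξ : ℕ → Fin n → Ξ) (s : ℕ → Fin n → S) : ℕ → State n p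
  | 0 => initState G W η xInit hInit (fun i v => oracle i v (ξ 0 i))
  | k + 1 => step G W α γ η (fun i v => oracle i v (ξ (k + 1) i)) (fun i v => compress v (s k i))
      (state G W α γ η xInit hInit oracle compress ξ s k)

/-- The solutions `x_{i, t-1}` at which the samples `ξ t i` are used: the initial values for
`t = 0`, and the iterates at time `k` for `t = k + 1`. -/
def queryPoint {n p : ℕ} {Ξ S : Type*} (G : SimpleGraph (Fin n)) (W : Matrix (Fin n) (Fin n) ℝ)
    (α γ η : ℝ) (xInit hInit : Fin n → Vec p) (oracle : Fin n → Vec p → Ξ → Vec p)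
    (compress : Vec p → S → Vec p) (ξ : ℕ → Fin n → Ξ) (s : ℕ → Fin n → S) :
    ℕ → Fin n → Vec p
  | 0 => xInit
  | k + 1 => (state G W α γ η xInit hInit oracle compress ξ s k).x

/-! ### The randomness -/

section Random

variable {Ω Ξ S : Type*} [mΩ : MeasurableSpace Ω] [MeasurableSpace Ξ] [MeasurableSpace S]

/-- The σ-algebra of everything drawn before the gradient samples `ξ t` (the samples of time
`t - 1`): all earlier gradient samples, and the compressor seeds of the times `l < t - 1`. -/
@[reducible] def historyGrad {n : ℕ} (ξ : ℕ → Fin n → Ω → Ξ) (s : ℕ → Fin n → Ω → S) (t : ℕ) :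
    MeasurableSpace Ω :=
  (⨆ (u : ℕ) (_ : u < t) (j : Fin n), MeasurableSpace.comap (ξ u j) inferInstance) ⊔
    (⨆ (l : ℕ) (_ : l + 1 < t) (j : Fin n), MeasurableSpace.comap (s l j) inferInstance)

/-- The σ-algebra of everything drawn before the compressor seeds `s k`: the gradient samples of
all times up to `k` (that is, `ξ 0, …, ξ (k + 1)`), and the seeds of the times `l < k`. -/
@[reducible] def historyComp {n : ℕ} (ξ : ℕ → Fin n → Ω → Ξ) (s : ℕ → Fin n → Ω → S) (k : ℕ) :
    MeasurableSpace Ω :=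
  (⨆ (u : ℕ) (_ : u ≤ k + 1) (j : Fin n), MeasurableSpace.comap (ξ u j) inferInstance) ⊔
    (⨆ (l : ℕ) (_ : l < k) (j : Fin n), MeasurableSpace.comap (s l j) inferInstance)

/-- The assumption on the stochastic gradients `oracle i (x i) (ξ i)` of one time step, given the
history `m` up to the current points `x i`: the samples are independent across the agents, and each
stochastic gradient is unbiased with variance at most `σ²`. -/
structure IsGoodGradientSample [StandardBorelSpace Ω] {n p : ℕ} (μ : Measure Ω)
    [IsFiniteMeasure μ] (m : MeasurableSpace Ω) (f : Fin n → Vec p → ℝ)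
    (oracle : Fin n → Vec p → Ξ → Vec p) (σ : ℝ) (x : Fin n → Ω → Vec p) (ξ : Fin n → Ω → Ξ) :
    Prop where
  indep : ∃ hm : m ≤ mΩ, iCondIndepFun m hm ξ μ
  memLp : ∀ i, MemLp (fun ω => oracle i (x i ω) (ξ i ω) - gradient (f i) (x i ω)) 2 μ
  unbiased : ∀ i,
    μ[fun ω => oracle i (x i ω) (ξ i ω) - gradient (f i) (x i ω) | m] =ᵐ[μ] fun _ => 0
  variance_le : ∀ i,
    μ[fun ω => ‖oracle i (x i ω) (ξ i ω) - gradient (f i) (x i ω)‖ ^ 2 | m] ≤ᵐ[μ] fun _ => σ ^ 2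

/-- The randomised operator `compress`, with seeds distributed according to `ν`, is an unbiased
compressor with parameter `C`. The second moment bound makes `compress v` integrable. -/
structure IsUnbiasedCompressor {p : ℕ} (ν : Measure S) (compress : Vec p → S → Vec p) (C : ℝ) :
    Prop where
  measurable : Measurable (Function.uncurry compress)
  unbiased : ∀ v, ∫ a, compress v a ∂ν = v
  variance_le : ∀ v, ∫⁻ a, ‖compress v a - v‖ₑ ^ 2 ∂ν ≤ ENNReal.ofReal (C * ‖v‖ ^ 2)

/-- The compressor seeds are fresh: each one has law `ν` and is independent of everything drawn at
earlier stages. -/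
structure IsFreshSeeds {n : ℕ} (μ : Measure Ω) (ν : Measure S) (ξ : ℕ → Fin n → Ω → Ξ)
    (s : ℕ → Fin n → Ω → S) : Prop where
  measurable : ∀ k i, Measurable (s k i)
  law : ∀ k i, μ.map (s k i) = ν
  indep : ∀ k i, Indep (MeasurableSpace.comap (s k i) inferInstance) (historyComp ξ s k) μ

end Random

/-! ### The objective functions -/

/-- The average objective `f = (1/n) ∑ fᵢ`. -/
def avgFun {n p : ℕ} (f : Fin n → Vec p → ℝ) (v : Vec p) : ℝ := (n : ℝ)⁻¹ * ∑ i, f i v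

/-- Each `fᵢ` is differentiable with `L`-Lipschitz gradient, and bounded below by `fLow i`. -/
structure IsSmoothBddBelow {n p : ℕ} (L : ℝ) (f : Fin n → Vec p → ℝ) (fLow : Fin n → ℝ) :
    Prop where
  differentiable : ∀ i, Differentiable ℝ (f i)
  lipschitz : ∀ i v w, ‖gradient (f i) v - gradient (f i) w‖ ≤ L * ‖v - w‖
  lower : ∀ i v, fLow i ≤ f i v

/-! ### Parameters, error and transient time -/

/-- `α = 1/(12 C)`. -/
def alphaParam (C : ℝ) : ℝ := 1 / (12 * C)

/-- `γ = min {√α / (2 √C), 1/2, α² (1 - λ₂) / (1728 C)}`. -/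
def gammaParam (C α lam : ℝ) : ℝ :=
  min (min (√α / (2 * √C)) (1 / 2)) (α ^ 2 * (1 - lam) / (1728 * C))

/-- `η = √(n / K)`. -/
def etaParam (n K : ℕ) : ℝ := √((n : ℝ) / K)

/-- `max {12 L² n / α, 256 n L² / (γ² (1 - λ₂)²)}`, the least admissible horizon. -/
def minHorizon (n : ℕ) (L α γ lam : ℝ) : ℝ :=
  max (12 * L ^ 2 * n / α) (256 * n * L ^ 2 / (γ ^ 2 * (1 - lam) ^ 2))

/-- `(1/K) ∑_{t=0}^{K-1} 𝔼 ‖∇f(x̄_t)‖²` for random iterates `x t`. -/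
def meanGradSq {Ω : Type*} [MeasurableSpace Ω] {n p : ℕ} (μ : Measure Ω)
    (f : Fin n → Vec p → ℝ) (x : ℕ → Ω → Fin n → Vec p) (K : ℕ) : ℝ≥0∞ :=
  (∑ t ∈ Finset.range K, ∫⁻ ω, ‖gradient (avgFun f) (avg (x t ω))‖ₑ ^ 2 ∂μ) / (K : ℝ≥0∞)

/-- The transient time: the infimum of the (positive, admissible) `K₀` such that for every horizon
`K ≥ K₀` the error `err K` is at most `A / √(n K)`. It is `∞` if there is no such `K₀`. -/
def transientTime (n : ℕ) (A Kmin : ℝ) (err : ℕ → ℝ≥0∞) : ℝ≥0∞ :=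
  sInf {T : ℝ≥0∞ | ∃ K₀ : ℕ, T = (K₀ : ℝ≥0∞) ∧ 1 ≤ K₀ ∧ Kmin ≤ (K₀ : ℝ) ∧
    ∀ K : ℕ, K₀ ≤ K → err K ≤ ENNReal.ofReal (A / √((n : ℝ) * K))}

end CEDAS

end

/-! The run is studied in the semi-inner product space `RandomVec` of square-integrable random
vectors with product `𝔼⟪f, g⟫`. Unbiasedness and freshness become orthogonality relations there:
gradient noise is orthogonal to the past, noises of different agents are orthogonal to each other,
and compression errors are orthogonal to everything drawn before the seeds. After that, one
iteration is deterministic geometry, and it splits along an orthonormal eigenbasis of `W`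
(`IsMixingMatrix.exists_isModeBasis`).

In a mode with eigenvalue `λ`, put `θ = γ (1 - λ) / 2`. Recentre the dual variable as `u = d + η
∇F(x̄)`, and let `e` be the compression error. Then `y = x - u + r - w`, with `r` the gradient
mismatch caused by disagreement and `w` the scaled noise. The update reads `x' = (1 - θ) y - θ e`,
`u' = u + θ (y + e) + ρ`, with `ρ` the drift of the recentring. The identity `mode_energy_identity`
shows that `‖x‖² / (1 - θ) + ‖u‖² / θ` loses about `θ ‖x‖² + ‖u‖²` per step, up to perturbations.
Since `e` is controlled by `C ‖y - h‖²`, a multiple of `∑ ‖x - h‖²` is added; the references `h`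
contract at rate `α`, and the weight `trackWeight` makes this contraction pay for the compression.
With `m = γ (1 - λ₂) / 2`, the smallest `θ` possible off consensus, the result
(`networkLyapunov_step_le`) is a decrease of `m / 4` times the consensus error, at the price of `η²
n ‖∇f(x̄)‖² / 2 + 3 η² n σ²`.

In the consensus mode the dual variable has mean zero, so `x̄` follows a gradient step whose noise
has variance at most `σ² / n`. The descent lemma (`descent_step_le`) bounds the decrease of `f(x̄)`
up to a multiple of the consensus error. Adding `2 η L² / (n m)` times the Lyapunov function cancels
that error exactly (`sum_le_of_coupled_recursion`), and telescoping bounds `η ∑ 𝔼‖∇f(x̄)‖²`.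

With `η = √(n / K)` one has `K η² / n = 1` and `K η = √(n K)`. All remaining terms are therefore
bounded by constants once `n η ≤ m` and `η L ≤ m / 8`: the initial Lyapunov value is `O(n²)`, so its
weighted contribution is `O(n η / m)`. Both conditions hold when `K ≥ (1 + 64 L²) n³ / m²`. Since
`m` is `(1 - λ₂)²` over a multiple of `C³`, this threshold is of order `n³ C⁶ / (1 - λ₂)⁴`. -/

noncomputable section

namespace CEDAS

/-! ### Spectral decomposition of the mixing matrix -/

section Spectral

variable {n : ℕ} {G : SimpleGraph (Fin n)} {W : Matrix (Fin n) (Fin n) ℝ}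

lemma IsMixingMatrix.symm_apply (hW : IsMixingMatrix G W) (i j : Fin n) : W i j = W j i :=
  (hW.symm.apply i j).symm

lemma IsMixingMatrix.isHermitian (hW : IsMixingMatrix G W) : W.IsHermitian :=
  Matrix.IsHermitian.ext fun i j => by simpa using hW.symm_apply j i

lemma IsMixingMatrix.col_sum (hW : IsMixingMatrix G W) (j : Fin n) : ∑ i, W i j = 1 := by
  rw [← hW.row_sum j]
  exact Finset.sum_congr rfl fun i _ => hW.symm_apply i j

/-- For `ε = ±1` the left side is nonnegative, which confines the spectrum to `[-1, 1]`; for `ε =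
-1` it is the Dirichlet form of the network. -/
lemma IsMixingMatrix.sum_mul_sq_add (hW : IsMixingMatrix G W) (ε : ℝ) (v : Fin n → ℝ) :
    ∑ i, ∑ j, W i j * (v i + ε * v j) ^ 2
      = (1 + ε ^ 2) * ∑ i, v i ^ 2 + 2 * ε * ∑ i, v i * ∑ j, W i j * v j := by
  have h1 : ∑ i, ∑ j, W i j * v i ^ 2 = ∑ i, v i ^ 2 := by
    refine Finset.sum_congr rfl fun i _ => ?_
    rw [← Finset.sum_mul, hW.row_sum, one_mul]
  have h2 : ∑ i, ∑ j, W i j * v j ^ 2 = ∑ i, v i ^ 2 := by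
    rw [Finset.sum_comm]
    refine Finset.sum_congr rfl fun i _ => ?_
    rw [← Finset.sum_mul, hW.col_sum, one_mul]
  have h3 : ∑ i, ∑ j, W i j * (v i + ε * v j) ^ 2
      = ∑ i, ∑ j, W i j * v i ^ 2 + ε ^ 2 * ∑ i, ∑ j, W i j * v j ^ 2
        + 2 * ε * ∑ i, v i * ∑ j, W i j * v j := by
    simp only [Finset.mul_sum, ← Finset.sum_add_distrib]
    refine Finset.sum_congr rfl fun i _ => Finset.sum_congr rfl fun j _ => by ring
  rw [h3, h1, h2]
  ring

/-- All terms are nonnegative, so each one vanishes; positive weights force equality along edges,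
and walks in the connected graph spread it. -/
lemma IsMixingMatrix.eq_of_sum_mul_sq_sub_eq_zero (hW : IsMixingMatrix G W) (v : Fin n → ℝ)
    (h : ∑ i, ∑ j, W i j * (v i + (-1) * v j) ^ 2 = 0) (i j : Fin n) : v i = v j := by
  have hnn : ∀ i j, 0 ≤ W i j * (v i + (-1) * v j) ^ 2 := fun i j =>
    mul_nonneg (hW.nonneg i j) (sq_nonneg _)
  have hz : ∀ i j, W i j * (v i + (-1) * v j) ^ 2 = 0 := by
    intro i j
    have h1 := (Finset.sum_eq_zero_iff_of_nonneg
      (fun i _ => Finset.sum_nonneg fun j _ => hnn i j)).1 h i (Finset.mem_univ i)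
    exact (Finset.sum_eq_zero_iff_of_nonneg (fun j _ => hnn i j)).1 h1 j (Finset.mem_univ j)
  have hadj : ∀ i j, G.Adj i j → v i = v j := by
    intro i j hij
    have := hz i j
    rcases mul_eq_zero.1 this with h0 | h0
    · exact absurd h0 (hW.pos_of_adj i j hij).ne'
    · have := pow_eq_zero_iff (two_ne_zero) |>.1 h0
      linarith
  obtain ⟨w⟩ := hW.connected.preconnected i j
  induction w with
  | nil => rfl
  | cons hab _ ih => exact (hadj _ _ hab).trans ih

/-- An orthonormal eigenbasis `U` of a mixing matrix: the mode `i₀` is the consensus mode, and all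
other eigenvalues lie in `[-1, λ₂]`. -/
structure IsModeBasis (W : Matrix (Fin n) (Fin n) ℝ) (lam2 : ℝ) (U : Fin n → Fin n → ℝ)
    (lam : Fin n → ℝ) (i₀ : Fin n) : Prop where
  orth : ∀ j l, ∑ i, U i j * U i l = if j = l then 1 else 0
  eigen : ∀ i l, ∑ j, U i j * W j l = lam i * U i l
  lam_zero : lam i₀ = 1
  le_lam : ∀ i, -1 ≤ lam i
  lam_le : ∀ i, i ≠ i₀ → lam i ≤ lam2
  sum_eq_zero : ∀ i, i ≠ i₀ → ∑ j, U i j = 0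
  zero_mode : ∀ j, U i₀ j = U i₀ i₀
  zero_mode_sq : (n : ℝ) * U i₀ i₀ ^ 2 = 1

theorem IsMixingMatrix.exists_isModeBasis (hW : IsMixingMatrix G W) (hn : 2 ≤ n) :
    lambda2 W < 1 ∧ -1 ≤ lambda2 W ∧ ∃ U lam i₀, IsModeBasis W (lambda2 W) U lam i₀ := by
  classical
  have hH := hW.isHermitian
  set b := hH.eigenvectorBasis with hb
  set lam := hH.eigenvalues with hlam
  have hl2 : lambda2 W = hH.eigenvalues₀ ⟨1, by simpa using Nat.lt_of_succ_le hn⟩ := by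
    unfold lambda2
    rw [dif_pos ⟨hH, hn⟩]
  have hev : ∀ i l, ∑ j, W l j * b i j = lam i * b i l := fun i l => by
    simpa [Matrix.mulVec, dotProduct] using congrFun (hH.mulVec_eigenvectorBasis i) l
  have hinner : ∀ i i', ∑ j, b i j * b i' j = if i = i' then 1 else 0 := fun i i' => by
    have := orthonormal_iff_ite.1 b.orthonormal i i'
    simpa [PiLp.inner_apply, mul_comm] using this
  have hquad : ∀ ε i, ∑ j, ∑ l, W j l * (b i j + ε * b i l) ^ 2
      = (1 + ε ^ 2) + 2 * ε * lam i := fun ε i => by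
    rw [hW.sum_mul_sq_add ε]
    have h1 : ∑ j, b i j ^ 2 = 1 := by
      simpa [sq] using hinner i i
    have h2 : ∑ j, b i j * ∑ l, W j l * b i l = lam i := by
      simp_rw [hev]
      calc ∑ j, b i j * (lam i * b i j) = lam i * ∑ j, b i j ^ 2 := by
            rw [Finset.mul_sum]; exact Finset.sum_congr rfl fun j _ => by ring
        _ = lam i := by rw [h1, mul_one]
    rw [h1, h2, mul_one]
  have hquad_nn : ∀ ε i, 0 ≤ (1 + ε ^ 2) + 2 * ε * lam i := fun ε i => by
    rw [← hquad]
    exact Finset.sum_nonneg fun j _ => Finset.sum_nonneg fun l _ =>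
      mul_nonneg (hW.nonneg j l) (sq_nonneg _)
  have hle1 : ∀ i, lam i ≤ 1 := fun i => by have := hquad_nn (-1) i; linarith
  have hge : ∀ i, -1 ≤ lam i := fun i => by have := hquad_nn 1 i; linarith
  have hconst : ∀ i, lam i = 1 → ∀ j l, b i j = b i l := fun i hi =>
    hW.eq_of_sum_mul_sq_sub_eq_zero (b i) (by rw [hquad, hi]; norm_num)
  have hsum : ∀ i, lam i ≠ 1 → ∑ j, b i j = 0 := fun i hi => by
    have h1 : lam i * ∑ j, b i j = ∑ j, b i j := by
      rw [Finset.mul_sum]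
      simp_rw [← hev]
      rw [Finset.sum_comm]
      refine Finset.sum_congr rfl fun j _ => ?_
      rw [← Finset.sum_mul, hW.col_sum, one_mul]
    have h2 : (lam i - 1) * ∑ j, b i j = 0 := by linarith
    exact (mul_eq_zero.1 h2).resolve_left (sub_ne_zero.2 hi)
  have horth : ∀ j l, ∑ i, b i j * b i l = if j = l then 1 else 0 := fun j l => by
    have := b.sum_inner_mul_inner (EuclideanSpace.single j (1 : ℝ)) (EuclideanSpace.single l 1)
    simpa [EuclideanSpace.inner_single_left, EuclideanSpace.inner_single_right, Pi.single_apply,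
      eq_comm] using this
  have hnpos : 0 < n := by omega
  -- Eigenvectors for eigenvalues other than 1 have zero coordinate sum. If all were of this kind,
  -- summing the completeness relation over one index would give `1 = 0`.
  obtain ⟨i₀, hi₀⟩ : ∃ i, lam i = 1 := by
    by_contra! hne
    let j₀ : Fin n := ⟨0, hnpos⟩
    have h1 : ∑ l, ∑ i, b i j₀ * b i l = 1 := by simp [horth]
    rw [Finset.sum_comm] at h1
    simp_rw [← Finset.mul_sum] at h1
    simp [hsum _ (hne _)] at h1
  -- Eigenvectors for the eigenvalue 1 are constant, and two constant unit vectors cannot be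
  -- orthogonal.
  have huniq : ∀ i, lam i = 1 → i = i₀ := fun i hi => by
    by_contra hne
    have h1 := hinner i i₀
    have h2 := hinner i i
    have h3 := hinner i₀ i₀
    simp only [hconst i hi _ i₀, hconst i₀ hi₀ _ i₀, hne, if_true, if_false, Finset.sum_const,
      Finset.card_univ, Fintype.card_fin, nsmul_eq_mul] at h1 h2 h3
    have h4 : (n : ℝ) * (b i i₀ * b i i₀) * ((n : ℝ) * (b i₀ i₀ * b i₀ i₀)) = 1 := by
      rw [h2, h3, one_mul]
    have h5 : (n : ℝ) * (b i i₀ * b i i₀) * ((n : ℝ) * (b i₀ i₀ * b i₀ i₀))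
        = ((n : ℝ) * (b i i₀ * b i₀ i₀)) ^ 2 := by ring
    rw [h5, h1] at h4
    norm_num at h4
  set e : Fin (Fintype.card (Fin n)) ≃ Fin n := Fintype.equivOfCardEq (Fintype.card_fin _) with he
  have hlam_e : ∀ k, hH.eigenvalues₀ k = lam (e k) := fun k => by
    simp [hlam, Matrix.IsHermitian.eigenvalues, he]
  -- `eigenvalues₀` is sorted in decreasing order. Its entry 0 is thus the simple eigenvalue 1, and
  -- all other modes lie at or below entry 1, which is `λ₂`.
  have hk0 : ∀ k : Fin (Fintype.card (Fin n)), (k : ℕ) = 0 → e k = i₀ := fun k hk => by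
    refine huniq _ (le_antisymm (hle1 _) ?_)
    rw [← hi₀, ← e.apply_symm_apply i₀, ← hlam_e, ← hlam_e]
    exact hH.eigenvalues₀_antitone (Fin.le_def.2 (by omega))
  set k1 : Fin (Fintype.card (Fin n)) := ⟨1, by simpa using Nat.lt_of_succ_le hn⟩ with hk1
  have hzero : 0 < Fintype.card (Fin n) := by simpa using hnpos
  have hlt : lambda2 W < 1 := by
    rw [hl2, hlam_e]
    refine lt_of_le_of_ne (hle1 _) fun h => ?_
    have h1 := huniq _ h
    rw [← hk0 ⟨0, hzero⟩ rfl] at h1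
    have := congrArg Fin.val (e.injective h1)
    simp at this
  refine ⟨hlt, by rw [hl2, hlam_e]; exact hge _, fun i j => b i j, lam, i₀, ?_⟩
  refine
    { orth := horth
      eigen := fun i l => ?_
      lam_zero := hi₀
      le_lam := hge
      lam_le := fun i hi => ?_
      sum_eq_zero := fun i hi => hsum i fun h => hi (huniq i h)
      zero_mode := fun j => hconst i₀ hi₀ _ _
      zero_mode_sq := ?_ }
  · rw [← hev]
    exact Finset.sum_congr rfl fun j _ => by rw [hW.symm_apply j l, mul_comm]
  · rw [hl2, ← e.apply_symm_apply i, ← hlam_e]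
    refine hH.eigenvalues₀_antitone (Fin.le_def.2 ?_)
    have : ((e.symm i : Fin _) : ℕ) ≠ 0 := fun h => hi (by rw [← hk0 _ h, e.apply_symm_apply])
    change 1 ≤ _
    omega
  · have h3 := hinner i₀ i₀
    simp only [hconst i₀ hi₀ _ i₀, if_true, Finset.sum_const, Finset.card_univ, Fintype.card_fin,
      nsmul_eq_mul] at h3
    rw [sq, h3]

end Spectral

open scoped RealInnerProductSpace

/-! ### Mode components of stacked vectors -/

section Hat

variable {n : ℕ} {H : Type*} [SeminormedAddCommGroup H] [InnerProductSpace ℝ H]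

/-- The components of a stacked vector in a mode basis. -/
def hat (U : Fin n → Fin n → ℝ) : (Fin n → H) →ₗ[ℝ] (Fin n → H) where
  toFun v i := ∑ j, U i j • v j
  map_add' v w := by ext i; simp [Finset.sum_add_distrib]
  map_smul' c v := by
    ext i
    simp only [Pi.smul_apply, RingHom.id_apply, Finset.smul_sum]
    exact Finset.sum_congr rfl fun j _ => smul_comm _ _ _

lemma hat_apply (U : Fin n → Fin n → ℝ) (v : Fin n → H) (i : Fin n) :
    hat U v i = ∑ j, U i j • v j := rfl

/-- The average of a stacked vector. -/
def mean : (Fin n → H) →ₗ[ℝ] H where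
  toFun v := (n : ℝ)⁻¹ • ∑ j, v j
  map_add' v w := by simp [Finset.sum_add_distrib]
  map_smul' c v := by
    simp only [Pi.smul_apply, RingHom.id_apply, ← Finset.smul_sum]
    exact smul_comm _ _ _

lemma mean_apply (v : Fin n → H) : mean v = (n : ℝ)⁻¹ • ∑ j, v j := rfl

lemma norm_sq_mean_le (v : Fin n → H) : n * ‖mean v‖ ^ 2 ≤ ∑ j, ‖v j‖ ^ 2 := by
  rcases Nat.eq_zero_or_pos n with rfl | hn
  · simp
  have hn' : (0 : ℝ) < n := Nat.cast_pos.2 hn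
  have h1 : ‖∑ j, v j‖ ^ 2 ≤ n * ∑ j, ‖v j‖ ^ 2 := by
    calc ‖∑ j, v j‖ ^ 2 ≤ (∑ j, ‖v j‖) ^ 2 := by gcongr; exact norm_sum_le _ _
      _ ≤ _ := by simpa using sq_sum_le_card_mul_sum_sq (s := Finset.univ) (f := fun j => ‖v j‖)
  rw [mean_apply, norm_smul, mul_pow, norm_inv, Real.norm_natCast]
  calc (n : ℝ) * ((n : ℝ)⁻¹ ^ 2 * ‖∑ j, v j‖ ^ 2) = (n : ℝ)⁻¹ * ‖∑ j, v j‖ ^ 2 := by field_simp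
    _ ≤ (n : ℝ)⁻¹ * (n * ∑ j, ‖v j‖ ^ 2) := by gcongr
    _ = _ := by field_simp

lemma inner_mean_eq_zero {v : Fin n → H} {z : H} (h : ∀ j, ⟪z, v j⟫ = 0) : ⟪z, mean v⟫ = 0 := by
  simp [mean_apply, inner_sum, inner_smul_right, h]

lemma inner_hat_eq_zero (U : Fin n → Fin n → ℝ) {v w : Fin n → H} (h : ∀ j l, ⟪v j, w l⟫ = 0)
    (i : Fin n) : ⟪hat U v i, hat U w i⟫ = 0 := by
  simp [hat_apply, sum_inner, inner_sum, inner_smul_left, inner_smul_right, h]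

variable {W : Matrix (Fin n) (Fin n) ℝ} {lam2 : ℝ} {U : Fin n → Fin n → ℝ} {lam : Fin n → ℝ}
  {i₀ : Fin n}

lemma IsModeBasis.sum_norm_sq_hat (hU : IsModeBasis W lam2 U lam i₀) (v : Fin n → H) :
    ∑ i, ‖hat U v i‖ ^ 2 = ∑ j, ‖v j‖ ^ 2 := by
  simp_rw [← real_inner_self_eq_norm_sq, hat_apply, sum_inner, inner_sum, inner_smul_left,
    inner_smul_right]
  rw [Finset.sum_comm]
  refine Finset.sum_congr rfl fun j _ => ?_
  rw [Finset.sum_comm]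
  have : ∀ l, ∑ i, (starRingEnd ℝ) (U i j) * (U i l * ⟪v j, v l⟫)
      = (if j = l then 1 else 0) * ⟪v j, v l⟫ := fun l => by
    rw [← hU.orth, Finset.sum_mul]
    exact Finset.sum_congr rfl fun i _ => by simp [mul_assoc]
  simp_rw [this]
  simp

lemma IsModeBasis.hat_mul (hU : IsModeBasis W lam2 U lam i₀) (v : Fin n → H) (i : Fin n) :
    hat U (fun j => ∑ l, W j l • v l) i = lam i • hat U v i := by
  simp only [hat_apply, Finset.smul_sum, smul_smul]
  rw [Finset.sum_comm]
  refine Finset.sum_congr rfl fun l _ => ?_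
  rw [← Finset.sum_smul, hU.eigen]

lemma IsModeBasis.hat_const (hU : IsModeBasis W lam2 U lam i₀) (v : H) {i : Fin n} (hi : i ≠ i₀) :
    hat U (fun _ => v) i = 0 := by
  rw [hat_apply, ← Finset.sum_smul, hU.sum_eq_zero i hi, zero_smul]

lemma IsModeBasis.hat_zero_mode (hU : IsModeBasis W lam2 U lam i₀) (v : Fin n → H) :
    hat U v i₀ = U i₀ i₀ • ∑ j, v j := by
  rw [hat_apply, Finset.smul_sum]
  exact Finset.sum_congr rfl fun j _ => by rw [hU.zero_mode j]

lemma IsModeBasis.norm_sq_hat_zero_mode (hU : IsModeBasis W lam2 U lam i₀) (v : Fin n → H) :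
    ‖hat U v i₀‖ ^ 2 = n * ‖mean v‖ ^ 2 := by
  have h := hU.zero_mode_sq
  have hn : (n : ℝ) ≠ 0 := fun h0 => by simp [h0] at h
  rw [hU.hat_zero_mode, mean_apply, norm_smul, norm_smul, mul_pow, mul_pow, Real.norm_eq_abs, sq_abs,
    Real.norm_eq_abs, sq_abs, inv_pow, eq_div_of_mul_eq hn ((mul_comm _ _).trans h)]
  field_simp

/-- The deviation from the average, in terms of the modes. -/
lemma IsModeBasis.sum_erase_norm_sq_hat (hU : IsModeBasis W lam2 U lam i₀) (v : Fin n → H) :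
    ∑ i ∈ Finset.univ.erase i₀, ‖hat U v i‖ ^ 2 = ∑ j, ‖v j - mean v‖ ^ 2 := by
  have h := hU.zero_mode_sq
  have hn : (n : ℝ) ≠ 0 := fun h0 => by simp [h0] at h
  set m := mean v with hm
  rw [← hU.sum_norm_sq_hat (fun j => v j - m),
    ← Finset.add_sum_erase _ _ (Finset.mem_univ i₀)]
  have hsub : (fun j => v j - m) = v - fun _ => m := rfl
  have h0 : hat U (fun j => v j - m) i₀ = 0 := by
    rw [hU.hat_zero_mode, Finset.sum_sub_distrib, Finset.sum_const, Finset.card_univ,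
      Fintype.card_fin, ← Nat.cast_smul_eq_nsmul ℝ, hm, mean_apply, smul_smul, mul_inv_cancel₀ hn, one_smul,
      sub_self, smul_zero]
  rw [h0, norm_zero, zero_pow two_ne_zero, zero_add]
  refine Finset.sum_congr rfl fun i hi => ?_
  rw [hsub, map_sub, Pi.sub_apply, hU.hat_const m (Finset.ne_of_mem_erase hi), sub_zero]

end Hat

/-! ### The Lyapunov function in mode coordinates -/

section Lyapunov

variable {ι H : Type*} [SeminormedAddCommGroup H] [InnerProductSpace ℝ H]

lemma norm_add_sq_le_young {H : Type*} [SeminormedAddCommGroup H] (a b : H) {t : ℝ} (ht : 0 < t) :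
    ‖a + b‖ ^ 2 ≤ (1 + t) * ‖a‖ ^ 2 + (1 + 1 / t) * ‖b‖ ^ 2 := by
  have h1 : ‖a + b‖ ^ 2 ≤ (‖a‖ + ‖b‖) ^ 2 := by gcongr; exact norm_add_le a b
  have h2 : t * ‖a‖ ^ 2 + 1 / t * ‖b‖ ^ 2 - 2 * ‖a‖ * ‖b‖ = (t * ‖a‖ - ‖b‖) ^ 2 / t := by
    field_simp
    ring
  have h3 : 0 ≤ (t * ‖a‖ - ‖b‖) ^ 2 / t := by positivity
  nlinarith

lemma norm_add_sq_le_two {H : Type*} [SeminormedAddCommGroup H] (a b : H) :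
    ‖a + b‖ ^ 2 ≤ 2 * ‖a‖ ^ 2 + 2 * ‖b‖ ^ 2 := by
  have := norm_add_sq_le_young a b one_pos
  norm_num at this
  exact this

lemma norm_sub_sq_le_two {H : Type*} [SeminormedAddCommGroup H] (a b : H) :
    ‖a - b‖ ^ 2 ≤ 2 * ‖a‖ ^ 2 + 2 * ‖b‖ ^ 2 := by
  have := norm_add_sq_le_two a (-b)
  rwa [norm_neg, ← sub_eq_add_neg] at this

/-- The energy identity of exact diffusion in a single mode. -/
lemma mode_energy_identity (y u e : H) {θ : ℝ} (h0 : θ ≠ 0) (h1 : 1 - θ ≠ 0) :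
    ‖(1 - θ) • y - θ • e‖ ^ 2 / (1 - θ) + ‖u + θ • (y + e)‖ ^ 2 / θ
      = ‖y + u‖ ^ 2 + (1 - θ) / θ * ‖u‖ ^ 2 + θ / (1 - θ) * ‖e‖ ^ 2 + 2 * ⟪u, e⟫ := by
  simp only [← real_inner_self_eq_norm_sq, inner_add_left, inner_add_right, inner_sub_left,
    inner_sub_right, inner_smul_left, inner_smul_right, real_inner_comm y u, real_inner_comm e u,
    real_inner_comm e y, RCLike.conj_to_real, map_sub, map_one]
  field_simp
  ring

/-- The one-step estimate of the primal-dual energy in a single mode. -/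
lemma mode_energy_step_le {θ m γ : ℝ} {x u r w e ρ y : H} (hmθ : m ≤ θ) (hθγ : θ ≤ γ) (hm : 0 < m)
    (hγ : γ ≤ 1 / 72) (hxw : ⟪x, w⟫ = 0) (hrw : ⟪r, w⟫ = 0) (hue : ⟪u, e⟫ = 0)
    (hy : y = x - u + r - w) :
    ‖(1 - θ) • y - θ • e‖ ^ 2 / (1 - θ) + ‖u + θ • (y + e) + ρ‖ ^ 2 / θ
      ≤ ‖x‖ ^ 2 / (1 - θ) + ‖u‖ ^ 2 / θ - m / 2 * ‖x‖ ^ 2 - 7 / 8 * ‖u‖ ^ 2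
        + 5 / m * ‖r‖ ^ 2 + 1.1 * ‖w‖ ^ 2 + 1.1 * γ * ‖e‖ ^ 2 + 9 / m ^ 2 * ‖ρ‖ ^ 2 := by
  have hθ0 : 0 < θ := hm.trans_le hmθ
  have hθ1 : 0 < 1 - θ := by linarith
  have hm1 : m ≤ 1 / 72 := by linarith
  have hmm : m * m ≤ 1 / 72 * m := by gcongr
  have hθθ : θ * θ ≤ 1 / 72 * θ := by gcongr; linarith
  have hmθ0 : 0 ≤ m * θ := by positivity
  have hid := mode_energy_identity y u e hθ0.ne' hθ1.ne'
  -- The recentred dual variable cancels in `y + u`, and the noise is orthogonal to the rest.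
  have hsum : ‖y + u‖ ^ 2 = ‖x + r‖ ^ 2 + ‖w‖ ^ 2 := by
    have : y + u = (x + r) - w := by rw [hy]; abel
    rw [this, norm_sub_sq_real, inner_add_left, hxw, hrw]
    ring
  -- The energy identity leaves a relative slack of at least `θ ≥ m` in `x`. Young parameters `m /
  -- 4` and `m / 8` use `3 m / 8` of it to first order, so `m / 2` can be kept as decrease.
  have hxr := norm_add_sq_le_young x r (t := m / 4) (by positivity)
  have hup := norm_add_sq_le_young (u + θ • (y + e)) ρ (t := m / 8) (by positivity)
  have hup' : ‖u + θ • (y + e) + ρ‖ ^ 2 / θ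
      ≤ (1 + m / 8) * (‖u + θ • (y + e)‖ ^ 2 / θ) + (1 + 1 / (m / 8)) * (‖ρ‖ ^ 2 / θ) := by
    rw [← mul_div_assoc, ← mul_div_assoc, ← add_div]
    gcongr
  have hxp : 0 ≤ ‖(1 - θ) • y - θ • e‖ ^ 2 / (1 - θ) := by positivity
  have hcρ : (1 + 1 / (m / 8)) * (‖ρ‖ ^ 2 / θ) ≤ 9 / m ^ 2 * ‖ρ‖ ^ 2 := by
    calc (1 + 1 / (m / 8)) * (‖ρ‖ ^ 2 / θ) ≤ (1 / m + 1 / (m / 8)) * (‖ρ‖ ^ 2 / m) := by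
          gcongr
          rw [le_div_iff₀ hm]; linarith
      _ = 9 / m ^ 2 * ‖ρ‖ ^ 2 := by field_simp; ring
  have hcx : (1 + m / 8) * ((1 + m / 4) * ‖x‖ ^ 2) ≤ ‖x‖ ^ 2 / (1 - θ) - m / 2 * ‖x‖ ^ 2 := by
    have h1 : (1 + θ) ≤ 1 / (1 - θ) := by
      rw [le_div_iff₀ hθ1]; linarith [mul_self_nonneg θ]
    have h2 : (1 + m / 8) * (1 + m / 4) ≤ 1 / (1 - θ) - m / 2 := by linarith
    calc (1 + m / 8) * ((1 + m / 4) * ‖x‖ ^ 2) = (1 + m / 8) * (1 + m / 4) * ‖x‖ ^ 2 := by ring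
      _ ≤ (1 / (1 - θ) - m / 2) * ‖x‖ ^ 2 := by gcongr
      _ = _ := by ring
  have hcu : (1 + m / 8) * ((1 - θ) / θ * ‖u‖ ^ 2) ≤ ‖u‖ ^ 2 / θ - 7 / 8 * ‖u‖ ^ 2 := by
    have h2 : (1 + m / 8) * ((1 - θ) / θ) ≤ 1 / θ - 7 / 8 := by
      rw [← mul_div_assoc, div_sub' hθ0.ne', div_le_div_iff_of_pos_right hθ0]
      linarith
    calc (1 + m / 8) * ((1 - θ) / θ * ‖u‖ ^ 2) = (1 + m / 8) * ((1 - θ) / θ) * ‖u‖ ^ 2 := by ring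
      _ ≤ (1 / θ - 7 / 8) * ‖u‖ ^ 2 := by gcongr
      _ = _ := by ring
  have hcr : (1 + m / 8) * ((1 + 1 / (m / 4)) * ‖r‖ ^ 2) ≤ 5 / m * ‖r‖ ^ 2 := by
    rw [← mul_assoc]
    gcongr
    rw [one_div_div, one_add_div hm.ne', ← mul_div_assoc, div_le_div_iff_of_pos_right hm]
    linarith
  have hce : (1 + m / 8) * (θ / (1 - θ) * ‖e‖ ^ 2) ≤ 1.1 * γ * ‖e‖ ^ 2 := by
    rw [← mul_assoc]
    refine mul_le_mul_of_nonneg_right ?_ (sq_nonneg _)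
    rw [← mul_div_assoc, div_le_iff₀ hθ1]
    have h1 : 1.1 * θ * (1 - θ) ≤ 1.1 * γ * (1 - θ) := by gcongr
    have h2 : m * θ ≤ 1 / 72 * θ := by gcongr
    linarith
  have hcw : (1 + m / 8) * ‖w‖ ^ 2 ≤ 1.1 * ‖w‖ ^ 2 := by
    gcongr
    linarith
  rw [hue, hsum] at hid
  calc ‖(1 - θ) • y - θ • e‖ ^ 2 / (1 - θ) + ‖u + θ • (y + e) + ρ‖ ^ 2 / θ
      ≤ (1 + m / 8) * (‖(1 - θ) • y - θ • e‖ ^ 2 / (1 - θ) + ‖u + θ • (y + e)‖ ^ 2 / θ)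
        + 9 / m ^ 2 * ‖ρ‖ ^ 2 := by
        have := mul_nonneg hm.le hxp
        linarith
    _ = (1 + m / 8) * ‖x + r‖ ^ 2 + (1 + m / 8) * ‖w‖ ^ 2
        + (1 + m / 8) * ((1 - θ) / θ * ‖u‖ ^ 2) + (1 + m / 8) * (θ / (1 - θ) * ‖e‖ ^ 2)
        + 9 / m ^ 2 * ‖ρ‖ ^ 2 := by rw [hid]; ring
    _ ≤ _ := by
      have := mul_le_mul_of_nonneg_left hxr (by positivity : 0 ≤ 1 + m / 8)
      linarith

variable [Fintype ι] [DecidableEq ι]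

/-- The primal-dual energy of exact diffusion in the modes other than `i₀`. -/
def modeEnergy (i₀ : ι) (θ : ι → ℝ) (x u : ι → H) : ℝ :=
  ∑ i ∈ Finset.univ.erase i₀, (‖x i‖ ^ 2 / (1 - θ i) + ‖u i‖ ^ 2 / θ i)

/-- The part of the one-step estimate that concerns the primal-dual energy. -/
lemma modeEnergy_step_le {i₀ : ι} {θ : ι → ℝ} {m γ C R N : ℝ} {x u r w e ρ y : ι → H}
    (hθ : ∀ i, i ≠ i₀ → m ≤ θ i ∧ θ i ≤ γ) (hm : 0 < m) (hmγ : m ≤ γ) (hγ : γ ≤ 1 / 72)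
    (hxw : ∀ i, ⟪x i, w i⟫ = 0) (hrw : ∀ i, ⟪r i, w i⟫ = 0) (hue : ∀ i, ⟪u i, e i⟫ = 0)
    (hy : ∀ i, y i = x i - u i + r i - w i)
    (hr : ∑ i, ‖r i‖ ^ 2 ≤ (m / 8) ^ 2 * ∑ i ∈ Finset.univ.erase i₀, ‖x i‖ ^ 2)
    (hw : ∑ i, ‖w i‖ ^ 2 ≤ N) (he : ∑ i, ‖e i‖ ^ 2 ≤ C)
    (hρ : ∑ i ∈ Finset.univ.erase i₀, ‖ρ i‖ ^ 2 ≤ R) :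
    modeEnergy i₀ θ (fun i => (1 - θ i) • y i - θ i • e i)
        (fun i => u i + θ i • (y i + e i) + ρ i)
      ≤ modeEnergy i₀ θ x u - 3 * m / 8 * ∑ i ∈ Finset.univ.erase i₀, ‖x i‖ ^ 2
        - 7 / 8 * ∑ i ∈ Finset.univ.erase i₀, ‖u i‖ ^ 2 + 1.1 * N + 1.1 * γ * C
        + 9 / m ^ 2 * R := by
  have herase : ∀ v : ι → H, ∑ i ∈ Finset.univ.erase i₀, ‖v i‖ ^ 2 ≤ ∑ i, ‖v i‖ ^ 2 := fun v =>
    Finset.sum_le_sum_of_subset_of_nonneg (Finset.erase_subset _ _) fun _ _ _ => sq_nonneg _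
  have hsum := Finset.sum_le_sum fun i (hi : i ∈ Finset.univ.erase i₀) =>
    mode_energy_step_le (ρ := ρ i) (hθ i (Finset.ne_of_mem_erase hi)).1
      (hθ i (Finset.ne_of_mem_erase hi)).2 hm hγ (hxw i) (hrw i) (hue i) (hy i)
  simp only [Finset.sum_add_distrib, Finset.sum_sub_distrib, ← Finset.mul_sum] at hsum
  unfold modeEnergy
  simp only [Finset.sum_add_distrib]
  refine hsum.trans ?_
  set X := ∑ i ∈ Finset.univ.erase i₀, ‖x i‖ ^ 2
  have hX : 0 ≤ X := Finset.sum_nonneg fun _ _ => sq_nonneg _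
  -- The mismatch bound with factor `m / 8` gives `5 / m * (m / 8)² = 5 m / 64`, which takes less
  -- than a quarter of the decrease `m / 2`.
  have h1 : 5 / m * ∑ i ∈ Finset.univ.erase i₀, ‖r i‖ ^ 2 ≤ m / 8 * X := by
    calc 5 / m * ∑ i ∈ Finset.univ.erase i₀, ‖r i‖ ^ 2 ≤ 5 / m * ((m / 8) ^ 2 * X) := by
          gcongr
          exact (herase r).trans hr
      _ = 5 / 64 * (m * X) := by field_simp; ring
      _ ≤ m / 8 * X := by nlinarith [mul_nonneg hm.le hX]
  have h2 : 1.1 * ∑ i ∈ Finset.univ.erase i₀, ‖w i‖ ^ 2 ≤ 1.1 * N := by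
    gcongr
    exact (herase w).trans hw
  have h3 : 1.1 * γ * ∑ i ∈ Finset.univ.erase i₀, ‖e i‖ ^ 2 ≤ 1.1 * γ * C := by
    have : 0 < γ := hm.trans_le hmγ
    gcongr
    exact (herase e).trans he
  have h4 : 9 / m ^ 2 * ∑ i ∈ Finset.univ.erase i₀, ‖ρ i‖ ^ 2 ≤ 9 / m ^ 2 * R := by gcongr
  linarith

/-- The part of the one-step estimate that concerns the compression error, in a single mode. -/
lemma mode_track_step_le {α θ γ : ℝ} {h y e : H} (hα : 0 < α) (hα1 : α ≤ 1) (hθ : 0 ≤ θ)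
    (hθγ : θ ≤ γ) (hye : ⟪y, e⟫ = 0) (hhe : ⟪h, e⟫ = 0) :
    ‖((1 - θ) • y - θ • e) - ((1 - α) • h + α • (y + e))‖ ^ 2
      ≤ (1 - α) * ‖y - h‖ ^ 2 + θ ^ 2 / α * ‖y‖ ^ 2 + (α + γ) ^ 2 * ‖e‖ ^ 2 := by
  have h1 : ((1 - θ) • y - θ • e) - ((1 - α) • h + α • (y + e))
      = ((1 - α) • (y - h) - θ • y) - (α + θ) • e := by module
  have h2 : ⟪(1 - α) • (y - h) - θ • y, (α + θ) • e⟫ = 0 := by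
    simp [inner_sub_left, inner_smul_left, inner_smul_right, hye, hhe]
  -- Strong convexity of the squared norm, in exact form, for the weights `1 - α` and `α` at the
  -- points `y - h` and `-(θ / α) y`. The full contraction factor `1 - α` survives.
  have h3 : ‖(1 - α) • (y - h) - θ • y‖ ^ 2 + (1 - α) * α * ‖(y - h) + (θ / α) • y‖ ^ 2
      = (1 - α) * ‖y - h‖ ^ 2 + θ ^ 2 / α * ‖y‖ ^ 2 := by
    simp only [norm_sub_sq_real ((1 - α) • (y - h)), norm_add_sq_real (y - h), inner_smul_left,
      inner_smul_right, norm_smul, mul_pow, Real.norm_eq_abs, sq_abs, RCLike.conj_to_real]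
    field_simp
    ring
  have h4 : 0 ≤ (1 - α) * α * ‖(y - h) + (θ / α) • y‖ ^ 2 :=
    mul_nonneg (mul_nonneg (by linarith) hα.le) (sq_nonneg _)
  have h5 : (α + θ) ^ 2 * ‖e‖ ^ 2 ≤ (α + γ) ^ 2 * ‖e‖ ^ 2 := by gcongr
  rw [h1, norm_sub_sq_real, h2, norm_smul, mul_pow, Real.norm_eq_abs, sq_abs]
  linarith

/-- The compressor acts on `y - h`, whereas the Lyapunov function measures `x - h`. Passing from one
to the other costs a factor `1 + α / 2`, small enough for the contraction of `h` to absorb. -/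
lemma mode_lag_sq_le {α : ℝ} {x u r w h y : H} (hα : 0 < α) (hα1 : α ≤ 1)
    (hxw : ⟪x, w⟫ = 0) (huw : ⟪u, w⟫ = 0) (hrw : ⟪r, w⟫ = 0) (hhw : ⟪h, w⟫ = 0)
    (hy : y = x - u + r - w) :
    ‖y - h‖ ^ 2 ≤ (1 + α / 2) * ‖x - h‖ ^ 2 + 6 / α * (‖r‖ ^ 2 + ‖u‖ ^ 2) + ‖w‖ ^ 2 := by
  have h1 : y - h = ((x - h) + (r - u)) - w := by rw [hy]; abel
  have h2 : ⟪(x - h) + (r - u), w⟫ = 0 := by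
    simp [inner_sub_left, inner_add_left, hxw, huw, hrw, hhw]
  have h3 := norm_add_sq_le_young (x - h) (r - u) (t := α / 2) (by positivity)
  have h4 := norm_sub_sq_le_two r u
  have h5 : 1 + 1 / (α / 2) ≤ 3 / α := by
    rw [one_div_div, one_add_div hα.ne', div_le_div_iff_of_pos_right hα]
    linarith
  have h6 : (1 + 1 / (α / 2)) * ‖r - u‖ ^ 2 ≤ 3 / α * (2 * ‖r‖ ^ 2 + 2 * ‖u‖ ^ 2) := by gcongr
  have h7 : 3 / α * (2 * ‖r‖ ^ 2 + 2 * ‖u‖ ^ 2) = 6 / α * (‖r‖ ^ 2 + ‖u‖ ^ 2) := by ring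
  rw [h1, norm_sub_sq_real, h2]
  linarith

lemma mode_norm_sq_le {x u r w y : H} (hxw : ⟪x, w⟫ = 0) (hrw : ⟪r, w⟫ = 0)
    (hy : y = x - u + r - w) :
    ‖y‖ ^ 2 ≤ 4 * ‖x‖ ^ 2 + 4 * ‖r‖ ^ 2 + 2 * ‖w‖ ^ 2 + 2 * ‖u‖ ^ 2 := by
  have h1 : y = ((x + r) - w) - u := by rw [hy]; abel
  have h2 : ‖(x + r) - w‖ ^ 2 = ‖x + r‖ ^ 2 + ‖w‖ ^ 2 := by
    rw [norm_sub_sq_real, inner_add_left, hxw, hrw]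
    ring
  have h3 := norm_sub_sq_le_two ((x + r) - w) u
  have h4 := norm_add_sq_le_two x r
  rw [← h1] at h3
  linarith

/-- The weight of the compression error in the Lyapunov function. -/
def trackWeight (C α γ : ℝ) : ℝ := 5 * (γ * C) / α

/-- The Lyapunov function: the primal-dual energy, and the weighted compression error. -/
def lyapunov (i₀ : ι) (θ : ι → ℝ) (κ : ℝ) (x u h : ι → H) : ℝ :=
  modeEnergy i₀ θ x u + κ * ∑ i, ‖x i - h i‖ ^ 2

/-- The factor 5 in the weight turns the compression cost `1.1 γ C` of the energy into `0.22 α`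
times the weight. The compression error entering `h` costs another `0.09 α`, because `α C = 1 / 12`
and `γ ≤ α / 72`. Of the contraction `α` there remains `0.69 α`, more than the `α / 2` lost in
`mode_lag_sq_le`. -/
lemma lyapunov_coeff_bounds {m α γ C : ℝ} (hm : 0 < m) (hmγ : m ≤ γ) (hα : 0 < α) (hα1 : α ≤ 1)
    (hαC : α * C = 1 / 12) (hγC : 864 * (γ * (γ * C)) = α ^ 2 * m) :
    0 < C ∧ trackWeight C α γ ≤ 0.006 ∧ 0 ≤ trackWeight C α γ ∧
      1.1 * γ * C + trackWeight C α γ * ((1 - α) + (α + γ) ^ 2 * C)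
        ≤ trackWeight C α γ * (1 - 0.69 * α) ∧
      trackWeight C α γ * (6 / α) ≤ 0.035 ∧
      trackWeight C α γ * (γ ^ 2 / α) = 5 * γ * m / 864 := by
  have hC : 0 < C := pos_of_mul_pos_right (by rw [hαC]; norm_num) hα.le
  have hγ0 : 0 < γ := hm.trans_le hmγ
  set g := γ * C with hg
  have hg0 : 0 < g := mul_pos hγ0 hC
  have hg1 : 864 * g ≤ α ^ 2 := by
    by_contra! h
    have : γ * α ^ 2 < γ * (864 * g) := by gcongr
    have : α ^ 2 * m ≤ α ^ 2 * γ := by gcongr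
    linarith
  have hαsq : α ^ 2 ≤ α := by nlinarith
  have hκ : trackWeight C α γ = 5 * g / α := rfl
  have hκ0 : 0 ≤ trackWeight C α γ := by rw [hκ]; positivity
  have hγα : γ ≤ α / 72 := by
    -- Here `12 α C = 1` is inserted, so the bound on `g = γ C` becomes one on `γ / α`.
    have : γ = 12 * α * g := by rw [hg]; linear_combination -12 * γ * hαC
    have : α * (864 * g) ≤ α * α ^ 2 := by gcongr
    have : α * α ^ 2 ≤ α * 1 := by gcongr; linarith
    linarith
  refine ⟨hC, ?_, hκ0, ?_, ?_, ?_⟩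
  · rw [hκ, div_le_iff₀ hα]
    linarith
  · have h1 : 1.1 * γ * C = trackWeight C α γ * (0.22 * α) := by
      rw [hκ, div_mul_eq_mul_div, eq_div_iff hα.ne', hg]
      ring
    have h2 : (α + γ) ^ 2 * C ≤ 0.09 * α := by
      have h3 : (α + γ) ^ 2 ≤ (α + α / 72) ^ 2 := by gcongr
      calc (α + γ) ^ 2 * C ≤ (α + α / 72) ^ 2 * C := by gcongr
        _ = (73 / 72) ^ 2 * α * (α * C) := by ring
        _ ≤ 0.09 * α := by rw [hαC]; linarith
    rw [h1, ← mul_add]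
    gcongr
    linarith
  · rw [hκ, div_mul_div_comm, div_le_iff₀ (by positivity)]
    linarith
  · rw [hκ, div_mul_div_comm, div_eq_div_iff (by positivity) (by norm_num)]
    linear_combination 5 * γ * hγC

/-- The energy decrease in `x` and `u` absorbs the terms created by the tracking error. Only `u₀`,
the dual component in the consensus mode, is not damped by the energy, so it stays on the right-hand
side. -/
lemma lyapunov_combine {m α γ C R N X Ue Ye Q D E Rr u₀ V V' D' : ℝ}
    (hm : 0 < m) (hmγ : m ≤ γ) (hγ : γ ≤ 1 / 72) (hα : 0 < α) (hα1 : α ≤ 1)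
    (hαC : α * C = 1 / 12) (hγC : 864 * (γ * (γ * C)) = α ^ 2 * m) (hX : 0 ≤ X) (hU : 0 ≤ Ue)
    (hYe0 : 0 ≤ Ye) (hQ0 : 0 ≤ Q) (hD0 : 0 ≤ D) (hRr0 : 0 ≤ Rr) (hu₀ : 0 ≤ u₀) (hN0 : 0 ≤ N)
    (hV : V' ≤ V - 3 * m / 8 * X - 7 / 8 * Ue + 1.1 * N + 1.1 * γ * (C * Q) + 9 / m ^ 2 * R)
    (hD : D' ≤ (1 - α) * Q + γ ^ 2 / α * Ye + (α + γ) ^ 2 * E)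
    (hQ : Q ≤ (1 + α / 2) * D + 6 / α * (Rr + (u₀ + Ue)) + N)
    (hY : Ye ≤ 4 * X + 4 * Rr + 2 * N + 2 * Ue) (hE : E ≤ C * Q) (hr : Rr ≤ (m / 8) ^ 2 * X) :
    V' + trackWeight C α γ * D'
      ≤ V + trackWeight C α γ * D - m / 3 * X + 0.1 * u₀ + 2 * N + 9 / m ^ 2 * R := by
  obtain ⟨hC, hκ1, hκ0, hκQ, hκu, hκx⟩ := lyapunov_coeff_bounds hm hmγ hα hα1 hαC hγC
  generalize trackWeight C α γ = κ at *
  have hm1 : m ≤ 1 / 72 := hmγ.trans hγ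
  have hmm : (m / 8) ^ 2 ≤ m / 4000 := by
    have : m * m ≤ 1 / 72 * m := by gcongr
    linarith
  have hRr : Rr ≤ m / 4000 * X := hr.trans (by gcongr)
  have hmX : m * X ≤ 1 / 72 * X := by gcongr
  have hYe : Ye ≤ 5 * X + 2 * N + 2 * Ue := by linarith
  have hQ' : κ * (1 - 0.69 * α) * Q
      ≤ κ * D + 0.035 * (m / 4000 * X + (u₀ + Ue)) + 0.006 * N := by
    have h1 : (1 - 0.69 * α) * Q
        ≤ (1 - 0.69 * α) * ((1 + α / 2) * D + 6 / α * (Rr + (u₀ + Ue)) + N) :=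
      mul_le_mul_of_nonneg_left hQ (by linarith)
    -- This is where the contraction of the references beats the loss from replacing `y - h` by `x -
    -- h`.
    have h2 : (1 - 0.69 * α) * (1 + α / 2) ≤ 1 := by linarith [mul_self_nonneg α]
    have h3 : (1 - 0.69 * α) * ((1 + α / 2) * D) ≤ D := by
      rw [← mul_assoc]; exact mul_le_of_le_one_left hD0 h2
    have h4 : 0 ≤ 6 / α * (Rr + (u₀ + Ue)) := by positivity
    have h5 : (1 - 0.69 * α) * (6 / α * (Rr + (u₀ + Ue)) + N)
        ≤ 6 / α * (Rr + (u₀ + Ue)) + N :=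
      mul_le_of_le_one_left (by positivity) (by linarith)
    have h6 : κ * (6 / α) * (Rr + (u₀ + Ue)) ≤ 0.035 * (m / 4000 * X + (u₀ + Ue)) := by
      gcongr
    have h7 : κ * N ≤ 0.006 * N := by gcongr
    calc κ * (1 - 0.69 * α) * Q = κ * ((1 - 0.69 * α) * Q) := by ring
      _ ≤ κ * (D + (6 / α * (Rr + (u₀ + Ue)) + N)) := by gcongr; linarith
      _ = κ * D + κ * (6 / α) * (Rr + (u₀ + Ue)) + κ * N := by ring
      _ ≤ _ := by linarith
  have hκY : κ * (γ ^ 2 / α) * Ye ≤ m / 10000 * (5 * X + 2 * N + 2 * Ue) := by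
    have : γ * m ≤ 1 / 72 * m := by gcongr
    exact mul_le_mul (by rw [hκx]; linarith) hYe hYe0 (by positivity)
  have hκE : κ * ((α + γ) ^ 2 * E) ≤ κ * ((α + γ) ^ 2 * (C * Q)) := by gcongr
  have hκD := mul_le_mul_of_nonneg_left hD hκ0
  have hκQ' := mul_le_mul_of_nonneg_right hκQ hQ0
  have hmN : m * N ≤ 1 / 72 * N := by gcongr
  have hmU : m * Ue ≤ 1 / 72 * Ue := by gcongr
  linarith

/-- The one-step estimate of the Lyapunov function. -/
theorem lyapunov_step_le {i₀ : ι} {θ : ι → ℝ} {m α γ C R N : ℝ} {x u r w e h ρ y : ι → H}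
    (hθ₀ : θ i₀ = 0) (hθ : ∀ i, i ≠ i₀ → m ≤ θ i ∧ θ i ≤ γ) (hm : 0 < m) (hmγ : m ≤ γ)
    (hγ : γ ≤ 1 / 72) (hα : 0 < α) (hα1 : α ≤ 1) (hαC : α * C = 1 / 12)
    (hγC : 864 * (γ * (γ * C)) = α ^ 2 * m)
    (hxw : ∀ i, ⟪x i, w i⟫ = 0) (huw : ∀ i, ⟪u i, w i⟫ = 0) (hrw : ∀ i, ⟪r i, w i⟫ = 0)
    (hhw : ∀ i, ⟪h i, w i⟫ = 0) (hue : ∀ i, ⟪u i, e i⟫ = 0) (hye : ∀ i, ⟪y i, e i⟫ = 0)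
    (hhe : ∀ i, ⟪h i, e i⟫ = 0) (hy : ∀ i, y i = x i - u i + r i - w i)
    (hr : ∑ i, ‖r i‖ ^ 2 ≤ (m / 8) ^ 2 * ∑ i ∈ Finset.univ.erase i₀, ‖x i‖ ^ 2)
    (hw : ∑ i, ‖w i‖ ^ 2 ≤ N) (he : ∑ i, ‖e i‖ ^ 2 ≤ C * ∑ i, ‖y i - h i‖ ^ 2)
    (hρ : ∑ i ∈ Finset.univ.erase i₀, ‖ρ i‖ ^ 2 ≤ R) :
    lyapunov i₀ θ (trackWeight C α γ) (fun i => (1 - θ i) • y i - θ i • e i)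
        (fun i => u i + θ i • (y i + e i) + ρ i) (fun i => (1 - α) • h i + α • (y i + e i))
      ≤ lyapunov i₀ θ (trackWeight C α γ) x u h
        - m / 3 * ∑ i ∈ Finset.univ.erase i₀, ‖x i‖ ^ 2 + 0.1 * ‖u i₀‖ ^ 2 + 2 * N
        + 9 / m ^ 2 * R := by
  have hγ0 : 0 < γ := hm.trans_le hmγ
  have hV := modeEnergy_step_le hθ hm hmγ hγ hxw hrw hue hy hr hw he hρ
  have hθ' : ∀ i, 0 ≤ θ i ∧ θ i ≤ γ := fun i => by
    by_cases hi : i = i₀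
    · rw [hi, hθ₀]; exact ⟨le_rfl, hγ0.le⟩
    · exact ⟨hm.le.trans (hθ i hi).1, (hθ i hi).2⟩
  have hD := Finset.sum_le_sum fun i (_ : i ∈ Finset.univ) =>
    mode_track_step_le hα hα1 (hθ' i).1 (hθ' i).2 (hye i) (hhe i)
  have hQ := Finset.sum_le_sum fun i (_ : i ∈ Finset.univ) =>
    mode_lag_sq_le hα hα1 (hxw i) (huw i) (hrw i) (hhw i) (hy i)
  have hY := Finset.sum_le_sum fun i (_ : i ∈ Finset.univ.erase i₀) =>
    mode_norm_sq_le (hxw i) (hrw i) (hy i)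
  -- The consensus component of `y` is not controlled by the energy, but its coefficient vanishes
  -- since `θ i₀ = 0`.
  have hYθ : ∑ i, θ i ^ 2 / α * ‖y i‖ ^ 2
      ≤ γ ^ 2 / α * ∑ i ∈ Finset.univ.erase i₀, ‖y i‖ ^ 2 := by
    rw [← Finset.add_sum_erase _ _ (Finset.mem_univ i₀), hθ₀, Finset.mul_sum]
    simp only [ne_eq, OfNat.ofNat_ne_zero, not_false_eq_true, zero_pow, zero_div, zero_mul,
      zero_add]
    refine Finset.sum_le_sum fun i _ => ?_
    have := (hθ' i).1
    have := (hθ' i).2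
    gcongr
  have herase : ∀ v : ι → H, ∑ i ∈ Finset.univ.erase i₀, ‖v i‖ ^ 2 ≤ ∑ i, ‖v i‖ ^ 2 := fun v =>
    Finset.sum_le_sum_of_subset_of_nonneg (Finset.erase_subset _ _) fun _ _ _ => sq_nonneg _
  have hr' := herase r
  have hw' := herase w
  have hu' := Finset.add_sum_erase Finset.univ (fun i => ‖u i‖ ^ 2) (Finset.mem_univ i₀)
  simp only [Finset.sum_add_distrib, ← Finset.mul_sum] at hD hQ hY
  rw [← hu'] at hQ
  refine lyapunov_combine hm hmγ hγ hα hα1 hαC hγC (Finset.sum_nonneg fun _ _ => sq_nonneg _)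
    (Finset.sum_nonneg fun _ _ => sq_nonneg _) (Finset.sum_nonneg fun _ _ => sq_nonneg _)
    (Finset.sum_nonneg fun _ _ => sq_nonneg _) (Finset.sum_nonneg fun _ _ => sq_nonneg _)
    (Finset.sum_nonneg fun _ _ => sq_nonneg _) (sq_nonneg _)
    ((Finset.sum_nonneg fun _ _ => sq_nonneg _).trans hw) hV
    (hD.trans (by gcongr)) (hQ.trans (by gcongr)) (hY.trans (by gcongr; exact hw'.trans hw)) he hr

end Lyapunov

/-! ### One step of the algorithm in an abstract Hilbert space -/

section Network

variable {n : ℕ} {H : Type*} [SeminormedAddCommGroup H] [InnerProductSpace ℝ H]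
  {W : Matrix (Fin n) (Fin n) ℝ} {lam2 : ℝ} {U : Fin n → Fin n → ℝ} {lam : Fin n → ℝ} {i₀ : Fin n}

/-- The Lyapunov function of the algorithm for the solutions `X`, the dual variables `D`, the
compression references `Hc` and the gradients `Gb` at the average. -/
def networkLyapunov (U : Fin n → Fin n → ℝ) (lam : Fin n → ℝ) (i₀ : Fin n) (C α γ η : ℝ)
    (X D Hc Gb : Fin n → H) : ℝ :=
  lyapunov i₀ (fun i => γ / 2 * (1 - lam i)) (trackWeight C α γ) (hat U X) (hat U (D + η • Gb))
    (hat U Hc)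

lemma IsModeBasis.card_pos (hU : IsModeBasis W lam2 U lam i₀) : (0 : ℝ) < n := by
  have h := hU.zero_mode_sq
  have : (n : ℝ) ≠ 0 := fun h0 => by simp [h0] at h
  exact lt_of_le_of_ne (Nat.cast_nonneg n) this.symm

/-- The algorithm never changes the average of the dual variables. -/
lemma mean_dual_step (hsymm : ∀ i l, W i l = W l i) (hrow : ∀ i, ∑ l, W i l = 1) (a : ℝ)
    (D Yh : Fin n → H) :
    mean (D + a • (Yh - fun j => ∑ l, W j l • Yh l)) = mean D := by
  have h : ∑ j, ∑ l, W j l • Yh l = ∑ l, Yh l := by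
    rw [Finset.sum_comm]
    refine Finset.sum_congr rfl fun l _ => ?_
    rw [← Finset.sum_smul, Finset.sum_congr rfl fun j _ => hsymm j l, hrow, one_smul]
  rw [map_add, map_smul, map_sub, mean_apply (fun j => ∑ l, W j l • Yh l), h, ← mean_apply,
    sub_self, smul_zero, add_zero]

theorem networkLyapunov_step_le (hU : IsModeBasis W lam2 U lam i₀) {m α γ C η L σ : ℝ}
    (hlam2 : lam2 < 1) (hlam2' : -1 ≤ lam2) (hm : m = γ * (1 - lam2) / 2) (hγ0 : 0 < γ)
    (hγ : γ ≤ 1 / 72) (hα : 0 < α) (hα1 : α ≤ 1) (hαC : α * C = 1 / 12)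
    (hγC : 864 * (γ * (γ * C)) = α ^ 2 * m) (hη : 0 ≤ η) (hL : 0 ≤ L) (hηL : η * L ≤ m / 8)
    {X D Hc Gr Gb Gb' w e Y D' X' H' : Fin n → H}
    (hY : Y = X - η • (Gr + w) - D)
    (hD' : D' = D + (γ / 2) • ((Y + e) - fun j => ∑ l, W j l • (Y + e) l))
    (hX' : X' = X - η • (Gr + w) - D') (hH' : H' = (1 - α) • Hc + α • (Y + e))
    (hD0 : mean D = 0) (hD'0 : mean D' = 0)
    (hXw : ∀ j l, ⟪X j, w l⟫ = 0) (hDw : ∀ j l, ⟪D j, w l⟫ = 0) (hHw : ∀ j l, ⟪Hc j, w l⟫ = 0)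
    (hGrw : ∀ j l, ⟪Gr j, w l⟫ = 0) (hGbw : ∀ j l, ⟪Gb j, w l⟫ = 0)
    (hDe : ∀ j l, ⟪D j, e l⟫ = 0) (hGbe : ∀ j l, ⟪Gb j, e l⟫ = 0) (hYe : ∀ j l, ⟪Y j, e l⟫ = 0)
    (hHe : ∀ j l, ⟪Hc j, e l⟫ = 0)
    (hGr : ∀ j, ‖Gr j - Gb j‖ ≤ L * ‖X j - mean X‖)
    (hGb : ∀ j, ‖Gb' j - Gb j‖ ≤ L * ‖mean X' - mean X‖)
    (hw : ∀ j, ‖w j‖ ^ 2 ≤ σ ^ 2) (hwm : n * ‖mean w‖ ^ 2 ≤ σ ^ 2)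
    (he : ∑ j, ‖e j‖ ^ 2 ≤ C * ∑ j, ‖Y j - Hc j‖ ^ 2) :
    networkLyapunov U lam i₀ C α γ η X' D' H' Gb'
      ≤ networkLyapunov U lam i₀ C α γ η X D Hc Gb - m / 4 * ∑ j, ‖X j - mean X‖ ^ 2
        + 1 / 2 * (η ^ 2 * (n * ‖mean Gb‖ ^ 2)) + 3 * (η ^ 2 * (n * σ ^ 2)) := by
  have hn := hU.card_pos
  have hn1 : (1 : ℝ) ≤ n := by exact_mod_cast Nat.cast_pos.1 hn
  have hm0 : 0 < m := by
    have : 0 < 1 - lam2 := by linarith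
    rw [hm]; positivity
  have hmγ : m ≤ γ := by
    calc m = γ / 2 * (1 - lam2) := by rw [hm]; ring
      _ ≤ γ / 2 * (1 - -1) := by gcongr
      _ = γ := by ring
  set r : Fin n → H := -(η • (Gr - Gb)) with hr_def
  set Xc := ∑ j, ‖X j - mean X‖ ^ 2 with hXc
  have hXc0 : 0 ≤ Xc := Finset.sum_nonneg fun _ _ => sq_nonneg _
  have hYr : Y = X - (D + η • Gb) + r - η • w := by rw [hY, hr_def]; module
  have hGsum : ∑ j, ‖Gr j - Gb j‖ ^ 2 ≤ L ^ 2 * Xc := by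
    rw [hXc, Finset.mul_sum]
    refine Finset.sum_le_sum fun j _ => ?_
    rw [← mul_pow]
    exact pow_le_pow_left₀ (norm_nonneg _) (hGr j) 2
  have hηL2 : η ^ 2 * L ^ 2 ≤ (m / 8) ^ 2 := by
    rw [← mul_pow]; exact pow_le_pow_left₀ (by positivity) hηL 2
  have hr : ∑ i, ‖hat U r i‖ ^ 2
      ≤ (m / 8) ^ 2 * ∑ i ∈ Finset.univ.erase i₀, ‖hat U X i‖ ^ 2 := by
    rw [hU.sum_norm_sq_hat, hU.sum_erase_norm_sq_hat, ← hXc]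
    calc ∑ j, ‖r j‖ ^ 2 = η ^ 2 * ∑ j, ‖Gr j - Gb j‖ ^ 2 := by
          rw [Finset.mul_sum]
          exact Finset.sum_congr rfl fun j _ => by
            simp [hr_def, norm_smul, mul_pow]
      _ ≤ η ^ 2 * (L ^ 2 * Xc) := by gcongr
      _ = η ^ 2 * L ^ 2 * Xc := by ring
      _ ≤ _ := by gcongr
  have hwN : ∑ i, ‖hat U (η • w) i‖ ^ 2 ≤ η ^ 2 * (n * σ ^ 2) := by
    rw [hU.sum_norm_sq_hat]
    calc ∑ j, ‖(η • w) j‖ ^ 2 = η ^ 2 * ∑ j, ‖w j‖ ^ 2 := by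
          rw [Finset.mul_sum]
          exact Finset.sum_congr rfl fun j _ => by simp [norm_smul, mul_pow]
      _ ≤ η ^ 2 * ∑ _j : Fin n, σ ^ 2 := by
          gcongr η ^ 2 * ?_; exact Finset.sum_le_sum fun j _ => hw j
      _ = _ := by simp
  have heH : ∑ i, ‖hat U e i‖ ^ 2 ≤ C * ∑ i, ‖hat U Y i - hat U Hc i‖ ^ 2 := by
    have : ∑ i, ‖hat U Y i - hat U Hc i‖ ^ 2 = ∑ j, ‖Y j - Hc j‖ ^ 2 := by
      rw [← hU.sum_norm_sq_hat fun j => Y j - Hc j, show (fun j => Y j - Hc j) = Y - Hc from rfl,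
        map_sub]
      rfl
    rwa [hU.sum_norm_sq_hat, this]
  -- The average is moved neither by the dual variables nor by compression, because the dual mean
  -- stays zero.
  have hstep : mean X' - mean X = -(η • (mean Gr + mean w)) := by
    rw [hX', map_sub, map_sub, map_smul, map_add, hD'0]; abel
  have hGrw' : ⟪mean Gr, mean w⟫ = 0 := by
    refine inner_mean_eq_zero fun l => ?_
    rw [real_inner_comm]
    exact inner_mean_eq_zero fun j => by rw [real_inner_comm]; exact hGrw j l
  have hmeanGr : n * ‖mean Gr‖ ^ 2 ≤ 2 * (n * ‖mean Gb‖ ^ 2) + 2 * (L ^ 2 * Xc) := by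
    have h1 : mean Gr = mean Gb + mean (Gr - Gb) := by rw [map_sub]; abel
    have h2 := norm_add_sq_le_two (mean Gb) (mean (Gr - Gb))
    rw [← h1] at h2
    have h3 := (norm_sq_mean_le (Gr - Gb)).trans hGsum
    have h4 := mul_le_mul_of_nonneg_left h2 hn.le
    linarith
  have hρ : ∑ i ∈ Finset.univ.erase i₀, ‖hat U (η • (Gb' - Gb)) i‖ ^ 2
      ≤ η ^ 2 * L ^ 2 * (η ^ 2 * (2 * (n * ‖mean Gb‖ ^ 2) + 2 * (L ^ 2 * Xc) + σ ^ 2)) := by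
    have h1 : ∀ j, ‖(η • (Gb' - Gb)) j‖ ^ 2 ≤ η ^ 2 * (L ^ 2 * ‖mean X' - mean X‖ ^ 2) := fun j => by
      rw [Pi.smul_apply, norm_smul, mul_pow, Real.norm_eq_abs, sq_abs, ← mul_pow L]
      gcongr
      exact hGb j
    calc ∑ i ∈ Finset.univ.erase i₀, ‖hat U (η • (Gb' - Gb)) i‖ ^ 2
        ≤ ∑ i, ‖hat U (η • (Gb' - Gb)) i‖ ^ 2 :=
          Finset.sum_le_sum_of_subset_of_nonneg (Finset.erase_subset _ _) fun _ _ _ => sq_nonneg _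
      _ = ∑ j, ‖(η • (Gb' - Gb)) j‖ ^ 2 := hU.sum_norm_sq_hat _
      _ ≤ ∑ _j : Fin n, η ^ 2 * (L ^ 2 * ‖mean X' - mean X‖ ^ 2) :=
          Finset.sum_le_sum fun j _ => h1 j
      _ = η ^ 2 * L ^ 2 * (n * ‖mean X' - mean X‖ ^ 2) := by simp; ring
      _ = η ^ 2 * L ^ 2 * (η ^ 2 * (n * ‖mean Gr‖ ^ 2 + n * ‖mean w‖ ^ 2)) := by
          rw [hstep, norm_neg, norm_smul, mul_pow, Real.norm_eq_abs, sq_abs, norm_add_sq_real,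
            hGrw']
          ring
      _ ≤ _ := by gcongr
  have hθ : ∀ i, i ≠ i₀ → m ≤ γ / 2 * (1 - lam i) ∧ γ / 2 * (1 - lam i) ≤ γ := fun i hi => by
    have h1 := hU.lam_le i hi
    have h2 := hU.le_lam i
    constructor
    · calc m = γ / 2 * (1 - lam2) := by rw [hm]; ring
        _ ≤ γ / 2 * (1 - lam i) := by gcongr
    · calc γ / 2 * (1 - lam i) ≤ γ / 2 * (1 - -1) := by gcongr
        _ = γ := by ring
  have horth_u : ∀ j l, ⟪(D + η • Gb) j, (η • w) l⟫ = 0 := fun j l => by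
    simp [inner_add_left, inner_smul_left, inner_smul_right, hDw, hGbw]
  have hmain := lyapunov_step_le (i₀ := i₀) (θ := fun i => γ / 2 * (1 - lam i)) (m := m) (α := α)
    (γ := γ) (C := C) (x := hat U X) (u := hat U (D + η • Gb)) (r := hat U r) (w := hat U (η • w))
    (e := hat U e) (h := hat U Hc) (ρ := hat U (η • (Gb' - Gb))) (y := hat U Y)
    (by rw [hU.lam_zero]; ring) hθ hm0 hmγ hγ hα hα1 hαC hγC
    (inner_hat_eq_zero U fun j l => by simp [inner_smul_right, hXw])
    (inner_hat_eq_zero U horth_u)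
    (inner_hat_eq_zero U fun j l => by
      simp [hr_def, inner_sub_left, inner_smul_left, inner_smul_right, hGrw, hGbw])
    (inner_hat_eq_zero U fun j l => by simp [inner_smul_right, hHw])
    (inner_hat_eq_zero U fun j l => by simp [inner_add_left, inner_smul_left, hDe, hGbe])
    (inner_hat_eq_zero U hYe) (inner_hat_eq_zero U hHe)
    (fun i => by conv_lhs => rw [hYr]
                 simp only [map_sub, map_add, Pi.sub_apply, Pi.add_apply])
    hr hwN heH hρ
  have hmix : ∀ i, hat U ((Y + e) - fun j => ∑ l, W j l • (Y + e) l) i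
      = (1 - lam i) • (hat U Y i + hat U e i) := fun i => by
    rw [map_sub, Pi.sub_apply, hU.hat_mul, map_add, Pi.add_apply, sub_smul, one_smul]
  have hxi : hat U X' = fun i => (1 - γ / 2 * (1 - lam i)) • hat U Y i
      - (γ / 2 * (1 - lam i)) • hat U e i := by
    have : X' = Y - (γ / 2) • ((Y + e) - fun j => ∑ l, W j l • (Y + e) l) := by
      rw [hX', hD', hY]; abel
    rw [this]
    ext i
    rw [map_sub, map_smul, Pi.sub_apply, Pi.smul_apply, hmix]
    module
  have hui : hat U (D' + η • Gb') = fun i => hat U (D + η • Gb) i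
      + (γ / 2 * (1 - lam i)) • (hat U Y i + hat U e i) + hat U (η • (Gb' - Gb)) i := by
    have : D' + η • Gb' = (D + η • Gb)
        + (γ / 2) • ((Y + e) - fun j => ∑ l, W j l • (Y + e) l) + η • (Gb' - Gb) := by
      rw [hD']; module
    rw [this]
    ext i
    rw [map_add, map_add, Pi.add_apply, Pi.add_apply, map_smul (hat U) (γ / 2), Pi.smul_apply, hmix,
      smul_smul]
  have hhi : hat U H' = fun i => (1 - α) • hat U Hc i + α • (hat U Y i + hat U e i) := by
    rw [hH']
    ext i
    simp only [map_add, map_smul, Pi.add_apply, Pi.smul_apply]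
  unfold networkLyapunov
  rw [hxi, hui, hhi]
  refine hmain.trans ?_
  -- The undamped consensus component of the recentred dual variable is just `η` times the average
  -- gradient; this is the source of the gradient term in the bound.
  have hmu : ‖mean (D + η • Gb)‖ ^ 2 = η ^ 2 * ‖mean Gb‖ ^ 2 := by
    rw [map_add, map_smul, hD0, zero_add, norm_smul, mul_pow, Real.norm_eq_abs, sq_abs]
  rw [hU.sum_erase_norm_sq_hat, hU.norm_sq_hat_zero_mode, hmu, ← hXc]
  -- The drift term carries `9 / m²`, but its size has a factor `(η L)² ≤ (m / 8)²`, so the singular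
  -- factor disappears.
  have hT : 9 / m ^ 2 * (η ^ 2 * L ^ 2
        * (η ^ 2 * (2 * (n * ‖mean Gb‖ ^ 2) + 2 * (L ^ 2 * Xc) + σ ^ 2)))
      ≤ 9 / 64 * (η ^ 2 * (2 * (n * ‖mean Gb‖ ^ 2) + 2 * (L ^ 2 * Xc) + σ ^ 2)) := by
    rw [← mul_assoc]
    gcongr
    calc 9 / m ^ 2 * (η ^ 2 * L ^ 2) ≤ 9 / m ^ 2 * (m / 8) ^ 2 := by gcongr
      _ = 9 / 64 := by field_simp; norm_num
  have hX1 : η ^ 2 * L ^ 2 * Xc ≤ m / 4000 * Xc := by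
    refine mul_le_mul_of_nonneg_right (hηL2.trans ?_) hXc0
    have : m * m ≤ 1 / 72 * m := by gcongr; exact hmγ.trans hγ
    linarith
  have hσ1 : η ^ 2 * σ ^ 2 ≤ η ^ 2 * (n * σ ^ 2) := by
    gcongr
    exact le_mul_of_one_le_left (sq_nonneg _) hn1
  have hmX : 0 ≤ m * Xc := by positivity
  have hσ0 : 0 ≤ η ^ 2 * (n * σ ^ 2) := by positivity
  have hG0 : 0 ≤ η ^ 2 * (n * ‖mean Gb‖ ^ 2) := by positivity
  generalize lyapunov i₀ (fun i => γ / 2 * (1 - lam i)) (trackWeight C α γ) (hat U X)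
    (hat U (D + η • Gb)) (hat U Hc) = Λ
  generalize ‖mean Gb‖ ^ 2 = g at *
  clear_value Xc
  linarith

end Network

/-! ### Orthogonality relations in probability -/

section Probability

variable {Ω Ξ S : Type*} {m : MeasurableSpace Ω} [mΩ : MeasurableSpace Ω] [MeasurableSpace Ξ]
  [MeasurableSpace S]
  {μ : Measure Ω}

/-- If the integrals of `g` over the sets `A ∩ ξ ⁻¹' B` vanish, then so do the integrals over all
sets that are measurable with respect to `m` and `ξ`. -/
lemma setIntegral_sup_comap_eq_zero {F : Type*} [NormedAddCommGroup F] [NormedSpace ℝ F]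
    (hm : m ≤ mΩ) {ξ : Ω → Ξ} (hξ : Measurable ξ) {g : Ω → F}
    (hg : Integrable g μ)
    (h : ∀ A, MeasurableSet[m] A → ∀ B, MeasurableSet B → ∫ ω in A ∩ ξ ⁻¹' B, g ω ∂μ = 0)
    (s : Set Ω) (hs : MeasurableSet[m ⊔ MeasurableSpace.comap ξ inferInstance] s) :
    ∫ ω in s, g ω ∂μ = 0 := by
  set π : Set (Set Ω) := {s | ∃ A, MeasurableSet[m] A ∧ ∃ B, MeasurableSet B ∧ s = A ∩ ξ ⁻¹' B}
    with hπ
  have hle : m ⊔ MeasurableSpace.comap ξ inferInstance ≤ mΩ := sup_le hm hξ.comap_le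
  have hgen : m ⊔ MeasurableSpace.comap ξ inferInstance = MeasurableSpace.generateFrom π := by
    apply le_antisymm
    · refine sup_le (fun A hA => ?_) ?_
      · exact MeasurableSpace.measurableSet_generateFrom
          ⟨A, hA, Set.univ, MeasurableSet.univ, by simp⟩
      · rintro _ ⟨B, hB, rfl⟩
        exact MeasurableSpace.measurableSet_generateFrom
          ⟨Set.univ, MeasurableSet.univ, B, hB, by simp⟩
    · refine MeasurableSpace.generateFrom_le ?_
      rintro _ ⟨A, hA, B, hB, rfl⟩
      exact MeasurableSet.inter ((le_sup_left : m ≤ _) _ hA)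
        ((le_sup_right : MeasurableSpace.comap ξ inferInstance ≤ m ⊔ _) _ ⟨B, hB, rfl⟩)
  have hpi : IsPiSystem π := by
    rintro _ ⟨A, hA, B, hB, rfl⟩ _ ⟨A', hA', B', hB', rfl⟩ _
    exact ⟨A ∩ A', hA.inter hA', B ∩ B', hB.inter hB', by
      rw [Set.preimage_inter, Set.inter_inter_inter_comm]⟩
  induction s, hs using MeasurableSpace.induction_on_inter hgen hpi with
  | empty => simp
  | basic t ht =>
    obtain ⟨A, hA, B, hB, rfl⟩ := ht
    exact h A hA B hB
  -- Complements need the total integral to vanish; that is the case where both sets of the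
  -- hypothesis are the whole space.
  | compl t ht ih =>
    have h1 := integral_add_compl (hle _ ht) hg
    have h2 := h Set.univ MeasurableSet.univ Set.univ MeasurableSet.univ
    simp only [Set.preimage_univ, Set.inter_self, Measure.restrict_univ] at h2
    rwa [ih, h2, zero_add] at h1
  | iUnion f hf hfm ih =>
    rw [integral_iUnion (fun i => hle _ (hfm i)) hf hg.integrableOn]
    simp [ih]

/-- A factor known to `m` is pulled out of the conditional expectation. The general bilinear form
covers the inner product as well as scalar multiplication with either factor measurable. -/
lemma integral_bilin_eq_zero_of_condExp {E F G : Type*} [NormedAddCommGroup E] [NormedSpace ℝ E]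
    [CompleteSpace E] [NormedAddCommGroup F] [NormedSpace ℝ F] [NormedAddCommGroup G]
    [NormedSpace ℝ G] [CompleteSpace G] [IsFiniteMeasure μ] (B : F →L[ℝ] E →L[ℝ] G)
    (hm : m ≤ mΩ) {f : Ω → F} {g : Ω → E} (hf : StronglyMeasurable[m] f)
    (hfg : Integrable (fun ω => B (f ω) (g ω)) μ) (hg : Integrable g μ)
    (h0 : μ[g | m] =ᵐ[μ] 0) : ∫ ω, B (f ω) (g ω) ∂μ = 0 := by
  rw [← integral_condExp hm]
  refine integral_eq_zero_of_ae ?_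
  filter_upwards [condExp_bilin_of_stronglyMeasurable_left B hf hfg hg, h0] with ω h1 h2
  rw [h1, h2]
  simp

lemma condExp_eq_zero_of_setIntegral {F : Type*} [NormedAddCommGroup F] [NormedSpace ℝ F]
    [CompleteSpace F] [IsFiniteMeasure μ] (hm : m ≤ mΩ) {g : Ω → F}
    (hg : Integrable g μ) (h : ∀ s, MeasurableSet[m] s → ∫ ω in s, g ω ∂μ = 0) :
    μ[g | m] =ᵐ[μ] 0 := by
  refine (ae_eq_condExp_of_forall_setIntegral_eq hm hg (fun s _ _ => integrableOn_zero)
    (fun s hs _ => ?_) aestronglyMeasurable_zero).symm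
  simp [h s hs]

variable {E : Type*} [NormedAddCommGroup E] [InnerProductSpace ℝ E] [CompleteSpace E]

lemma integrable_inner_of_memLp {E : Type*} [NormedAddCommGroup E] [InnerProductSpace ℝ E]
    {f g : Ω → E} (hf : MemLp f 2 μ) (hg : MemLp g 2 μ) :
    Integrable (fun ω => ⟪f ω, g ω⟫) μ := by
  refine (integrable_congr ?_).1 (L2.integrable_inner (𝕜 := ℝ) (hf.toLp f) (hg.toLp g))
  filter_upwards [hf.coeFn_toLp, hg.coeFn_toLp] with ω h1 h2
  rw [h1, h2]

lemma integral_inner_eq_zero_of_condExp [IsFiniteMeasure μ] (hm : m ≤ mΩ)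
    {f g : Ω → E} (hfm : StronglyMeasurable[m] f) (hf : MemLp f 2 μ) (hg : MemLp g 2 μ)
    (h0 : μ[g | m] =ᵐ[μ] 0) : ∫ ω, ⟪f ω, g ω⟫ ∂μ = 0 :=
  integral_bilin_eq_zero_of_condExp (innerSL ℝ) hm hfm (integrable_inner_of_memLp hf hg)
    (hg.integrable one_le_two) h0

/-- Conditional independence of `ξ₁` and `ξ₂` given `m`: the conditional probability of an event
of `ξ₁` does not change when `ξ₂` becomes known. -/
lemma condExp_indicator_sub_eq_zero [StandardBorelSpace Ω] [IsFiniteMeasure μ]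
    {hm : m ≤ mΩ} {ξ₁ ξ₂ : Ω → Ξ} (hξ₁ : Measurable ξ₁)
    (hξ₂ : Measurable ξ₂) (hind : CondIndepFun m hm ξ₁ ξ₂ μ) {B : Set Ξ} (hB : MeasurableSet B) :
    μ[fun ω => (ξ₁ ⁻¹' B).indicator (fun _ => (1 : ℝ)) ω - (μ⟦ξ₁ ⁻¹' B | m⟧) ω
      | m ⊔ MeasurableSpace.comap ξ₂ inferInstance] =ᵐ[μ] 0 := by
  have hint1 : ∀ s : Set Ω, MeasurableSet s → Integrable (s.indicator fun _ => (1 : ℝ)) μ :=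
    fun s hs => (integrable_const 1).indicator hs
  have hint : Integrable (fun ω => (ξ₁ ⁻¹' B).indicator (fun _ => (1 : ℝ)) ω
      - (μ⟦ξ₁ ⁻¹' B | m⟧) ω) μ := (hint1 _ (hξ₁ hB)).sub integrable_condExp
  refine condExp_eq_zero_of_setIntegral (sup_le hm hξ₂.comap_le) hint ?_
  refine setIntegral_sup_comap_eq_zero hm hξ₂ hint fun A hA B' hB' => ?_
  have hφm : StronglyMeasurable[m] (μ⟦ξ₁ ⁻¹' B | m⟧) := stronglyMeasurable_condExp
  have hφint : Integrable (fun ω => (μ⟦ξ₁ ⁻¹' B | m⟧) ω * (ξ₂ ⁻¹' B').indicator (fun _ => (1 : ℝ)) ω)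
      μ := by
    have : (fun ω => (μ⟦ξ₁ ⁻¹' B | m⟧) ω * (ξ₂ ⁻¹' B').indicator (fun _ => (1 : ℝ)) ω)
        = (ξ₂ ⁻¹' B').indicator (μ⟦ξ₁ ⁻¹' B | m⟧) := by
      ext ω
      by_cases hω : ω ∈ ξ₂ ⁻¹' B' <;> simp [hω]
    rw [this]
    exact integrable_condExp.indicator (hξ₂ hB')
  have h1 := condExp_mul_of_stronglyMeasurable_left hφm hφint (hint1 _ (hξ₂ hB'))
  have h2 := (condIndepFun_iff_condExp_inter_preimage_eq_mul hξ₁ hξ₂).1 hind B B' hB hB'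
  rw [Set.inter_comm, ← integral_indicator (hξ₂ hB' |>.inter (hm _ hA)), ← Set.indicator_indicator]
  have h3 : ∀ ω, (ξ₂ ⁻¹' B').indicator (A.indicator fun ω =>
      (ξ₁ ⁻¹' B).indicator (fun _ => (1 : ℝ)) ω - (μ⟦ξ₁ ⁻¹' B | m⟧) ω) ω
      = A.indicator (fun ω => (ξ₁ ⁻¹' B ∩ ξ₂ ⁻¹' B').indicator (fun _ => (1 : ℝ)) ω
        - (μ⟦ξ₁ ⁻¹' B | m⟧) ω * (ξ₂ ⁻¹' B').indicator (fun _ => (1 : ℝ)) ω) ω := fun ω => by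
    by_cases h4 : ω ∈ ξ₂ ⁻¹' B' <;> by_cases h5 : ω ∈ A <;> by_cases h6 : ω ∈ ξ₁ ⁻¹' B <;>
      simp [h4, h5, h6, Set.indicator]
  have h4 := hint1 _ ((hξ₁ hB).inter (hξ₂ hB'))
  simp_rw [h3]
  rw [integral_indicator (hm _ hA), integral_sub h4.integrableOn hφint.integrableOn,
    ← setIntegral_condExp hm h4 hA, ← setIntegral_condExp hm hφint hA, sub_eq_zero]
  refine integral_congr_ae (ae_restrict_of_ae ?_)
  filter_upwards [h1, h2] with ω h7 h8
  exact h8.trans h7.symm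

/-- It suffices that `w₂` still has conditional mean zero once `ξ₁` is also known. On a generating
set this concerns the integral of `w₂` against an indicator of `ξ₁`; conditional independence allows
that indicator to be replaced by its conditional probability given `m`, and the mean of `w₂` given
`m` is zero. -/
lemma integral_inner_eq_zero_of_condIndepFun [StandardBorelSpace Ω] [IsFiniteMeasure μ]
    {hm : m ≤ mΩ} {ξ₁ ξ₂ : Ω → Ξ} (hξ₁ : Measurable ξ₁)
    (hξ₂ : Measurable ξ₂) (hind : CondIndepFun m hm ξ₁ ξ₂ μ) {w₁ w₂ : Ω → E}
    (hw₁m : StronglyMeasurable[m ⊔ MeasurableSpace.comap ξ₁ inferInstance] w₁)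
    (hw₂m : StronglyMeasurable[m ⊔ MeasurableSpace.comap ξ₂ inferInstance] w₂)
    (hw₁ : MemLp w₁ 2 μ) (hw₂ : MemLp w₂ 2 μ) (h0 : μ[w₂ | m] =ᵐ[μ] 0) :
    ∫ ω, ⟪w₁ ω, w₂ ω⟫ ∂μ = 0 := by
  have hw₂i : Integrable w₂ μ := hw₂.integrable one_le_two
  refine integral_inner_eq_zero_of_condExp (sup_le hm hξ₁.comap_le) hw₁m hw₁ hw₂ ?_
  refine condExp_eq_zero_of_setIntegral (sup_le hm hξ₁.comap_le) hw₂i ?_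
  refine setIntegral_sup_comap_eq_zero hm hξ₁ hw₂i fun A hA B hB => ?_
  set φ : Ω → ℝ := μ⟦ξ₁ ⁻¹' B | m⟧ with hφ
  set b : Ω → ℝ := (ξ₁ ⁻¹' B).indicator fun _ => (1 : ℝ) with hb
  have hbint : Integrable b μ := (integrable_const 1).indicator (hξ₁ hB)
  have hb1 : ∀ ω, |b ω| ≤ 1 := fun ω => by
    by_cases hω : ω ∈ ξ₁ ⁻¹' B <;> simp [hb, hω]
  have hφ1 : ∀ᵐ ω ∂μ, |φ ω| ≤ 1 :=
    ae_bdd_abs_condExp_of_ae_bdd_abs (Filter.Eventually.of_forall hb1)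
  have hφm : StronglyMeasurable[m] φ := stronglyMeasurable_condExp
  have hAw : Integrable (A.indicator w₂) μ := hw₂i.indicator (hm _ hA)
  have hφA : Integrable (fun ω => φ ω • A.indicator w₂ ω) μ :=
    hAw.bdd_smul 1 (hφm.mono hm).aestronglyMeasurable
      (by filter_upwards [hφ1] with ω h using h)
  have hbA : Integrable (fun ω => b ω • A.indicator w₂ ω) μ :=
    hAw.bdd_smul 1 hbint.aestronglyMeasurable (Filter.Eventually.of_forall hb1)
  -- Here `w₂` is the measurable factor, with respect to `m` and `ξ₂`, and `b - φ` is the one with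
  -- conditional mean zero; in the next step the roles are exchanged.
  have h1 : ∫ ω, (b ω - φ ω) • A.indicator w₂ ω ∂μ = 0 := by
    refine integral_bilin_eq_zero_of_condExp (ContinuousLinearMap.lsmul ℝ ℝ (E := E)).flip
      (sup_le hm hξ₂.comap_le) (f := A.indicator w₂) (g := fun ω => b ω - φ ω)
      (hw₂m.indicator ((le_sup_left : m ≤ _) _ hA)) ?_ (hbint.sub integrable_condExp)
      (condExp_indicator_sub_eq_zero hξ₁ hξ₂ hind hB)
    refine (hbA.sub hφA).congr (Filter.Eventually.of_forall fun ω => ?_)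
    simp [sub_smul]
  have h2 : ∫ ω, φ ω • A.indicator w₂ ω ∂μ = 0 := by
    have h3 : ∀ ω, φ ω • A.indicator w₂ ω = A.indicator φ ω • w₂ ω := fun ω => by
      by_cases hω : ω ∈ A <;> simp [hω]
    simp_rw [h3] at hφA ⊢
    exact integral_bilin_eq_zero_of_condExp (ContinuousLinearMap.lsmul ℝ ℝ (E := E)) hm
      (hφm.indicator hA) hφA hw₂i h0
  have h4 : ∫ ω, b ω • A.indicator w₂ ω ∂μ = 0 := by
    simp_rw [sub_smul] at h1
    rwa [integral_sub hbA hφA, h2, sub_zero] at h1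
  rw [← integral_indicator ((hm _ hA).inter (hξ₁ hB)), Set.inter_comm, ← Set.indicator_indicator,
    ← h4]
  refine integral_congr_ae (Filter.Eventually.of_forall fun ω => ?_)
  by_cases hω : ω ∈ ξ₁ ⁻¹' B <;> simp [hb, hω]

/-! ### The compressor -/

variable {p : ℕ} {ν : Measure S} {compress : Vec p → S → Vec p} {C : ℝ}

/-- This is the bridge from the assumptions on `compress` at a fixed vector to random inputs: with a
product law, Fubini freezes the history and integrates over the seed alone. -/
lemma map_prodMk_eq_prod_of_indep [IsProbabilityMeasure μ] {β : Type*} [MeasurableSpace β]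
    (hm : m ≤ mΩ) {a : Ω → S} (ha : Measurable a) (hlaw : μ.map a = ν)
    (hind : Indep (MeasurableSpace.comap a inferInstance) m μ) {F : Ω → β}
    (hF : Measurable[m] F) : μ.map (fun ω => (F ω, a ω)) = (μ.map F).prod ν := by
  have h : IndepFun F a μ := by
    rw [IndepFun_iff_Indep]
    exact indep_of_indep_of_le_left hind.symm hF.comap_le
  rw [← hlaw]
  exact (indepFun_iff_map_prod_eq_prod_map_map (hF.mono hm le_rfl).aemeasurable ha.aemeasurable).1 h

lemma IsUnbiasedCompressor.measurable_error (hc : IsUnbiasedCompressor ν compress C) :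
    Measurable fun q : Vec p × S => compress q.1 q.2 - q.1 :=
  hc.measurable.sub measurable_fst

lemma IsUnbiasedCompressor.memLp_error_const (hc : IsUnbiasedCompressor ν compress C) (v : Vec p) :
    MemLp (fun a => compress v a - v) 2 ν := by
  have hmeas : Measurable fun a => compress v a - v :=
    hc.measurable_error.comp measurable_prodMk_left
  refine ⟨hmeas.aestronglyMeasurable, ?_⟩
  rw [eLpNorm_lt_top_iff_lintegral_rpow_enorm_lt_top two_ne_zero ENNReal.ofNat_ne_top]
  simpa using (hc.variance_le v).trans_lt ENNReal.ofReal_lt_top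

lemma lintegral_enorm_sq_eq {E : Type*} [NormedAddCommGroup E] {f : Ω → E} (hf : MemLp f 2 μ) :
    ∫⁻ ω, ‖f ω‖ₑ ^ 2 ∂μ = ENNReal.ofReal (∫ ω, ‖f ω‖ ^ 2 ∂μ) := by
  rw [ofReal_integral_eq_lintegral_ofReal (hf.integrable_norm_pow two_ne_zero)
    (Filter.Eventually.of_forall fun _ => sq_nonneg _)]
  simp_rw [ENNReal.ofReal_pow (norm_nonneg _), ofReal_norm]

lemma IsUnbiasedCompressor.lintegral_error_le [IsProbabilityMeasure μ] [SFinite ν]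
    (hc : IsUnbiasedCompressor ν compress C) (hC : 0 ≤ C) (hm : m ≤ mΩ)
    {a : Ω → S} (ha : Measurable a) (hlaw : μ.map a = ν)
    (hind : Indep (MeasurableSpace.comap a inferInstance) m μ) {v : Ω → Vec p}
    (hv : Measurable[m] v) :
    ∫⁻ ω, ‖compress (v ω) (a ω) - v ω‖ₑ ^ 2 ∂μ ≤ ENNReal.ofReal C * ∫⁻ ω, ‖v ω‖ₑ ^ 2 ∂μ := by
  have hmeas : Measurable fun q : Vec p × S => ‖compress q.1 q.2 - q.1‖ₑ ^ 2 :=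
    hc.measurable_error.enorm.pow_const 2
  have hv' : Measurable v := hv.mono hm le_rfl
  have h1 := lintegral_map hmeas (hv'.prodMk ha) (μ := μ)
  rw [map_prodMk_eq_prod_of_indep hm ha hlaw hind hv, lintegral_prod _ hmeas.aemeasurable] at h1
  rw [← h1, ← lintegral_const_mul _ (hv'.enorm.pow_const 2)]
  calc ∫⁻ x, ∫⁻ y, ‖compress x y - x‖ₑ ^ 2 ∂ν ∂(μ.map v)
      ≤ ∫⁻ x, ENNReal.ofReal C * ‖x‖ₑ ^ 2 ∂(μ.map v) := by
        refine lintegral_mono fun x => (hc.variance_le x).trans_eq ?_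
        rw [ENNReal.ofReal_mul hC, ENNReal.ofReal_pow (norm_nonneg _), ofReal_norm]
    _ = ∫⁻ ω, ENNReal.ofReal C * ‖v ω‖ₑ ^ 2 ∂μ :=
        lintegral_map (by fun_prop) hv'

lemma IsUnbiasedCompressor.memLp_error [IsProbabilityMeasure μ] [SFinite ν]
    (hc : IsUnbiasedCompressor ν compress C) (hC : 0 ≤ C) (hm : m ≤ mΩ)
    {a : Ω → S} (ha : Measurable a) (hlaw : μ.map a = ν)
    (hind : Indep (MeasurableSpace.comap a inferInstance) m μ) {v : Ω → Vec p}
    (hv : Measurable[m] v) (hv2 : MemLp v 2 μ) :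
    MemLp (fun ω => compress (v ω) (a ω) - v ω) 2 μ ∧
      ∫ ω, ‖compress (v ω) (a ω) - v ω‖ ^ 2 ∂μ ≤ C * ∫ ω, ‖v ω‖ ^ 2 ∂μ := by
  have h1 := hc.lintegral_error_le hC hm ha hlaw hind hv
  rw [lintegral_enorm_sq_eq hv2, ← ENNReal.ofReal_mul hC] at h1
  have hmeas : Measurable fun ω => compress (v ω) (a ω) - v ω :=
    hc.measurable_error.comp ((hv.mono hm le_rfl).prodMk ha)
  have h2 : MemLp (fun ω => compress (v ω) (a ω) - v ω) 2 μ := by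
    refine ⟨hmeas.aestronglyMeasurable, ?_⟩
    rw [eLpNorm_lt_top_iff_lintegral_rpow_enorm_lt_top two_ne_zero ENNReal.ofNat_ne_top]
    simpa using h1.trans_lt ENNReal.ofReal_lt_top
  refine ⟨h2, ?_⟩
  rw [lintegral_enorm_sq_eq h2] at h1
  exact (ENNReal.ofReal_le_ofReal_iff
    (mul_nonneg hC (integral_nonneg fun _ => sq_nonneg _))).1 h1

lemma IsUnbiasedCompressor.integral_inner_error [IsProbabilityMeasure μ] [IsProbabilityMeasure ν]
    (hc : IsUnbiasedCompressor ν compress C) (hC : 0 ≤ C) (hm : m ≤ mΩ)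
    {a : Ω → S} (ha : Measurable a) (hlaw : μ.map a = ν)
    (hind : Indep (MeasurableSpace.comap a inferInstance) m μ) {v z : Ω → Vec p}
    (hv : Measurable[m] v) (hv2 : MemLp v 2 μ) (hz : Measurable[m] z) (hz2 : MemLp z 2 μ) :
    ∫ ω, ⟪z ω, compress (v ω) (a ω) - v ω⟫ ∂μ = 0 := by
  -- The test vector `z` and the input `v` form one history variable, so both are frozen when the
  -- seed is integrated out.
  set F : (Vec p × Vec p) × S → ℝ := fun q => ⟪q.1.1, compress q.1.2 q.2 - q.1.2⟫ with hF
  have hFm : Measurable F := by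
    have h1 : Measurable fun q : (Vec p × Vec p) × S => compress q.1.2 q.2 - q.1.2 :=
      hc.measurable_error.comp ((measurable_snd.comp measurable_fst).prodMk measurable_snd)
    exact (measurable_fst.comp measurable_fst).inner h1
  have hzv : Measurable[m] fun ω => (z ω, v ω) := hz.prodMk hv
  have hpair : Measurable fun ω => ((z ω, v ω), a ω) := (hzv.mono hm le_rfl).prodMk ha
  have hint : Integrable (fun ω => F ((z ω, v ω), a ω)) μ :=
    integrable_inner_of_memLp hz2 (hc.memLp_error hC hm ha hlaw hind hv hv2).1
  have hlaw2 := map_prodMk_eq_prod_of_indep hm ha hlaw hind hzv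
  have h1 : ∫ ω, F ((z ω, v ω), a ω) ∂μ = ∫ q, F q ∂(μ.map fun ω => ((z ω, v ω), a ω)) :=
    (integral_map hpair.aemeasurable hFm.aestronglyMeasurable).symm
  have h2 : Integrable F (μ.map fun ω => ((z ω, v ω), a ω)) :=
    (integrable_map_measure hFm.aestronglyMeasurable hpair.aemeasurable).2 hint
  change ∫ ω, F ((z ω, v ω), a ω) ∂μ = 0
  rw [h1]
  rw [hlaw2] at h2 ⊢
  have : SFinite (μ.map fun ω => (z ω, v ω)) := inferInstance
  rw [integral_prod _ h2]
  refine integral_eq_zero_of_ae (Filter.Eventually.of_forall fun q => ?_)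
  have h3 := (hc.memLp_error_const q.2).integrable one_le_two
  have h4 : ∫ b, (compress q.2 b - q.2) ∂ν = 0 := by
    have h5 : Integrable (fun b => compress q.2 b) ν :=
      (h3.add (integrable_const q.2)).congr (Filter.Eventually.of_forall fun b => by simp)
    rw [integral_sub h5 (integrable_const _), hc.unbiased]
    simp
  simp only [hF, Pi.zero_apply]
  rw [integral_inner h3, h4, inner_zero_right]

end Probability

/-! ### Square-integrable random vectors -/

section SquareIntegrable

variable {Ω : Type*} [MeasurableSpace Ω]

/-- The square-integrable random vectors, as a submodule of the space of all functions. -/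
def sqIntegrable (μ : Measure Ω) (p : ℕ) : Submodule ℝ (Ω → Vec p) where
  carrier := {f | MemLp f 2 μ}
  add_mem' hf hg := hf.add hg
  zero_mem' := MemLp.zero
  smul_mem' c _ hf := hf.const_smul c

/-- The semi-inner product space of square-integrable random vectors with `⟪f, g⟫ = 𝔼⟪f, g⟫`. -/
def RandomVec (μ : Measure Ω) (p : ℕ) : Type _ := sqIntegrable μ p

namespace RandomVec

variable {μ : Measure Ω} {p : ℕ}

instance : AddCommGroup (RandomVec μ p) := inferInstanceAs (AddCommGroup (sqIntegrable μ p))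

instance : Module ℝ (RandomVec μ p) := inferInstanceAs (Module ℝ (sqIntegrable μ p))

instance : CoeFun (RandomVec μ p) fun _ => Ω → Vec p := ⟨fun f => f.1⟩

/-- A square-integrable random vector as an element of the semi-inner product space. -/
def of (f : Ω → Vec p) (hf : MemLp f 2 μ) : RandomVec μ p := ⟨f, hf⟩

lemma memLp (f : RandomVec μ p) : MemLp f 2 μ := f.2

@[ext] lemma ext {f g : RandomVec μ p} (h : ∀ ω, f ω = g ω) : f = g := Subtype.ext (funext h)

@[simp] lemma of_apply (f : Ω → Vec p) (hf : MemLp f 2 μ) (ω : Ω) : of f hf ω = f ω := rfl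

@[simp] lemma add_apply (f g : RandomVec μ p) (ω : Ω) : (f + g) ω = f ω + g ω := rfl

@[simp] lemma sub_apply (f g : RandomVec μ p) (ω : Ω) : (f - g) ω = f ω - g ω := rfl

@[simp] lemma smul_apply (c : ℝ) (f : RandomVec μ p) (ω : Ω) : (c • f) ω = c • f ω := rfl

@[simp] lemma zero_apply (ω : Ω) : (0 : RandomVec μ p) ω = 0 := rfl

@[simp] lemma sum_apply {ι : Type*} (s : Finset ι) (f : ι → RandomVec μ p) (ω : Ω) :
    (∑ i ∈ s, f i) ω = ∑ i ∈ s, f i ω := by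
  classical
  induction s using Finset.induction_on with
  | empty => simp
  | insert a s ha ih => simp [Finset.sum_insert ha, ih]

/-- The semi-inner product `𝔼⟪f, g⟫`. -/
instance : PreInnerProductSpace.Core ℝ (RandomVec μ p) where
  inner f g := ∫ ω, ⟪f ω, g ω⟫ ∂μ
  conj_inner_symm f g := by
    simp only [conj_trivial]
    exact integral_congr_ae (Filter.Eventually.of_forall fun ω => real_inner_comm _ _)
  re_inner_nonneg f := by
    simp only [RCLike.re_to_real]
    exact integral_nonneg fun ω => real_inner_self_nonneg
  add_left f g h := by
    rw [← integral_add (integrable_inner_of_memLp f.memLp h.memLp)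
      (integrable_inner_of_memLp g.memLp h.memLp)]
    simp [inner_add_left]
  smul_left f g c := by
    simp [inner_smul_left, integral_const_mul]

instance : SeminormedAddCommGroup (RandomVec μ p) :=
  InnerProductSpace.Core.toSeminormedAddCommGroup (𝕜 := ℝ)

instance : InnerProductSpace ℝ (RandomVec μ p) := InnerProductSpace.ofCore inferInstance

lemma inner_eq (f g : RandomVec μ p) : ⟪f, g⟫ = ∫ ω, ⟪f ω, g ω⟫ ∂μ := rfl

lemma norm_sq_eq (f : RandomVec μ p) : ‖f‖ ^ 2 = ∫ ω, ‖f ω‖ ^ 2 ∂μ := by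
  rw [← real_inner_self_eq_norm_sq, inner_eq]
  simp_rw [real_inner_self_eq_norm_sq]

lemma norm_le_mul_of_forall {f g : RandomVec μ p} {L : ℝ} (hL : 0 ≤ L)
    (h : ∀ ω, ‖f ω‖ ≤ L * ‖g ω‖) : ‖f‖ ≤ L * ‖g‖ := by
  refine le_of_sq_le_sq ?_ (by positivity)
  rw [mul_pow, norm_sq_eq, norm_sq_eq, ← integral_const_mul]
  refine integral_mono (f.memLp.integrable_norm_pow two_ne_zero)
    ((g.memLp.integrable_norm_pow two_ne_zero).const_mul _) fun ω => ?_
  simp only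
  rw [← mul_pow]
  exact pow_le_pow_left₀ (norm_nonneg _) (h ω) 2

@[simp] lemma mean_apply {n : ℕ} (v : Fin n → RandomVec μ p) (ω : Ω) :
    mean v ω = avg fun i => v i ω := by
  simp [CEDAS.mean_apply, avg]

end RandomVec

end SquareIntegrable

/-! ### Smooth functions -/

section Smooth

variable {E : Type*} [NormedAddCommGroup E] [InnerProductSpace ℝ E] [CompleteSpace E]

/-- The descent lemma. -/
lemma le_add_of_lipschitz_gradient {f : E → ℝ} {L : ℝ} (hf : Differentiable ℝ f)
    (hL : ∀ v w, ‖gradient f v - gradient f w‖ ≤ L * ‖v - w‖) (x y : E) :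
    f y ≤ f x + ⟪gradient f x, y - x⟫ + L / 2 * ‖y - x‖ ^ 2 := by
  set d := y - x with hd
  set φ : ℝ → ℝ := fun t => f (x + t • d) - t * ⟪gradient f x, d⟫ - L / 2 * t ^ 2 * ‖d‖ ^ 2
    with hφ
  have hder : ∀ t, HasDerivAt φ (⟪gradient f (x + t • d) - gradient f x, d⟫ - L * t * ‖d‖ ^ 2) t := by
    intro t
    have h1 : HasDerivAt (fun t : ℝ => x + t • d) d t := by
      simpa using ((hasDerivAt_id t).smul_const d).const_add x
    have h2 : HasDerivAt (fun t : ℝ => f (x + t • d)) ⟪gradient f (x + t • d), d⟫ t := by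
      rw [show ⟪gradient f (x + t • d), d⟫ = fderiv ℝ f (x + t • d) d by simp [gradient]]
      exact (hf (x + t • d)).hasFDerivAt.comp_hasDerivAt t h1
    have h3 : HasDerivAt (fun t : ℝ => t * ⟪gradient f x, d⟫) ⟪gradient f x, d⟫ t := by
      simpa using (hasDerivAt_id t).mul_const ⟪gradient f x, d⟫
    have h4 : HasDerivAt (fun t : ℝ => L / 2 * t ^ 2 * ‖d‖ ^ 2) (L * t * ‖d‖ ^ 2) t := by
      refine (((hasDerivAt_pow 2 t).const_mul (L / 2)).mul_const (‖d‖ ^ 2)).congr_deriv ?_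
      rw [Nat.cast_ofNat, Nat.add_one_sub_one, pow_one]
      ring
    rw [inner_sub_left]
    exact (h2.sub h3).sub h4
  have hanti : AntitoneOn φ (Set.Icc 0 1) := by
    refine antitoneOn_of_deriv_nonpos (convex_Icc 0 1)
      (fun t _ => (hder t).continuousAt.continuousWithinAt)
      (fun t _ => (hder t).differentiableAt.differentiableWithinAt) fun t ht => ?_
    rw [interior_Icc] at ht
    rw [(hder t).deriv]
    have h1 := real_inner_le_norm (gradient f (x + t • d) - gradient f x) d
    have h2 := hL (x + t • d) x
    rw [add_sub_cancel_left, norm_smul, Real.norm_of_nonneg ht.1.le] at h2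
    nlinarith [norm_nonneg d, mul_le_mul_of_nonneg_right h2 (norm_nonneg d)]
  have h := hanti (Set.left_mem_Icc.2 zero_le_one) (Set.right_mem_Icc.2 zero_le_one) zero_le_one
  simp only [hφ, one_smul, zero_smul, add_zero, one_mul, zero_mul, one_pow, mul_one, sub_zero,
    mul_zero, ne_eq, OfNat.ofNat_ne_zero, not_false_eq_true, zero_pow] at h
  have h5 : x + d = y := by rw [hd]; abel
  rw [h5] at h
  linarith

variable {n p : ℕ} {L : ℝ} {f : Fin n → Vec p → ℝ} {fLow : Fin n → ℝ}

lemma IsSmoothBddBelow.gradient_avgFun (hf : IsSmoothBddBelow L f fLow) (v : Vec p) :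
    gradient (avgFun f) v = avg fun i => gradient (f i) v := by
  refine HasGradientAt.gradient ?_
  rw [hasGradientAt_iff_hasFDerivAt]
  have h : HasFDerivAt (avgFun f) ((n : ℝ)⁻¹ • ∑ i, fderiv ℝ (f i) v) v := by
    refine HasFDerivAt.const_mul ?_ _
    exact HasFDerivAt.fun_sum fun i _ => (hf.differentiable i v).hasFDerivAt
  refine h.congr_fderiv (ContinuousLinearMap.ext fun w => ?_)
  simp [avg, gradient]

lemma IsSmoothBddBelow.differentiable_avgFun (hf : IsSmoothBddBelow L f fLow) :
    Differentiable ℝ (avgFun f) := by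
  have := hf.differentiable
  unfold avgFun
  fun_prop

lemma norm_avg_le {n p : ℕ} (hn : 0 < n) {v : Fin n → Vec p} {b : ℝ} (h : ∀ i, ‖v i‖ ≤ b) :
    ‖avg v‖ ≤ b := by
  have hn' : (0 : ℝ) < n := Nat.cast_pos.2 hn
  rw [avg, norm_smul, norm_inv, Real.norm_natCast, inv_mul_le_iff₀ hn']
  calc ‖∑ i, v i‖ ≤ ∑ i, ‖v i‖ := norm_sum_le _ _
    _ ≤ ∑ _i : Fin n, b := Finset.sum_le_sum fun i _ => h i
    _ = n * b := by simp

lemma IsSmoothBddBelow.lipschitz_avgFun (hf : IsSmoothBddBelow L f fLow) (hn : 0 < n)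
    (v w : Vec p) : ‖gradient (avgFun f) v - gradient (avgFun f) w‖ ≤ L * ‖v - w‖ := by
  rw [hf.gradient_avgFun, hf.gradient_avgFun]
  have : (avg fun i => gradient (f i) v) - (avg fun i => gradient (f i) w)
      = avg fun i => gradient (f i) v - gradient (f i) w := by
    simp [avg, Finset.sum_sub_distrib, smul_sub]
  rw [this]
  exact norm_avg_le hn fun i => hf.lipschitz i v w

lemma IsSmoothBddBelow.le_avgFun (hf : IsSmoothBddBelow L f fLow) (v : Vec p) :
    (n : ℝ)⁻¹ * ∑ i, fLow i ≤ avgFun f v := by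
  unfold avgFun
  gcongr with i
  exact hf.lower i v

lemma IsSmoothBddBelow.continuous_gradient (hf : IsSmoothBddBelow L f fLow) (i : Fin n) :
    Continuous (gradient (f i)) :=
  (LipschitzWith.of_dist_le_mul (K := L.toNNReal) fun v w => by
    rw [dist_eq_norm, dist_eq_norm]
    exact (hf.lipschitz i v w).trans (by gcongr; exact Real.le_coe_toNNReal L)).continuous

variable {Ω : Type*} [MeasurableSpace Ω] {μ : Measure Ω}

lemma IsSmoothBddBelow.memLp_gradient [IsFiniteMeasure μ] (hf : IsSmoothBddBelow L f fLow)
    (i : Fin n) {x : Ω → Vec p} (hx : MemLp x 2 μ) : MemLp (fun ω => gradient (f i) (x ω)) 2 μ := by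
  have h1 : MemLp (fun ω => gradient (f i) (x ω) - gradient (f i) 0) 2 μ := by
    refine MemLp.of_le_mul (c := L) hx ?_ (Filter.Eventually.of_forall fun ω => ?_)
    · exact ((hf.continuous_gradient i).comp_aestronglyMeasurable hx.1).sub
        aestronglyMeasurable_const
    · simpa using hf.lipschitz i (x ω) 0
  exact (h1.add (memLp_const (gradient (f i) 0))).ae_eq
    (Filter.Eventually.of_forall fun ω => by simp)

/-- The function lies between a constant and a quadratic polynomial, the latter by the descent lemma
at the origin. -/
lemma IsSmoothBddBelow.integrable_avgFun [IsFiniteMeasure μ] (hf : IsSmoothBddBelow L f fLow)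
    (hn : 0 < n) {x : Ω → Vec p} (hx : MemLp x 2 μ) : Integrable (fun ω => avgFun f (x ω)) μ := by
  refine integrable_of_le_of_le (g₁ := fun _ => (n : ℝ)⁻¹ * ∑ i, fLow i)
    (g₂ := fun ω => avgFun f 0 + ⟪gradient (avgFun f) 0, x ω⟫ + L / 2 * ‖x ω‖ ^ 2)
    (hf.differentiable_avgFun.continuous.comp_aestronglyMeasurable hx.1)
    (Filter.Eventually.of_forall fun ω => hf.le_avgFun _)
    (Filter.Eventually.of_forall fun ω => ?_) (integrable_const _) ?_
  · simpa using le_add_of_lipschitz_gradient hf.differentiable_avgFun (hf.lipschitz_avgFun hn) 0 (x ω)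
  · exact ((integrable_const _).add (integrable_inner_of_memLp (memLp_const _) hx)).add
      ((hx.integrable_norm_pow two_ne_zero).const_mul _)

end Smooth

/-! ### Descent of the average, and the initial value of the Lyapunov function -/

section NetworkBounds

variable {n : ℕ} {H : Type*} [SeminormedAddCommGroup H] [InnerProductSpace ℝ H]
  {W : Matrix (Fin n) (Fin n) ℝ} {lam2 : ℝ} {U : Fin n → Fin n → ℝ} {lam : Fin n → ℝ} {i₀ : Fin n}

/-- Pythagoras. This variance reduction by the factor `n` is what produces the rate `1 / √(n K)`. -/
lemma norm_sq_mean_orthogonal_le {σ : ℝ} (hn : 0 < n) {w : Fin n → H}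
    (hw : ∀ i, ‖w i‖ ^ 2 ≤ σ ^ 2) (horth : ∀ i j, i ≠ j → ⟪w i, w j⟫ = 0) :
    n * ‖mean w‖ ^ 2 ≤ σ ^ 2 := by
  have hn' : (0 : ℝ) < n := Nat.cast_pos.2 hn
  have h1 : ‖∑ i, w i‖ ^ 2 = ∑ i, ‖w i‖ ^ 2 := by
    simp_rw [← real_inner_self_eq_norm_sq, sum_inner, inner_sum]
    refine Finset.sum_congr rfl fun i _ => ?_
    exact Finset.sum_eq_single i (fun j _ hj => horth i j hj.symm) (by simp)
  rw [mean_apply, norm_smul, mul_pow, h1, norm_inv, Real.norm_natCast]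
  calc (n : ℝ) * ((n : ℝ)⁻¹ ^ 2 * ∑ i, ‖w i‖ ^ 2) = (n : ℝ)⁻¹ * ∑ i, ‖w i‖ ^ 2 := by field_simp
    _ ≤ (n : ℝ)⁻¹ * ∑ _i : Fin n, σ ^ 2 := by
        gcongr (n : ℝ)⁻¹ * ?_
        exact Finset.sum_le_sum fun i _ => hw i
    _ = σ ^ 2 := by simp [hn'.ne']

/-- Polarisation of `⟪mean Gb, mean Gr⟫` yields `-η / 2` times both squared norms plus `η / 2` times
the squared mismatch. The `Gr` term absorbs the second-order term because `η L ≤ 1`, and the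
mismatch is bounded by the consensus error. -/
lemma descent_step_le (hn : 0 < n) {η L σ : ℝ} (hη : 0 ≤ η) (hL : 0 ≤ L) (hηL : η * L ≤ 1)
    {X X' Gr Gb w : Fin n → H} (hstep : mean X' = mean X - η • (mean Gr + mean w))
    (hGrw : ∀ j l, ⟪Gr j, w l⟫ = 0) (hGbw : ∀ j l, ⟪Gb j, w l⟫ = 0)
    (hGr : ∀ j, ‖Gr j - Gb j‖ ≤ L * ‖X j - mean X‖) (hwm : n * ‖mean w‖ ^ 2 ≤ σ ^ 2) :
    ⟪mean Gb, mean X' - mean X⟫ + L / 2 * ‖mean X' - mean X‖ ^ 2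
      ≤ -(η / 2) * ‖mean Gb‖ ^ 2 + η * L ^ 2 / (2 * n) * ∑ j, ‖X j - mean X‖ ^ 2
        + L * η ^ 2 * σ ^ 2 / (2 * n) := by
  have hn' : (0 : ℝ) < n := Nat.cast_pos.2 hn
  have horth : ∀ {v : Fin n → H}, (∀ j l, ⟪v j, w l⟫ = 0) → ⟪mean v, mean w⟫ = 0 := fun h => by
    refine inner_mean_eq_zero fun l => ?_
    rw [real_inner_comm]
    exact inner_mean_eq_zero fun j => by rw [real_inner_comm]; exact h j l
  have h1 : mean X' - mean X = -(η • (mean Gr + mean w)) := by rw [hstep]; abel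
  have h2 : ‖mean Gr - mean Gb‖ ^ 2 ≤ L ^ 2 / n * ∑ j, ‖X j - mean X‖ ^ 2 := by
    have h3 := norm_sq_mean_le (Gr - Gb)
    rw [map_sub] at h3
    have h4 : ∑ j, ‖(Gr - Gb) j‖ ^ 2 ≤ L ^ 2 * ∑ j, ‖X j - mean X‖ ^ 2 := by
      rw [Finset.mul_sum]
      refine Finset.sum_le_sum fun j _ => ?_
      rw [← mul_pow]
      exact pow_le_pow_left₀ (norm_nonneg _) (hGr j) 2
    rw [div_mul_eq_mul_div, le_div_iff₀ hn', mul_comm]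
    exact h3.trans h4
  have h5 : ‖mean w‖ ^ 2 ≤ σ ^ 2 / n := by rwa [le_div_iff₀ hn', mul_comm]
  have h6 : ‖mean Gr - mean Gb‖ ^ 2 = ‖mean Gr‖ ^ 2 - 2 * ⟪mean Gb, mean Gr⟫ + ‖mean Gb‖ ^ 2 := by
    rw [norm_sub_sq_real, real_inner_comm]
  have h7 : ‖mean Gr + mean w‖ ^ 2 = ‖mean Gr‖ ^ 2 + ‖mean w‖ ^ 2 := by
    rw [norm_add_sq_real, horth hGrw]; ring
  rw [h1, inner_neg_right, inner_smul_right, inner_add_right, horth hGbw, norm_neg, norm_smul,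
    mul_pow, Real.norm_eq_abs, sq_abs, h7]
  have h8 : L / 2 * (η ^ 2 * ‖mean Gr‖ ^ 2) ≤ η / 2 * ‖mean Gr‖ ^ 2 := by
    calc L / 2 * (η ^ 2 * ‖mean Gr‖ ^ 2) = η * L * (η / 2 * ‖mean Gr‖ ^ 2) := by ring
      _ ≤ 1 * (η / 2 * ‖mean Gr‖ ^ 2) := by gcongr
      _ = _ := one_mul _
  have h9 : L / 2 * (η ^ 2 * ‖mean w‖ ^ 2) ≤ L * η ^ 2 * σ ^ 2 / (2 * n) := by
    calc L / 2 * (η ^ 2 * ‖mean w‖ ^ 2) ≤ L / 2 * (η ^ 2 * (σ ^ 2 / n)) := by gcongr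
      _ = _ := by field_simp
  have h10 : η / 2 * ‖mean Gr - mean Gb‖ ^ 2
      ≤ η * L ^ 2 / (2 * n) * ∑ j, ‖X j - mean X‖ ^ 2 := by
    calc η / 2 * ‖mean Gr - mean Gb‖ ^ 2 ≤ η / 2 * (L ^ 2 / n * ∑ j, ‖X j - mean X‖ ^ 2) := by
          gcongr
      _ = _ := by field_simp
  rw [h6] at h10
  linarith

lemma IsModeBasis.theta_bounds (hU : IsModeBasis W lam2 U lam i₀) {γ : ℝ} (hγ : 0 ≤ γ) {i : Fin n}
    (hi : i ≠ i₀) : γ * (1 - lam2) / 2 ≤ γ / 2 * (1 - lam i) ∧ γ / 2 * (1 - lam i) ≤ γ := by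
  have h1 := hU.lam_le i hi
  have h2 := hU.le_lam i
  constructor
  · calc γ * (1 - lam2) / 2 = γ / 2 * (1 - lam2) := by ring
      _ ≤ γ / 2 * (1 - lam i) := by gcongr
  · calc γ / 2 * (1 - lam i) ≤ γ / 2 * (1 - -1) := by gcongr
      _ = γ := by ring

lemma networkLyapunov_nonneg (hU : IsModeBasis W lam2 U lam i₀) {C α γ η : ℝ} (hlam2 : lam2 < 1)
    (hγ0 : 0 < γ) (hγ : γ ≤ 1 / 72) (hκ : 0 ≤ trackWeight C α γ) (X D Hc Gb : Fin n → H) :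
    0 ≤ networkLyapunov U lam i₀ C α γ η X D Hc Gb := by
  refine add_nonneg (Finset.sum_nonneg fun i hi => ?_)
    (mul_nonneg hκ (Finset.sum_nonneg fun _ _ => sq_nonneg _))
  obtain ⟨h1, h2⟩ := hU.theta_bounds hγ0.le (Finset.ne_of_mem_erase hi)
  have h3 : 0 < γ * (1 - lam2) / 2 := by
    have : 0 < 1 - lam2 := by linarith
    positivity
  exact add_nonneg (div_nonneg (sq_nonneg _) (by linarith)) (div_nonneg (sq_nonneg _) (by linarith))

/-- The factor 4 on `X` combines 2 from `1 / (1 - θ) ≤ 2` and 2 from the tracking error. The dual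
variable is zero, so only its recentring contributes, with `1 / θ ≤ 1 / m`. -/
lemma networkLyapunov_init_le (hU : IsModeBasis W lam2 U lam i₀) {m C α γ η : ℝ} (hlam2 : lam2 < 1)
    (hm : m = γ * (1 - lam2) / 2) (hγ0 : 0 < γ) (hγ : γ ≤ 1 / 72)
    (hκ : trackWeight C α γ ≤ 1) (X Hc Gb : Fin n → H) :
    networkLyapunov U lam i₀ C α γ η X 0 Hc Gb
      ≤ 4 * ∑ j, ‖X j‖ ^ 2 + 2 * ∑ j, ‖Hc j‖ ^ 2 + η ^ 2 / m * ∑ j, ‖Gb j‖ ^ 2 := by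
  have hm0 : 0 < m := by
    have : 0 < 1 - lam2 := by linarith
    rw [hm]; positivity
  have herase : ∀ v : Fin n → H, ∑ i ∈ Finset.univ.erase i₀, ‖hat U v i‖ ^ 2 ≤ ∑ j, ‖v j‖ ^ 2 :=
    fun v => (Finset.sum_le_sum_of_subset_of_nonneg (Finset.erase_subset _ _)
      fun _ _ _ => sq_nonneg _).trans_eq (hU.sum_norm_sq_hat v)
  have h1 : modeEnergy i₀ (fun i => γ / 2 * (1 - lam i)) (hat U X) (hat U (0 + η • Gb))
      ≤ 2 * ∑ j, ‖X j‖ ^ 2 + η ^ 2 / m * ∑ j, ‖Gb j‖ ^ 2 := by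
    calc modeEnergy i₀ (fun i => γ / 2 * (1 - lam i)) (hat U X) (hat U (0 + η • Gb))
        ≤ ∑ i ∈ Finset.univ.erase i₀, (2 * ‖hat U X i‖ ^ 2 + η ^ 2 / m * ‖hat U Gb i‖ ^ 2) := by
          refine Finset.sum_le_sum fun i hi => ?_
          obtain ⟨h2, h3⟩ := hU.theta_bounds hγ0.le (Finset.ne_of_mem_erase hi)
          rw [← hm] at h2
          simp only
          refine add_le_add ?_ ?_
          · rw [div_le_iff₀ (by linarith)]
            have : 1 * ‖hat U X i‖ ^ 2 ≤ (2 * (1 - γ / 2 * (1 - lam i))) * ‖hat U X i‖ ^ 2 := by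
              gcongr
              linarith
            linarith
          · rw [zero_add, map_smul, Pi.smul_apply, norm_smul, mul_pow, Real.norm_eq_abs, sq_abs,
              ← div_mul_eq_mul_div]
            gcongr
      _ ≤ _ := by
          rw [Finset.sum_add_distrib, ← Finset.mul_sum, ← Finset.mul_sum]
          gcongr
          · exact herase X
          · exact herase Gb
  have h2 : ∑ i, ‖hat U X i - hat U Hc i‖ ^ 2 ≤ 2 * ∑ j, ‖X j‖ ^ 2 + 2 * ∑ j, ‖Hc j‖ ^ 2 := by
    rw [← hU.sum_norm_sq_hat X, ← hU.sum_norm_sq_hat Hc, Finset.mul_sum, Finset.mul_sum,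
      ← Finset.sum_add_distrib]
    exact Finset.sum_le_sum fun i _ => norm_sub_sq_le_two _ _
  have h3 := mul_le_mul hκ h2 (Finset.sum_nonneg fun _ _ => sq_nonneg _) zero_le_one
  unfold networkLyapunov lyapunov
  linarith

end NetworkBounds

/-! ### Stochastic gradients -/

section GoodSample

variable {Ω Ξ : Type*} {m : MeasurableSpace Ω} [mΩ : MeasurableSpace Ω] [StandardBorelSpace Ω]
  [MeasurableSpace Ξ] {μ : Measure Ω} [IsProbabilityMeasure μ] {n p : ℕ} {f : Fin n → Vec p → ℝ}
  {oracle : Fin n → Vec p → Ξ → Vec p} {σ : ℝ} {x : Fin n → Ω → Vec p} {ξ : Fin n → Ω → Ξ}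

lemma IsGoodGradientSample.le (hg : IsGoodGradientSample μ m f oracle σ x ξ) : m ≤ mΩ :=
  hg.indep.1

lemma IsGoodGradientSample.integral_norm_sq_le (hg : IsGoodGradientSample μ m f oracle σ x ξ)
    (i : Fin n) :
    ∫ ω, ‖oracle i (x i ω) (ξ i ω) - gradient (f i) (x i ω)‖ ^ 2 ∂μ ≤ σ ^ 2 := by
  rw [← integral_condExp hg.le]
  calc _ ≤ ∫ _ω, σ ^ 2 ∂μ :=
        integral_mono_ae integrable_condExp (integrable_const _) (hg.variance_le i)
    _ = σ ^ 2 := by simp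

lemma IsGoodGradientSample.integral_inner_eq_zero (hg : IsGoodGradientSample μ m f oracle σ x ξ)
    (i : Fin n) {z : Ω → Vec p} (hz : Measurable[m] z) (hz2 : MemLp z 2 μ) :
    ∫ ω, ⟪z ω, oracle i (x i ω) (ξ i ω) - gradient (f i) (x i ω)⟫ ∂μ = 0 :=
  integral_inner_eq_zero_of_condExp hg.le hz.stronglyMeasurable hz2 (hg.memLp i) (hg.unbiased i)

lemma IsGoodGradientSample.integral_inner_noise_eq_zero
    (hg : IsGoodGradientSample μ m f oracle σ x ξ)
    (hf : ∀ i, Continuous (gradient (f i))) (ho : ∀ i, Measurable (Function.uncurry (oracle i)))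
    (hξ : ∀ i, Measurable (ξ i)) (hx : ∀ i, Measurable[m] (x i)) {i j : Fin n} (hij : i ≠ j) :
    ∫ ω, ⟪oracle i (x i ω) (ξ i ω) - gradient (f i) (x i ω),
      oracle j (x j ω) (ξ j ω) - gradient (f j) (x j ω)⟫ ∂μ = 0 := by
  obtain ⟨hm, hind⟩ := hg.indep
  have hmeas : ∀ i, StronglyMeasurable[m ⊔ MeasurableSpace.comap (ξ i) inferInstance]
      fun ω => oracle i (x i ω) (ξ i ω) - gradient (f i) (x i ω) := fun i => by
    have h1 : Measurable[m ⊔ MeasurableSpace.comap (ξ i) inferInstance] (x i) :=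
      (hx i).mono le_sup_left le_rfl
    have h2 : Measurable[m ⊔ MeasurableSpace.comap (ξ i) inferInstance] (ξ i) :=
      (comap_measurable (ξ i)).mono le_sup_right le_rfl
    exact (((ho i).comp (h1.prodMk h2)).sub ((hf i).measurable.comp h1)).stronglyMeasurable
  exact integral_inner_eq_zero_of_condIndepFun (hξ i) (hξ j) (hind.condIndepFun hij) (hmeas i)
    (hmeas j) (hg.memLp i) (hg.memLp j) (hg.unbiased j)

end GoodSample

/-! ### Runs of the algorithm -/

lemma IsMixingMatrix.mix_eq {n p : ℕ} {G : SimpleGraph (Fin n)} {W : Matrix (Fin n) (Fin n) ℝ}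
    (hW : IsMixingMatrix G W) (v : Fin n → Vec p) (i : Fin n) : mix G W v i = ∑ j, W i j • v j := by
  classical
  unfold mix
  rw [Finset.sum_filter]
  refine Finset.sum_congr rfl fun j _ => ?_
  split_ifs with h
  · rfl
  · rw [not_or] at h
    rw [hW.eq_zero_of_not_adj i j (Ne.symm h.2) h.1, zero_smul]

/-- `Z k ω` is the state at time `k` of a run with the samples `ξ` and the seeds `s`. -/
structure IsRun {Ω Ξ S : Type*} {n p : ℕ} (G : SimpleGraph (Fin n)) (W : Matrix (Fin n) (Fin n) ℝ)
    (α γ η : ℝ) (xInit hInit : Fin n → Vec p) (oracle : Fin n → Vec p → Ξ → Vec p)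
    (compress : Vec p → S → Vec p) (ξ : ℕ → Fin n → Ω → Ξ) (s : ℕ → Fin n → Ω → S)
    (Z : ℕ → Ω → State n p) : Prop where
  mixing : IsMixingMatrix G W
  zero : ∀ ω, Z 0 ω = initState G W η xInit hInit (fun i v => oracle i v (ξ 0 i ω))
  succ : ∀ k ω, Z (k + 1) ω = step G W α γ η (fun i v => oracle i v (ξ (k + 1) i ω))
    (fun i v => compress v (s k i ω)) (Z k ω)

namespace IsRun

section Dynamics

variable {Ω Ξ S : Type*} {n p : ℕ} {G : SimpleGraph (Fin n)} {W : Matrix (Fin n) (Fin n) ℝ}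
  {α γ η : ℝ} {xInit hInit : Fin n → Vec p} {oracle : Fin n → Vec p → Ξ → Vec p}
  {compress : Vec p → S → Vec p} {ξ : ℕ → Fin n → Ω → Ξ} {s : ℕ → Fin n → Ω → S}
  {Z : ℕ → Ω → State n p}

/-- The vectors that are to be communicated at time `k`. -/
def target (η : ℝ) (oracle : Fin n → Vec p → Ξ → Vec p) (ξ : ℕ → Fin n → Ω → Ξ)
    (Z : ℕ → Ω → State n p) (k : ℕ) (i : Fin n) (ω : Ω) : Vec p :=
  (Z k ω).x i - η • oracle i ((Z k ω).x i) (ξ (k + 1) i ω) - (Z k ω).d i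

/-- The compression errors at time `k`. -/
def error (η : ℝ) (oracle : Fin n → Vec p → Ξ → Vec p) (compress : Vec p → S → Vec p)
    (ξ : ℕ → Fin n → Ω → Ξ) (s : ℕ → Fin n → Ω → S) (Z : ℕ → Ω → State n p) (k : ℕ) (i : Fin n)
    (ω : Ω) : Vec p :=
  compress (target η oracle ξ Z k i ω - (Z k ω).h i) (s k i ω)
    - (target η oracle ξ Z k i ω - (Z k ω).h i)

lemma yhat_eq (k : ℕ) (ω : Ω) (i : Fin n) :
    (Z k ω).h i + compress (target η oracle ξ Z k i ω - (Z k ω).h i) (s k i ω)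
      = target η oracle ξ Z k i ω + error η oracle compress ξ s Z k i ω := by
  unfold error
  abel

variable (hZ : IsRun G W α γ η xInit hInit oracle compress ξ s Z)

include hZ

/-- The mixed copies obey the same affine recursion as `h`, with `q` replaced by its mixture.
Transmitting only `q` therefore suffices to form the mixture of `yhat`. -/
lemma hw_eq (k : ℕ) (ω : Ω) (i : Fin n) : (Z k ω).hw i = ∑ j, W i j • (Z k ω).h j := by
  induction k generalizing i with
  | zero => rw [hZ.zero]; exact hZ.mixing.mix_eq _ _
  | succ k ih =>
    rw [hZ.succ]
    simp only [step, comm]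
    rw [ih, hZ.mixing.mix_eq]
    simp only [smul_add, Finset.smul_sum, Finset.sum_add_distrib, smul_comm (W i _)]

lemma step_d (k : ℕ) (ω : Ω) (i : Fin n) :
    (Z (k + 1) ω).d i = (Z k ω).d i + (γ / 2) •
      (target η oracle ξ Z k i ω + error η oracle compress ξ s Z k i ω
        - ∑ j, W i j • (target η oracle ξ Z k j ω + error η oracle compress ξ s Z k j ω)) := by
  rw [hZ.succ]
  simp only [step, comm]
  rw [hZ.hw_eq, hZ.mixing.mix_eq, ← Finset.sum_add_distrib]
  simp only [← smul_add]
  simp only [← yhat_eq]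
  rfl

lemma step_x (k : ℕ) (ω : Ω) (i : Fin n) :
    (Z (k + 1) ω).x i
      = (Z k ω).x i - η • oracle i ((Z k ω).x i) (ξ (k + 1) i ω) - (Z (k + 1) ω).d i := by
  rw [hZ.succ]
  rfl

lemma step_h (k : ℕ) (ω : Ω) (i : Fin n) :
    (Z (k + 1) ω).h i = (1 - α) • (Z k ω).h i
      + α • (target η oracle ξ Z k i ω + error η oracle compress ξ s Z k i ω) := by
  rw [← yhat_eq, hZ.succ]
  rfl

/-- The state at time `k` is determined by the samples and the seeds drawn before. -/
lemma measurable_state [MeasurableSpace Ω] [MeasurableSpace Ξ] [MeasurableSpace S]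
    (ho : ∀ i, Measurable (Function.uncurry (oracle i)))
    (hc : Measurable (Function.uncurry compress)) (k : ℕ)
    (hξ : ∀ u ≤ k, ∀ j, Measurable (ξ u j)) (hs : ∀ l < k, ∀ j, Measurable (s l j)) (i : Fin n) :
    Measurable (fun ω => (Z k ω).x i) ∧ Measurable (fun ω => (Z k ω).d i) ∧
      Measurable (fun ω => (Z k ω).h i) := by
  induction k generalizing i with
  | zero =>
    simp only [hZ.zero, initState]
    refine ⟨measurable_const.sub (Measurable.const_smul ?_ η), measurable_const, measurable_const⟩
    exact (ho i).comp (measurable_const.prodMk (hξ 0 le_rfl i))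
  | succ k ih =>
    have ih' := ih (fun u hu => hξ u (hu.trans (Nat.le_succ k))) fun l hl => hs l (hl.trans_le
      (Nat.le_succ k))
    have hg : ∀ i, Measurable fun ω => oracle i ((Z k ω).x i) (ξ (k + 1) i ω) := fun i =>
      (ho i).comp ((ih' i).1.prodMk (hξ (k + 1) le_rfl i))
    have hy : ∀ i, Measurable (target η oracle ξ Z k i) := fun i =>
      ((ih' i).1.sub ((hg i).const_smul η)).sub (ih' i).2.1
    have he : ∀ i, Measurable (error η oracle compress ξ s Z k i) := fun i =>
      (hc.comp (((hy i).sub (ih' i).2.2).prodMk (hs k (Nat.lt_succ_self k) i))).sub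
        ((hy i).sub (ih' i).2.2)
    have hd : Measurable fun ω => (Z (k + 1) ω).d i := by
      simp only [hZ.step_d]
      have hsum : Measurable fun ω => ∑ j, W i j •
          (target η oracle ξ Z k j ω + error η oracle compress ξ s Z k j ω) :=
        Finset.measurable_sum _ fun j _ => ((hy j).add (he j)).const_smul (W i j)
      exact (ih' i).2.1.add ((((hy i).add (he i)).sub hsum).const_smul (γ / 2))
    refine ⟨?_, hd, ?_⟩
    · simp only [hZ.step_x]
      exact ((ih' i).1.sub ((hg i).const_smul η)).sub hd
    · simp only [hZ.step_h]
      exact ((ih' i).2.2.const_smul (1 - α)).add (((hy i).add (he i)).const_smul α)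

end Dynamics

end IsRun

/-! ### History -/

section History

variable {Ω Ξ S : Type*} [MeasurableSpace Ξ] [MeasurableSpace S] {n : ℕ}
  {ξ : ℕ → Fin n → Ω → Ξ} {s : ℕ → Fin n → Ω → S}

lemma measurable_sample_historyGrad {u t : ℕ} (hu : u < t) (j : Fin n) :
    Measurable[historyGrad ξ s t] (ξ u j) :=
  (comap_measurable (ξ u j)).mono
    (le_sup_of_le_left (le_iSup_of_le u (le_iSup_of_le hu (le_iSup_of_le j le_rfl)))) le_rfl

lemma measurable_seed_historyGrad {l t : ℕ} (hl : l + 1 < t) (j : Fin n) :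
    Measurable[historyGrad ξ s t] (s l j) :=
  (comap_measurable (s l j)).mono
    (le_sup_of_le_right (le_iSup_of_le l (le_iSup_of_le hl (le_iSup_of_le j le_rfl)))) le_rfl

lemma measurable_sample_historyComp {u k : ℕ} (hu : u ≤ k + 1) (j : Fin n) :
    Measurable[historyComp ξ s k] (ξ u j) :=
  (comap_measurable (ξ u j)).mono
    (le_sup_of_le_left (le_iSup_of_le u (le_iSup_of_le hu (le_iSup_of_le j le_rfl)))) le_rfl

lemma measurable_seed_historyComp {l k : ℕ} (hl : l < k) (j : Fin n) :
    Measurable[historyComp ξ s k] (s l j) :=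
  (comap_measurable (s l j)).mono
    (le_sup_of_le_right (le_iSup_of_le l (le_iSup_of_le hl (le_iSup_of_le j le_rfl)))) le_rfl

lemma historyComp_le [mΩ : MeasurableSpace Ω] (hξ : ∀ t i, Measurable (ξ t i))
    (hs : ∀ k i, Measurable (s k i)) (k : ℕ) :
    historyComp ξ s k ≤ mΩ :=
  sup_le (iSup_le fun u => iSup_le fun _ => iSup_le fun j => (hξ u j).comap_le)
    (iSup_le fun l => iSup_le fun _ => iSup_le fun j => (hs l j).comap_le)

end History

/-! ### Stochastic runs -/

namespace RandomVec

variable {Ω : Type*} [MeasurableSpace Ω] {μ : Measure Ω} {p : ℕ}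

open Classical in
/-- A random vector as an element of the semi-inner product space; it is replaced by `0` if it is
not square-integrable. -/
def lift (μ : Measure Ω) (f : Ω → Vec p) : RandomVec μ p := if hf : MemLp f 2 μ then of f hf else 0

lemma lift_apply {f : Ω → Vec p} (hf : MemLp f 2 μ) (ω : Ω) : lift μ f ω = f ω := by
  rw [lift, dif_pos hf, of_apply]

lemma inner_lift {f g : Ω → Vec p} (hf : MemLp f 2 μ) (hg : MemLp g 2 μ) :
    ⟪lift μ f, lift μ g⟫ = ∫ ω, ⟪f ω, g ω⟫ ∂μ := by
  simp_rw [inner_eq, lift_apply hf, lift_apply hg]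

lemma norm_sq_lift {f : Ω → Vec p} (hf : MemLp f 2 μ) :
    ‖lift μ f‖ ^ 2 = ∫ ω, ‖f ω‖ ^ 2 ∂μ := by
  simp_rw [norm_sq_eq, lift_apply hf]

end RandomVec

open RandomVec

section Run

variable {Ω Ξ S : Type*} [mΩ : MeasurableSpace Ω] [StandardBorelSpace Ω] [MeasurableSpace Ξ]
  [MeasurableSpace S] {n p : ℕ}

/-- The assumptions on a run up to the horizon `K`. -/
structure IsStochasticRun (μ : Measure Ω) [IsProbabilityMeasure μ] (ν : Measure S)
    (G : SimpleGraph (Fin n)) (W : Matrix (Fin n) (Fin n) ℝ) (L σ C α γ η : ℝ)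
    (f : Fin n → Vec p → ℝ) (fLow : Fin n → ℝ) (xInit hInit : Fin n → Vec p)
    (oracle : Fin n → Vec p → Ξ → Vec p) (compress : Vec p → S → Vec p) (ξ : ℕ → Fin n → Ω → Ξ)
    (s : ℕ → Fin n → Ω → S) (Z : ℕ → Ω → State n p) (K : ℕ) : Prop
    extends IsRun G W α γ η xInit hInit oracle compress ξ s Z where
  two_le : 2 ≤ n
  nonneg_C : 0 ≤ C
  smooth : IsSmoothBddBelow L f fLow
  compressor : IsUnbiasedCompressor ν compress C
  seeds : IsFreshSeeds μ ν ξ s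
  measurable_oracle : ∀ i, Measurable (Function.uncurry (oracle i))
  measurable_sample : ∀ t i, Measurable (ξ t i)
  good_init : IsGoodGradientSample μ (historyGrad ξ s 0) f oracle σ (fun i _ => xInit i) (ξ 0)
  good : ∀ k < K, IsGoodGradientSample μ (historyGrad ξ s (k + 1)) f oracle σ
    (fun i ω => (Z k ω).x i) (ξ (k + 1))

namespace IsStochasticRun

variable {μ : Measure Ω} [IsProbabilityMeasure μ] {ν : Measure S}
  {G : SimpleGraph (Fin n)} {W : Matrix (Fin n) (Fin n) ℝ} {L σ C α γ η : ℝ}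
  {f : Fin n → Vec p → ℝ} {fLow : Fin n → ℝ} {xInit hInit : Fin n → Vec p}
  {oracle : Fin n → Vec p → Ξ → Vec p} {compress : Vec p → S → Vec p} {ξ : ℕ → Fin n → Ω → Ξ}
  {s : ℕ → Fin n → Ω → S} {Z : ℕ → Ω → State n p} {K : ℕ}

/-- The noise of the stochastic gradients at time `k`. -/
def noise (f : Fin n → Vec p → ℝ) (oracle : Fin n → Vec p → Ξ → Vec p) (ξ : ℕ → Fin n → Ω → Ξ)
    (Z : ℕ → Ω → State n p) (k : ℕ) (i : Fin n) (ω : Ω) : Vec p :=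
  oracle i ((Z k ω).x i) (ξ (k + 1) i ω) - gradient (f i) ((Z k ω).x i)

variable (hR : IsStochasticRun μ ν G W L σ C α γ η f fLow xInit hInit oracle compress ξ s Z K)

include hR

/-- `IsRun.measurable_state` holds for any σ-algebra that makes the samples with index at most `k`
and the seeds before `k` measurable. Explicit application lets the history take the place of the
ambient σ-algebra. -/
lemma measurable_historyGrad (k : ℕ) (i : Fin n) :
    Measurable[historyGrad ξ s (k + 1)] (fun ω => (Z k ω).x i) ∧
      Measurable[historyGrad ξ s (k + 1)] (fun ω => (Z k ω).d i) ∧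
      Measurable[historyGrad ξ s (k + 1)] (fun ω => (Z k ω).h i) :=
  @IsRun.measurable_state _ _ _ _ _ _ _ _ _ _ _ _ _ _ _ _ _ hR.toIsRun (historyGrad ξ s (k + 1)) _ _
    hR.measurable_oracle hR.compressor.measurable k
    (fun _ hu j => measurable_sample_historyGrad (Nat.lt_succ_of_le hu) j)
    (fun _ hl j => measurable_seed_historyGrad (Nat.succ_lt_succ hl) j) i

lemma measurable_historyComp (k : ℕ) (i : Fin n) :
    Measurable[historyComp ξ s k] (fun ω => (Z k ω).x i) ∧
      Measurable[historyComp ξ s k] (fun ω => (Z k ω).d i) ∧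
      Measurable[historyComp ξ s k] (fun ω => (Z k ω).h i) :=
  @IsRun.measurable_state _ _ _ _ _ _ _ _ _ _ _ _ _ _ _ _ _ hR.toIsRun (historyComp ξ s k) _ _
    hR.measurable_oracle hR.compressor.measurable k
    (fun _ hu j => measurable_sample_historyComp (hu.trans (Nat.le_succ k)) j)
    (fun _ hl j => measurable_seed_historyComp hl j) i

/-- The target uses the sample `ξ (k + 1)`, which `historyComp` at `k` already contains. The
compression error is thus orthogonal to the current gradient noise too. -/
lemma measurable_target (k : ℕ) (i : Fin n) :
    Measurable[historyComp ξ s k] (IsRun.target η oracle ξ Z k i) := by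
  obtain ⟨hx, hd, -⟩ := hR.measurable_historyComp k i
  have hg : Measurable[historyComp ξ s k] fun ω => oracle i ((Z k ω).x i) (ξ (k + 1) i ω) :=
    (hR.measurable_oracle i).comp (hx.prodMk (measurable_sample_historyComp le_rfl i))
  exact (hx.sub (hg.const_smul η)).sub hd

lemma historyComp_le (k : ℕ) : historyComp ξ s k ≤ mΩ :=
  CEDAS.historyComp_le hR.measurable_sample hR.seeds.measurable k

lemma memLp_noise {k : ℕ} (hk : k < K) (i : Fin n) : MemLp (noise f oracle ξ Z k i) 2 μ :=
  (hR.good k hk).memLp i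

lemma memLp_oracle {k : ℕ} (hk : k < K) (i : Fin n) (hx : MemLp (fun ω => (Z k ω).x i) 2 μ) :
    MemLp (fun ω => oracle i ((Z k ω).x i) (ξ (k + 1) i ω)) 2 μ :=
  ((hR.memLp_noise hk i).add (hR.smooth.memLp_gradient i hx)).ae_eq
    (Filter.Eventually.of_forall fun ω => by simp [noise])

lemma measurable_avg (k : ℕ) : Measurable[historyGrad ξ s (k + 1)] fun ω => avg (Z k ω).x :=
  Measurable.const_smul (Finset.measurable_sum _ fun i _ => (hR.measurable_historyGrad k i).1)
    ((n : ℝ)⁻¹)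

lemma inner_noise_eq_zero {k : ℕ} (hk : k < K) (i : Fin n) {z : Ω → Vec p}
    (hz : Measurable[historyGrad ξ s (k + 1)] z) (hz2 : MemLp z 2 μ) :
    ⟪lift μ z, lift μ (noise f oracle ξ Z k i)⟫ = 0 := by
  rw [inner_lift hz2 (hR.memLp_noise hk i)]
  exact (hR.good k hk).integral_inner_eq_zero i hz hz2

lemma norm_sq_noise_le {k : ℕ} (hk : k < K) (i : Fin n) :
    ‖lift μ (noise f oracle ξ Z k i)‖ ^ 2 ≤ σ ^ 2 := by
  rw [norm_sq_lift (hR.memLp_noise hk i)]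
  exact (hR.good k hk).integral_norm_sq_le i

lemma norm_sq_mean_noise_le {k : ℕ} (hk : k < K) :
    n * ‖mean fun i => lift μ (noise f oracle ξ Z k i)‖ ^ 2 ≤ σ ^ 2 := by
  refine norm_sq_mean_orthogonal_le (zero_lt_two.trans_le hR.two_le) (hR.norm_sq_noise_le hk)
    fun i j hij => ?_
  rw [inner_lift (hR.memLp_noise hk i) (hR.memLp_noise hk j)]
  exact (hR.good k hk).integral_inner_noise_eq_zero hR.smooth.continuous_gradient
    hR.measurable_oracle (hR.measurable_sample _) (fun i => (hR.measurable_historyGrad k i).1) hij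

variable [IsProbabilityMeasure ν]

lemma memLp_error {k : ℕ} {i : Fin n} (hy : MemLp (IsRun.target η oracle ξ Z k i) 2 μ)
    (hh : MemLp (fun ω => (Z k ω).h i) 2 μ) :
    MemLp (IsRun.error η oracle compress ξ s Z k i) 2 μ ∧
      ∫ ω, ‖IsRun.error η oracle compress ξ s Z k i ω‖ ^ 2 ∂μ
        ≤ C * ∫ ω, ‖IsRun.target η oracle ξ Z k i ω - (Z k ω).h i‖ ^ 2 ∂μ :=
  hR.compressor.memLp_error hR.nonneg_C (hR.historyComp_le k) (hR.seeds.measurable k i)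
    (hR.seeds.law k i) (hR.seeds.indep k i)
    ((hR.measurable_target k i).sub (hR.measurable_historyComp k i).2.2) (hy.sub hh)

/-- Each step preserves square-integrability: the noise is square-integrable by assumption, the
gradient grows linearly, and the compressor has relative variance. The step from `k` needs the
oracle assumption at `k < K`. -/
lemma memLp_state {k : ℕ} (hk : k ≤ K) (i : Fin n) :
    MemLp (fun ω => (Z k ω).x i) 2 μ ∧ MemLp (fun ω => (Z k ω).d i) 2 μ ∧
      MemLp (fun ω => (Z k ω).h i) 2 μ := by
  induction k generalizing i with
  | zero =>
    simp only [hR.zero, initState]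
    refine ⟨(memLp_const _).sub (MemLp.const_smul ?_ η), memLp_const _, memLp_const _⟩
    exact ((hR.good_init.memLp i).add (memLp_const (gradient (f i) (xInit i)))).ae_eq
      (Filter.Eventually.of_forall fun ω => by simp)
  | succ k ih =>
    have hk' : k < K := hk
    have ih' := fun i => ih hk'.le i
    have hg := fun i => hR.memLp_oracle hk' i (ih' i).1
    have hy : ∀ i, MemLp (IsRun.target η oracle ξ Z k i) 2 μ := fun i =>
      ((ih' i).1.sub ((hg i).const_smul η)).sub (ih' i).2.1
    have he := fun i => (hR.memLp_error (hy i) (ih' i).2.2).1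
    have hd : MemLp (fun ω => (Z (k + 1) ω).d i) 2 μ := by
      simp only [hR.step_d]
      have hsum : MemLp (fun ω => ∑ j, W i j • (IsRun.target η oracle ξ Z k j ω
          + IsRun.error η oracle compress ξ s Z k j ω)) 2 μ :=
        memLp_finsetSum _ fun j _ => ((hy j).add (he j)).const_smul (W i j)
      exact (ih' i).2.1.add ((((hy i).add (he i)).sub hsum).const_smul (γ / 2))
    refine ⟨?_, hd, ?_⟩
    · simp only [hR.step_x]
      exact ((ih' i).1.sub ((hg i).const_smul η)).sub hd
    · simp only [hR.step_h]
      exact ((ih' i).2.2.const_smul (1 - α)).add (((hy i).add (he i)).const_smul α)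

lemma memLp_target {k : ℕ} (hk : k < K) (i : Fin n) :
    MemLp (IsRun.target η oracle ξ Z k i) 2 μ :=
  ((hR.memLp_state hk.le i).1.sub ((hR.memLp_oracle hk i (hR.memLp_state hk.le i).1).const_smul
    η)).sub (hR.memLp_state hk.le i).2.1

lemma memLp_avg {k : ℕ} (hk : k ≤ K) : MemLp (fun ω => avg (Z k ω).x) 2 μ := by
  have h : MemLp (fun ω => ∑ i, (Z k ω).x i) 2 μ :=
    memLp_finsetSum _ fun i _ => (hR.memLp_state hk i).1
  exact h.const_smul ((n : ℝ)⁻¹)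

lemma memLp_gradAvg {k : ℕ} (hk : k ≤ K) (i : Fin n) :
    MemLp (fun ω => gradient (f i) (avg (Z k ω).x)) 2 μ :=
  hR.smooth.memLp_gradient i (hR.memLp_avg hk)

lemma inner_error_eq_zero {k : ℕ} (hk : k < K) (i : Fin n) {z : Ω → Vec p}
    (hz : Measurable[historyComp ξ s k] z) (hz2 : MemLp z 2 μ) :
    ⟪lift μ z, lift μ (IsRun.error η oracle compress ξ s Z k i)⟫ = 0 := by
  have hy := hR.memLp_target hk i
  have hh := (hR.memLp_state hk.le i).2.2
  rw [inner_lift hz2 (hR.memLp_error hy hh).1]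
  exact hR.compressor.integral_inner_error hR.nonneg_C (hR.historyComp_le k)
    (hR.seeds.measurable k i) (hR.seeds.law k i) (hR.seeds.indep k i)
    ((hR.measurable_target k i).sub (hR.measurable_historyComp k i).2.2) (hy.sub hh) hz hz2

end IsStochasticRun

end Run

/-! ### One step of a stochastic run -/

namespace IsStochasticRun

open RandomVec

variable {Ω Ξ S : Type*} [mΩ : MeasurableSpace Ω] [StandardBorelSpace Ω] [MeasurableSpace Ξ]
  [MeasurableSpace S] {n p : ℕ}

/-- The solutions at time `k`. -/
def sol (μ : Measure Ω) (Z : ℕ → Ω → State n p) (k : ℕ) (i : Fin n) : RandomVec μ p :=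
  lift μ fun ω => (Z k ω).x i

/-- The dual variables at time `k`. -/
def dual (μ : Measure Ω) (Z : ℕ → Ω → State n p) (k : ℕ) (i : Fin n) : RandomVec μ p :=
  lift μ fun ω => (Z k ω).d i

/-- The compression references at time `k`. -/
def ref (μ : Measure Ω) (Z : ℕ → Ω → State n p) (k : ℕ) (i : Fin n) : RandomVec μ p :=
  lift μ fun ω => (Z k ω).h i

/-- The gradients at the solutions at time `k`. -/
def gradSol (μ : Measure Ω) (f : Fin n → Vec p → ℝ) (Z : ℕ → Ω → State n p) (k : ℕ) (i : Fin n) :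
    RandomVec μ p :=
  lift μ fun ω => gradient (f i) ((Z k ω).x i)

/-- The gradients at the average of the solutions at time `k`. -/
def gradAvg (μ : Measure Ω) (f : Fin n → Vec p → ℝ) (Z : ℕ → Ω → State n p) (k : ℕ) (i : Fin n) :
    RandomVec μ p :=
  lift μ fun ω => gradient (f i) (avg (Z k ω).x)

/-- The consensus error at time `k`. -/
def consensusError (μ : Measure Ω) (Z : ℕ → Ω → State n p) (k : ℕ) : ℝ :=
  ∑ j, ‖sol μ Z k j - mean (sol μ Z k)‖ ^ 2

variable {μ : Measure Ω} [IsProbabilityMeasure μ] {ν : Measure S}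
  {G : SimpleGraph (Fin n)} {W : Matrix (Fin n) (Fin n) ℝ} {L σ C α γ η : ℝ}
  {f : Fin n → Vec p → ℝ} {fLow : Fin n → ℝ} {xInit hInit : Fin n → Vec p}
  {oracle : Fin n → Vec p → Ξ → Vec p} {compress : Vec p → S → Vec p} {ξ : ℕ → Fin n → Ω → Ξ}
  {s : ℕ → Fin n → Ω → S} {Z : ℕ → Ω → State n p} {K : ℕ} [IsProbabilityMeasure ν]

variable (hR : IsStochasticRun μ ν G W L σ C α γ η f fLow xInit hInit oracle compress ξ s Z K)

include hR

lemma sol_apply {k : ℕ} (hk : k ≤ K) (i : Fin n) (ω : Ω) : sol μ Z k i ω = (Z k ω).x i :=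
  lift_apply (hR.memLp_state hk i).1 ω

lemma dual_apply {k : ℕ} (hk : k ≤ K) (i : Fin n) (ω : Ω) : dual μ Z k i ω = (Z k ω).d i :=
  lift_apply (hR.memLp_state hk i).2.1 ω

lemma ref_apply {k : ℕ} (hk : k ≤ K) (i : Fin n) (ω : Ω) : ref μ Z k i ω = (Z k ω).h i :=
  lift_apply (hR.memLp_state hk i).2.2 ω

lemma gradSol_apply {k : ℕ} (hk : k ≤ K) (i : Fin n) (ω : Ω) :
    gradSol μ f Z k i ω = gradient (f i) ((Z k ω).x i) :=
  lift_apply (hR.smooth.memLp_gradient i (hR.memLp_state hk i).1) ω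

lemma gradAvg_apply {k : ℕ} (hk : k ≤ K) (i : Fin n) (ω : Ω) :
    gradAvg μ f Z k i ω = gradient (f i) (avg (Z k ω).x) :=
  lift_apply (hR.memLp_gradAvg hk i) ω

lemma mean_sol_apply {k : ℕ} (hk : k ≤ K) (ω : Ω) : mean (sol μ Z k) ω = avg (Z k ω).x := by
  rw [RandomVec.mean_apply]
  simp_rw [hR.sol_apply hk]

lemma mean_gradAvg_apply {k : ℕ} (hk : k ≤ K) (ω : Ω) :
    mean (gradAvg μ f Z k) ω = gradient (avgFun f) (avg (Z k ω).x) := by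
  rw [RandomVec.mean_apply, hR.smooth.gradient_avgFun]
  simp_rw [hR.gradAvg_apply hk]

/-- The dynamics of a run in the space of square-integrable random vectors. -/
lemma dynamics {k : ℕ} (hk : k < K) :
    (fun i => lift μ (IsRun.target η oracle ξ Z k i))
        = sol μ Z k - η • (gradSol μ f Z k + fun i => lift μ (noise f oracle ξ Z k i))
          - dual μ Z k ∧
      dual μ Z (k + 1) = dual μ Z k + (γ / 2) •
        (((fun i => lift μ (IsRun.target η oracle ξ Z k i))
            + fun i => lift μ (IsRun.error η oracle compress ξ s Z k i))
          - fun j => ∑ l, W j l • ((fun i => lift μ (IsRun.target η oracle ξ Z k i))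
            + fun i => lift μ (IsRun.error η oracle compress ξ s Z k i)) l) ∧
      sol μ Z (k + 1) = sol μ Z k
        - η • (gradSol μ f Z k + fun i => lift μ (noise f oracle ξ Z k i)) - dual μ Z (k + 1) ∧
      ref μ Z (k + 1) = (1 - α) • ref μ Z k
        + α • ((fun i => lift μ (IsRun.target η oracle ξ Z k i))
            + fun i => lift μ (IsRun.error η oracle compress ξ s Z k i)) := by
  have hk' : k + 1 ≤ K := hk
  have hy := fun i => lift_apply (hR.memLp_target hk i)
  have he := fun i => lift_apply
    (hR.memLp_error (hR.memLp_target hk i) (hR.memLp_state hk.le i).2.2).1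
  have hw := fun i => lift_apply (hR.memLp_noise hk i)
  refine ⟨?_, ?_, ?_, ?_⟩
  · refine funext fun i => RandomVec.ext fun ω => ?_
    simp only [Pi.sub_apply, Pi.smul_apply, Pi.add_apply, RandomVec.sub_apply, RandomVec.smul_apply,
      RandomVec.add_apply,
      hR.sol_apply hk.le, hR.dual_apply hk.le, hR.gradSol_apply hk.le, hw, hy, IsRun.target, noise,
      add_sub_cancel]
  · refine funext fun i => RandomVec.ext fun ω => ?_
    simp only [Pi.sub_apply, Pi.smul_apply, Pi.add_apply, RandomVec.sub_apply, RandomVec.smul_apply,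
      RandomVec.add_apply,
      RandomVec.sum_apply, hR.dual_apply hk.le, hR.dual_apply hk', hy, he, hR.step_d]
  · refine funext fun i => RandomVec.ext fun ω => ?_
    simp only [Pi.sub_apply, Pi.smul_apply, Pi.add_apply, RandomVec.sub_apply, RandomVec.smul_apply,
      RandomVec.add_apply,
      hR.sol_apply hk.le, hR.sol_apply hk', hR.dual_apply hk', hR.gradSol_apply hk.le, hw, noise,
      add_sub_cancel, hR.step_x]
  · refine funext fun i => RandomVec.ext fun ω => ?_
    simp only [Pi.smul_apply, Pi.add_apply, RandomVec.smul_apply, RandomVec.add_apply,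
      hR.ref_apply hk.le, hR.ref_apply hk', hy, he, hR.step_h]

lemma mean_dual_eq_zero {k : ℕ} (hk : k ≤ K) : mean (dual μ Z k) = 0 := by
  induction k with
  | zero =>
    have : dual μ Z 0 = 0 := by
      refine funext fun i => RandomVec.ext fun ω => ?_
      rw [hR.dual_apply hk, hR.zero]
      rfl
    rw [this, map_zero]
  | succ k ih =>
    have hk' : k < K := hk
    rw [(hR.dynamics hk').2.1, mean_dual_step hR.mixing.symm_apply hR.mixing.row_sum, ih hk'.le]

lemma norm_gradSol_sub_le (hL : 0 ≤ L) {k : ℕ} (hk : k ≤ K) (j : Fin n) :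
    ‖gradSol μ f Z k j - gradAvg μ f Z k j‖ ≤ L * ‖sol μ Z k j - mean (sol μ Z k)‖ := by
  refine norm_le_mul_of_forall hL fun ω => ?_
  rw [RandomVec.sub_apply, RandomVec.sub_apply, hR.gradSol_apply hk, hR.gradAvg_apply hk,
    hR.sol_apply hk, hR.mean_sol_apply hk]
  exact hR.smooth.lipschitz j _ _

lemma norm_gradAvg_sub_le (hL : 0 ≤ L) {k : ℕ} (hk : k + 1 ≤ K) (j : Fin n) :
    ‖gradAvg μ f Z (k + 1) j - gradAvg μ f Z k j‖
      ≤ L * ‖mean (sol μ Z (k + 1)) - mean (sol μ Z k)‖ := by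
  have hk' : k ≤ K := (Nat.le_succ k).trans hk
  refine norm_le_mul_of_forall hL fun ω => ?_
  rw [RandomVec.sub_apply, RandomVec.sub_apply, hR.gradAvg_apply hk, hR.gradAvg_apply hk',
    hR.mean_sol_apply hk, hR.mean_sol_apply hk']
  exact hR.smooth.lipschitz j _ _

/-- Only a sum of second moments over the agents is needed, so the argument requires no independence
of the seeds across agents. -/
lemma sum_norm_sq_error_le {k : ℕ} (hk : k < K) :
    ∑ j, ‖lift μ (IsRun.error η oracle compress ξ s Z k j)‖ ^ 2
      ≤ C * ∑ j, ‖lift μ (IsRun.target η oracle ξ Z k j) - ref μ Z k j‖ ^ 2 := by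
  rw [Finset.mul_sum]
  refine Finset.sum_le_sum fun j _ => ?_
  have h := hR.memLp_error (hR.memLp_target hk j) (hR.memLp_state hk.le j).2.2
  rw [norm_sq_lift h.1, norm_sq_eq]
  simp_rw [RandomVec.sub_apply, lift_apply (hR.memLp_target hk j), hR.ref_apply hk.le]
  exact h.2

lemma inner_noise {k : ℕ} (hk : k < K) (j l : Fin n) :
    ⟪sol μ Z k j, lift μ (noise f oracle ξ Z k l)⟫ = 0 ∧
      ⟪dual μ Z k j, lift μ (noise f oracle ξ Z k l)⟫ = 0 ∧
      ⟪ref μ Z k j, lift μ (noise f oracle ξ Z k l)⟫ = 0 ∧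
      ⟪gradSol μ f Z k j, lift μ (noise f oracle ξ Z k l)⟫ = 0 ∧
      ⟪gradAvg μ f Z k j, lift μ (noise f oracle ξ Z k l)⟫ = 0 := by
  obtain ⟨hx, hd, hh⟩ := hR.measurable_historyGrad k j
  obtain ⟨hx2, hd2, hh2⟩ := hR.memLp_state hk.le j
  exact ⟨hR.inner_noise_eq_zero hk l hx hx2, hR.inner_noise_eq_zero hk l hd hd2,
    hR.inner_noise_eq_zero hk l hh hh2,
    hR.inner_noise_eq_zero hk l ((hR.smooth.continuous_gradient j).measurable.comp hx)
      (hR.smooth.memLp_gradient j hx2),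
    hR.inner_noise_eq_zero hk l
      ((hR.smooth.continuous_gradient j).measurable.comp (hR.measurable_avg k))
      (hR.memLp_gradAvg hk.le j)⟩

lemma inner_error {k : ℕ} (hk : k < K) (j l : Fin n) :
    ⟪dual μ Z k j, lift μ (IsRun.error η oracle compress ξ s Z k l)⟫ = 0 ∧
      ⟪ref μ Z k j, lift μ (IsRun.error η oracle compress ξ s Z k l)⟫ = 0 ∧
      ⟪gradAvg μ f Z k j, lift μ (IsRun.error η oracle compress ξ s Z k l)⟫ = 0 ∧
      ⟪lift μ (IsRun.target η oracle ξ Z k j),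
        lift μ (IsRun.error η oracle compress ξ s Z k l)⟫ = 0 := by
  obtain ⟨hx, hd, hh⟩ := hR.measurable_historyComp k j
  obtain ⟨hx2, hd2, hh2⟩ := hR.memLp_state hk.le j
  have havg : Measurable[historyComp ξ s k] fun ω => avg (Z k ω).x :=
    Measurable.const_smul (Finset.measurable_sum _ fun i _ => (hR.measurable_historyComp k i).1)
      ((n : ℝ)⁻¹)
  exact ⟨hR.inner_error_eq_zero hk l hd hd2, hR.inner_error_eq_zero hk l hh hh2,
    hR.inner_error_eq_zero hk l ((hR.smooth.continuous_gradient j).measurable.comp havg)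
      (hR.memLp_gradAvg hk.le j),
    hR.inner_error_eq_zero hk l (hR.measurable_target k j) (hR.memLp_target hk j)⟩

/-- The decrease of the Lyapunov function along a run. -/
theorem lyapunov_succ_le {lam2 : ℝ} {U : Fin n → Fin n → ℝ} {lam : Fin n → ℝ} {i₀ : Fin n}
    (hU : IsModeBasis W lam2 U lam i₀) {m : ℝ} (hlam2 : lam2 < 1) (hlam2' : -1 ≤ lam2)
    (hm : m = γ * (1 - lam2) / 2) (hγ0 : 0 < γ) (hγ : γ ≤ 1 / 72) (hα : 0 < α) (hα1 : α ≤ 1)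
    (hαC : α * C = 1 / 12) (hγC : 864 * (γ * (γ * C)) = α ^ 2 * m) (hη : 0 ≤ η) (hL : 0 ≤ L)
    (hηL : η * L ≤ m / 8) {k : ℕ} (hk : k < K) :
    networkLyapunov U lam i₀ C α γ η (sol μ Z (k + 1)) (dual μ Z (k + 1)) (ref μ Z (k + 1))
        (gradAvg μ f Z (k + 1))
      ≤ networkLyapunov U lam i₀ C α γ η (sol μ Z k) (dual μ Z k) (ref μ Z k) (gradAvg μ f Z k)
        - m / 4 * consensusError μ Z k
        + 1 / 2 * (η ^ 2 * (n * ‖mean (gradAvg μ f Z k)‖ ^ 2)) + 3 * (η ^ 2 * (n * σ ^ 2)) := by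
  obtain ⟨hY, hD', hX', hH'⟩ := hR.dynamics hk
  exact networkLyapunov_step_le hU hlam2 hlam2' hm hγ0 hγ hα hα1 hαC hγC hη hL hηL hY hD' hX' hH'
    (hR.mean_dual_eq_zero hk.le) (hR.mean_dual_eq_zero hk)
    (fun j l => (hR.inner_noise hk j l).1) (fun j l => (hR.inner_noise hk j l).2.1)
    (fun j l => (hR.inner_noise hk j l).2.2.1) (fun j l => (hR.inner_noise hk j l).2.2.2.1)
    (fun j l => (hR.inner_noise hk j l).2.2.2.2) (fun j l => (hR.inner_error hk j l).1)
    (fun j l => (hR.inner_error hk j l).2.2.1) (fun j l => (hR.inner_error hk j l).2.2.2)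
    (fun j l => (hR.inner_error hk j l).2.1) (hR.norm_gradSol_sub_le hL hk.le)
    (hR.norm_gradAvg_sub_le hL hk) (hR.norm_sq_noise_le hk) (hR.norm_sq_mean_noise_le hk)
    (hR.sum_norm_sq_error_le hk)

end IsStochasticRun

/-- The descent lemma in expectation. -/
lemma IsSmoothBddBelow.integral_avgFun_le {Ω : Type*} [MeasurableSpace Ω] {μ : Measure Ω}
    [IsProbabilityMeasure μ] {n p : ℕ} {L : ℝ} {f : Fin n → Vec p → ℝ} {fLow : Fin n → ℝ}
    (hf : IsSmoothBddBelow L f fLow) (hn : 0 < n) {x y g : RandomVec μ p}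
    (hg : ∀ ω, g ω = gradient (avgFun f) (x ω)) :
    ∫ ω, avgFun f (y ω) ∂μ ≤ ∫ ω, avgFun f (x ω) ∂μ + (⟪g, y - x⟫ + L / 2 * ‖y - x‖ ^ 2) := by
  have h1 := integrable_inner_of_memLp g.memLp (y - x).memLp
  have h2 := ((y - x).memLp.integrable_norm_pow two_ne_zero).const_mul (L / 2)
  have h3 := hf.integrable_avgFun hn x.memLp
  have h4 : Integrable (fun ω => ⟪g ω, (y - x) ω⟫ + L / 2 * ‖(y - x) ω‖ ^ 2) μ := h1.add h2
  rw [RandomVec.inner_eq, RandomVec.norm_sq_eq, ← integral_const_mul, ← integral_add h1 h2,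
    ← integral_add h3 h4]
  refine integral_mono (hf.integrable_avgFun hn y.memLp) (h3.add h4) fun ω => ?_
  simp only
  rw [hg, RandomVec.sub_apply, ← add_assoc]
  exact le_add_of_lipschitz_gradient hf.differentiable_avgFun (hf.lipschitz_avgFun hn) _ _

namespace IsStochasticRun

open RandomVec

variable {Ω Ξ S : Type*} [mΩ : MeasurableSpace Ω] [StandardBorelSpace Ω] [MeasurableSpace Ξ]
  [MeasurableSpace S] {n p : ℕ} {μ : Measure Ω} [IsProbabilityMeasure μ] {ν : Measure S}
  {G : SimpleGraph (Fin n)} {W : Matrix (Fin n) (Fin n) ℝ} {L σ C α γ η : ℝ}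
  {f : Fin n → Vec p → ℝ} {fLow : Fin n → ℝ} {xInit hInit : Fin n → Vec p}
  {oracle : Fin n → Vec p → Ξ → Vec p} {compress : Vec p → S → Vec p} {ξ : ℕ → Fin n → Ω → Ξ}
  {s : ℕ → Fin n → Ω → S} {Z : ℕ → Ω → State n p} {K : ℕ} [IsProbabilityMeasure ν]

variable (hR : IsStochasticRun μ ν G W L σ C α γ η f fLow xInit hInit oracle compress ξ s Z K)

include hR

lemma descent_succ_le (hη : 0 ≤ η) (hL : 0 ≤ L) (hηL : η * L ≤ 1) {k : ℕ} (hk : k < K) :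
    ∫ ω, avgFun f (avg (Z (k + 1) ω).x) ∂μ
      ≤ ∫ ω, avgFun f (avg (Z k ω).x) ∂μ - η / 2 * ‖mean (gradAvg μ f Z k)‖ ^ 2
        + η * L ^ 2 / (2 * n) * consensusError μ Z k + L * η ^ 2 * σ ^ 2 / (2 * n) := by
  have hn : 0 < n := zero_lt_two.trans_le hR.two_le
  have h1 := hR.smooth.integral_avgFun_le hn (x := mean (sol μ Z k)) (y := mean (sol μ Z (k + 1)))
    (g := mean (gradAvg μ f Z k)) fun ω => by
      rw [hR.mean_gradAvg_apply hk.le, hR.mean_sol_apply hk.le]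
  have hstep : mean (sol μ Z (k + 1)) = mean (sol μ Z k) - η • (mean (gradSol μ f Z k)
      + mean fun i => lift μ (noise f oracle ξ Z k i)) := by
    rw [(hR.dynamics hk).2.2.1, map_sub, map_sub, map_smul, map_add,
      hR.mean_dual_eq_zero (k := k + 1) hk, sub_zero]
  have h2 := descent_step_le hn hη hL hηL hstep (fun j l => (hR.inner_noise hk j l).2.2.2.1)
    (fun j l => (hR.inner_noise hk j l).2.2.2.2) (hR.norm_gradSol_sub_le hL hk.le)
    (hR.norm_sq_mean_noise_le hk)
  simp_rw [hR.mean_sol_apply hk.le, hR.mean_sol_apply (k := k + 1) hk] at h1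
  unfold consensusError
  linarith

end IsStochasticRun

/-! ### The parameters -/

/-- From `C ≥ 1 / 12` and `1 - lam ≤ 2`, the third entry of the minimum is always the active one.
This makes `γ` explicit. -/
lemma gammaParam_eq {C α lam : ℝ} (hC : 1 / 12 ≤ C) (hα : α = alphaParam C) (hlam : lam < 1)
    (hlam' : -1 ≤ lam) :
    gammaParam C α lam = (1 - lam) / (248832 * C ^ 3) ∧ gammaParam C α lam ≤ 1 / 72 := by
  have hC0 : 0 < C := by linarith
  have hC2 : (1 / 12) ^ 2 ≤ C ^ 2 := by gcongr
  have hC3 : (1 / 12) ^ 3 ≤ C ^ 3 := by gcongr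
  have hx : α ^ 2 * (1 - lam) / (1728 * C) = (1 - lam) / (248832 * C ^ 3) := by
    rw [hα, alphaParam]; field_simp; ring
  set x := (1 - lam) / (248832 * C ^ 3) with hxdef
  have hx0 : 0 ≤ x := div_nonneg (by linarith) (by positivity)
  have hx1 : x ≤ 1 / 72 := by
    rw [hxdef, div_le_iff₀ (by positivity)]
    linarith
  have hx2 : x * C ≤ 1 / 864 := by
    rw [hxdef, div_mul_eq_mul_div, div_le_iff₀ (by positivity)]
    have h := mul_le_mul_of_nonneg_right hC2 hC0.le
    have h' := mul_le_mul_of_nonneg_right (show 1 - lam ≤ 2 by linarith) hC0.le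
    linarith
  have hx3 : x ≤ √α / (2 * √C) := by
    rw [le_div_iff₀ (by positivity)]
    refine Real.le_sqrt_of_sq_le ?_
    rw [mul_pow, mul_pow, Real.sq_sqrt hC0.le, hα, alphaParam, le_div_iff₀ (by positivity)]
    have h := mul_le_mul hx2 hx2 (by positivity) (by norm_num)
    linarith
  have h : gammaParam C α lam = x := by
    rw [gammaParam, hx]
    exact min_eq_right (le_min hx3 (by linarith))
  exact ⟨h, h.trans_le hx1⟩

/-! ### The initialisation of a run, and its average squared gradient -/

/-- Summation of the recursions of the objective values `F` and the Lyapunov function `Φ`. -/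
lemma sum_le_of_coupled_recursion {F Φ g e : ℕ → ℝ} {b η L σ m N : ℝ} {K : ℕ} (hη : 0 < η)
    (hL : 0 < L) (hN : 0 < N) (hm : 0 < m) (hm1 : m ≤ 1) (hηL : η * L ≤ m / 8)
    (hb : b ≤ F K) (hΦ : 0 ≤ Φ K) (hg : ∀ k, 0 ≤ g k)
    (hF : ∀ k < K, F (k + 1) ≤ F k - η / 2 * g k + η * L ^ 2 / (2 * N) * e k
      + L * η ^ 2 * σ ^ 2 / (2 * N))
    (hΦ' : ∀ k < K, Φ (k + 1) ≤ Φ k - m / 4 * e k + 1 / 2 * (η ^ 2 * (N * g k))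
      + 3 * (η ^ 2 * (N * σ ^ 2))) :
    η / 4 * ∑ k ∈ Finset.range K, g k ≤ F 0 - b + 2 * η * L ^ 2 / (N * m) * Φ 0
      + K * (L * η ^ 2 * σ ^ 2 / (2 * N) + 6 * η ^ 3 * L ^ 2 * σ ^ 2 / m) := by
  -- The choice makes `β m / 4` equal to the coefficient `η L² / (2 N)` of the consensus error in
  -- the descent inequality.
  set β := 2 * η * L ^ 2 / (N * m) with hβ
  have hβ0 : 0 ≤ β := by positivity
  have hsmall : η ^ 3 * L ^ 2 / m ≤ η / 4 := by
    rw [div_le_iff₀ hm]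
    calc η ^ 3 * L ^ 2 = η * (η * L) ^ 2 := by ring
      _ ≤ η * (m / 8) ^ 2 := by gcongr
      _ = η / 64 * m * m := by ring
      _ ≤ η / 64 * m * 1 := by gcongr
      _ ≤ η / 4 * m := by nlinarith [mul_pos hη hm]
  have hstep : ∀ k < K, F (k + 1) + β * Φ (k + 1) ≤ F k + β * Φ k - η / 4 * g k
      + (L * η ^ 2 * σ ^ 2 / (2 * N) + 6 * η ^ 3 * L ^ 2 * σ ^ 2 / m) := fun k hk => by
    have h1 := mul_le_mul_of_nonneg_left (hΦ' k hk) hβ0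
    have h2 : β * (Φ k - m / 4 * e k + 1 / 2 * (η ^ 2 * (N * g k)) + 3 * (η ^ 2 * (N * σ ^ 2)))
        = β * Φ k - η * L ^ 2 / (2 * N) * e k + η ^ 3 * L ^ 2 / m * g k
          + 6 * η ^ 3 * L ^ 2 * σ ^ 2 / m := by
      rw [hβ]; field_simp; ring
    have h3 := mul_le_mul_of_nonneg_right hsmall (hg k)
    linarith [hF k hk]
  have hsum : ∀ k ≤ K, F k + β * Φ k + η / 4 * ∑ l ∈ Finset.range k, g l ≤ F 0 + β * Φ 0
      + k * (L * η ^ 2 * σ ^ 2 / (2 * N) + 6 * η ^ 3 * L ^ 2 * σ ^ 2 / m) := by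
    intro k hk
    induction k with
    | zero => simp
    | succ k ih =>
      rw [Finset.sum_range_succ]
      push_cast
      linarith [ih (by omega), hstep k hk]
  linarith [hsum K le_rfl, mul_nonneg hβ0 hΦ]

namespace RandomVec

variable {Ω : Type*} [MeasurableSpace Ω] {μ : Measure Ω} [IsProbabilityMeasure μ] {n p : ℕ}

/-- Deterministic vectors as random vectors. -/
def const (μ : Measure Ω) (v : Fin n → Vec p) (i : Fin n) : RandomVec μ p := lift μ fun _ => v i

lemma const_apply (v : Fin n → Vec p) (i : Fin n) (ω : Ω) : const μ v i ω = v i :=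
  lift_apply (memLp_const _) ω

lemma sum_norm_sq_const (v : Fin n → Vec p) : ∑ j, ‖const μ v j‖ ^ 2 = stackedNormSq v := by
  refine Finset.sum_congr rfl fun j _ => ?_
  rw [const, norm_sq_lift (memLp_const _)]
  simp

lemma sum_norm_sq_const_sub_le {v : Fin n → RandomVec μ p} (w : Fin n → Vec p) :
    ∑ j, ‖mean v - const μ w j‖ ^ 2 ≤ 2 * ∑ j, ‖v j‖ ^ 2 + 2 * stackedNormSq w := by
  have h1 := norm_sq_mean_le v
  calc ∑ j, ‖mean v - const μ w j‖ ^ 2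
      ≤ ∑ j, (2 * ‖mean v‖ ^ 2 + 2 * ‖const μ w j‖ ^ 2) :=
        Finset.sum_le_sum fun j _ => norm_sub_sq_le_two _ _
    _ = 2 * (n * ‖mean v‖ ^ 2) + 2 * stackedNormSq w := by
        rw [Finset.sum_add_distrib, ← Finset.mul_sum, ← Finset.mul_sum, sum_norm_sq_const]
        simp
    _ ≤ _ := by linarith

end RandomVec

namespace IsStochasticRun

open RandomVec

variable {Ω Ξ S : Type*} [mΩ : MeasurableSpace Ω] [StandardBorelSpace Ω] [MeasurableSpace Ξ]
  [MeasurableSpace S] {n p : ℕ} {μ : Measure Ω} [IsProbabilityMeasure μ] {ν : Measure S}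
  {G : SimpleGraph (Fin n)} {W : Matrix (Fin n) (Fin n) ℝ} {L σ C α γ η : ℝ}
  {f : Fin n → Vec p → ℝ} {fLow : Fin n → ℝ} {xInit hInit : Fin n → Vec p}
  {oracle : Fin n → Vec p → Ξ → Vec p} {compress : Vec p → S → Vec p} {ξ : ℕ → Fin n → Ω → Ξ}
  {s : ℕ → Fin n → Ω → S} {Z : ℕ → Ω → State n p} {K : ℕ}

/-- The noise of the stochastic gradients of the initialisation. -/
def initNoise (f : Fin n → Vec p → ℝ) (oracle : Fin n → Vec p → Ξ → Vec p) (ξ : ℕ → Fin n → Ω → Ξ)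
    (xInit : Fin n → Vec p) (i : Fin n) (ω : Ω) : Vec p :=
  oracle i (xInit i) (ξ 0 i ω) - gradient (f i) (xInit i)

variable (hR : IsStochasticRun μ ν G W L σ C α γ η f fLow xInit hInit oracle compress ξ s Z K)

include hR

lemma memLp_initNoise (i : Fin n) : MemLp (initNoise f oracle ξ xInit i) 2 μ :=
  hR.good_init.memLp i

lemma inner_initNoise (v : Fin n → Vec p) (j l : Fin n) :
    ⟪const μ v j, lift μ (initNoise f oracle ξ xInit l)⟫ = 0 := by
  rw [const, inner_lift (memLp_const _) (hR.memLp_initNoise l)]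
  exact hR.good_init.integral_inner_eq_zero l measurable_const (memLp_const _)

lemma norm_sq_initNoise_le (i : Fin n) : ‖lift μ (initNoise f oracle ξ xInit i)‖ ^ 2 ≤ σ ^ 2 := by
  rw [norm_sq_lift (hR.memLp_initNoise i)]
  exact hR.good_init.integral_norm_sq_le i

lemma norm_sq_mean_initNoise_le :
    n * ‖mean fun i => lift μ (initNoise f oracle ξ xInit i)‖ ^ 2 ≤ σ ^ 2 := by
  refine norm_sq_mean_orthogonal_le (zero_lt_two.trans_le hR.two_le) hR.norm_sq_initNoise_le
    fun i j hij => ?_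
  rw [inner_lift (hR.memLp_initNoise i) (hR.memLp_initNoise j)]
  exact hR.good_init.integral_inner_noise_eq_zero hR.smooth.continuous_gradient
    hR.measurable_oracle (hR.measurable_sample _) (fun i => measurable_const) hij

variable [IsProbabilityMeasure ν]

lemma sol_zero : sol μ Z 0 = const μ xInit
    - η • (const μ (fun i => gradient (f i) (xInit i))
      + fun i => lift μ (initNoise f oracle ξ xInit i)) := by
  refine funext fun i => RandomVec.ext fun ω => ?_
  simp only [Pi.sub_apply, Pi.smul_apply, Pi.add_apply, RandomVec.sub_apply, RandomVec.smul_apply,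
    RandomVec.add_apply, hR.sol_apply (Nat.zero_le K), const_apply,
    lift_apply (hR.memLp_initNoise i), hR.zero, initState,
    initNoise, add_sub_cancel]

lemma dual_zero : dual μ Z 0 = 0 := by
  refine funext fun i => RandomVec.ext fun ω => ?_
  rw [hR.dual_apply (Nat.zero_le K), hR.zero]
  rfl

lemma ref_zero : ref μ Z 0 = const μ hInit := by
  refine funext fun i => RandomVec.ext fun ω => ?_
  rw [hR.ref_apply (Nat.zero_le K), hR.zero, const_apply]
  rfl

/-- The initialisation is itself a stochastic gradient step from `xInit`, so the descent estimate
applies; the consensus error there is at most `4 ‖xInit‖²`. -/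
lemma descent_init_le (hη : 0 ≤ η) (hL : 0 ≤ L) (hηL : η * L ≤ 1) :
    ∫ ω, avgFun f (avg (Z 0 ω).x) ∂μ ≤ avgFun f (avg xInit)
      + η * L ^ 2 / (2 * n) * (4 * stackedNormSq xInit) + L * η ^ 2 * σ ^ 2 / (2 * n) := by
  have hn : 0 < n := zero_lt_two.trans_le hR.two_le
  set g : Fin n → Vec p := fun i => gradient (f i) (avg xInit) with hg
  have hmean : ∀ (v : Fin n → Vec p) (ω : Ω), mean (const μ v) ω = avg v := fun v ω => by
    rw [RandomVec.mean_apply]; simp_rw [const_apply]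
  have h1 := hR.smooth.integral_avgFun_le hn (x := mean (const μ xInit)) (y := mean (sol μ Z 0))
    (g := mean (const μ g)) fun ω => by rw [hmean, hmean, hR.smooth.gradient_avgFun]
  have hstep : mean (sol μ Z 0) = mean (const μ xInit)
      - η • (mean (const μ fun i => gradient (f i) (xInit i))
        + mean fun i => lift μ (initNoise f oracle ξ xInit i)) := by
    rw [hR.sol_zero, map_sub, map_smul, map_add]
  have h2 := descent_step_le hn hη hL hηL hstep (hR.inner_initNoise _) (hR.inner_initNoise g)
    (fun j => norm_le_mul_of_forall hL fun ω => by
      rw [RandomVec.sub_apply, RandomVec.sub_apply, const_apply, const_apply, const_apply, hmean]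
      exact hR.smooth.lipschitz j _ _) hR.norm_sq_mean_initNoise_le
  have h3 : ∑ j, ‖const μ xInit j - mean (const μ xInit)‖ ^ 2 ≤ 4 * stackedNormSq xInit := by
    have h := sum_norm_sq_const_sub_le (v := const μ xInit) xInit
    simp_rw [norm_sub_rev (const μ xInit _)]
    rw [sum_norm_sq_const] at h
    linarith
  have h4 := mul_le_mul_of_nonneg_left h3 (show 0 ≤ η * L ^ 2 / (2 * n) by positivity)
  have h5 : 0 ≤ η / 2 * ‖mean (const μ g)‖ ^ 2 := by positivity
  simp_rw [hmean, hR.mean_sol_apply (Nat.zero_le K)] at h1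
  rw [integral_const, probReal_univ, one_smul] at h1
  linarith

lemma sum_norm_sq_sol_zero_le {b : ℝ} (hη : 0 ≤ η) (hη1 : η ≤ 1)
    (hx : stackedNormSq xInit ≤ b * (n : ℝ) ^ 2)
    (hg : stackedNormSq (fun i => gradient (f i) (xInit i)) ≤ b * (n : ℝ) ^ 2) :
    ∑ j, ‖sol μ Z 0 j‖ ^ 2 ≤ (6 * b + 4 * σ ^ 2) * (n : ℝ) ^ 2 := by
  have hn1 : (1 : ℝ) ≤ n := by exact_mod_cast one_le_two.trans hR.two_le
  set g := const μ fun i => gradient (f i) (xInit i)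
  have h1 : ∀ j, ‖sol μ Z 0 j‖ ^ 2 ≤ 2 * ‖const μ xInit j‖ ^ 2 + (4 * ‖g j‖ ^ 2 + 4 * σ ^ 2) :=
    fun j => by
    rw [hR.sol_zero]
    refine (norm_sub_sq_le_two _ _).trans (add_le_add_right ?_ _)
    rw [Pi.smul_apply, norm_smul, mul_pow, Real.norm_of_nonneg hη]
    have h2 : η ^ 2 ≤ 1 := pow_le_one₀ hη hη1
    have h3 := norm_add_sq_le_two (g j) (lift μ (initNoise f oracle ξ xInit j))
    have h4 := hR.norm_sq_initNoise_le j
    have h5 := mul_le_mul_of_nonneg_right h2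
      (sq_nonneg ‖g j + lift μ (initNoise f oracle ξ xInit j)‖)
    rw [Pi.add_apply]
    linarith
  have h2 := Finset.sum_le_sum fun j (_ : j ∈ Finset.univ) => h1 j
  rw [Finset.sum_add_distrib, Finset.sum_add_distrib, ← Finset.mul_sum, ← Finset.mul_sum,
    sum_norm_sq_const, sum_norm_sq_const, Finset.sum_const, Finset.card_univ, Fintype.card_fin,
    nsmul_eq_mul] at h2
  have h3 : (n : ℝ) * (4 * σ ^ 2) ≤ (n : ℝ) ^ 2 * (4 * σ ^ 2) := by
    gcongr
    nlinarith
  linarith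

/-- The factor `η² / m` in front of the gradients at the average is at most 1 because `η ≤ m ≤ 1`.
These gradients are compared with those at `xInit` by the Lipschitz bound. -/
lemma lyapunov_zero_le {lam2 : ℝ} {U : Fin n → Fin n → ℝ} {lam : Fin n → ℝ} {i₀ : Fin n}
    (hU : IsModeBasis W lam2 U lam i₀) {m b : ℝ} (hlam2 : lam2 < 1)
    (hm : m = γ * (1 - lam2) / 2) (hm1 : m ≤ 1) (hγ0 : 0 < γ) (hγ : γ ≤ 1 / 72)
    (hκ : trackWeight C α γ ≤ 1) (hη : 0 ≤ η) (hηm : n * η ≤ m) (hL : 0 ≤ L)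
    (hx : stackedNormSq xInit ≤ b * (n : ℝ) ^ 2) (hh : stackedNormSq hInit ≤ b * (n : ℝ) ^ 2)
    (hg : stackedNormSq (fun i => gradient (f i) (xInit i)) ≤ b * (n : ℝ) ^ 2) :
    networkLyapunov U lam i₀ C α γ η (sol μ Z 0) (dual μ Z 0) (ref μ Z 0) (gradAvg μ f Z 0)
      ≤ (1 + L ^ 2) * (28 * b + 16 * σ ^ 2) * (n : ℝ) ^ 2 := by
  have hn1 : (1 : ℝ) ≤ n := by exact_mod_cast one_le_two.trans hR.two_le
  have hm0 : 0 < m := by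
    have : 0 < 1 - lam2 := by linarith
    rw [hm]; positivity
  have hηm' : η ≤ m := (le_mul_of_one_le_left hη hn1).trans hηm
  have h1 := hR.sum_norm_sq_sol_zero_le hη (hηm'.trans hm1) hx hg
  have h2 : ∑ j, ‖gradAvg μ f Z 0 j‖ ^ 2
      ≤ (2 * b + 4 * L ^ 2 * (7 * b + 4 * σ ^ 2)) * (n : ℝ) ^ 2 := by
    set g := const μ fun i => gradient (f i) (xInit i)
    have h3 : ∀ j, ‖gradAvg μ f Z 0 j‖ ^ 2
        ≤ 2 * ‖g j‖ ^ 2 + 2 * (L ^ 2 * ‖mean (sol μ Z 0) - const μ xInit j‖ ^ 2) := fun j => by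
      have h4 : ‖gradAvg μ f Z 0 j - g j‖ ≤ L * ‖mean (sol μ Z 0) - const μ xInit j‖ :=
        norm_le_mul_of_forall hL fun ω => by
          rw [RandomVec.sub_apply, RandomVec.sub_apply, hR.gradAvg_apply (Nat.zero_le K),
            hR.mean_sol_apply (Nat.zero_le K), const_apply, const_apply]
          exact hR.smooth.lipschitz j _ _
      have h5 := norm_add_sq_le_two (g j) (gradAvg μ f Z 0 j - g j)
      have h6 := pow_le_pow_left₀ (norm_nonneg _) h4 2
      rw [add_sub_cancel] at h5
      rw [mul_pow] at h6
      linarith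
    have h4 := Finset.sum_le_sum fun j (_ : j ∈ Finset.univ) => h3 j
    rw [Finset.sum_add_distrib, ← Finset.mul_sum, ← Finset.mul_sum, ← Finset.mul_sum,
      sum_norm_sq_const] at h4
    have h5 := mul_le_mul_of_nonneg_left (sum_norm_sq_const_sub_le (v := sol μ Z 0) xInit)
      (sq_nonneg L)
    have h6 := mul_le_mul_of_nonneg_left (add_le_add h1 hx) (sq_nonneg L)
    linarith
  have h3 : η ^ 2 / m ≤ 1 := by
    rw [div_le_one hm0]
    nlinarith
  have h4 := networkLyapunov_init_le (η := η) hU hlam2 hm hγ0 hγ hκ (sol μ Z 0) (const μ hInit)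
    (gradAvg μ f Z 0)
  have h5 := mul_le_mul h3 h2 (Finset.sum_nonneg fun _ _ => sq_nonneg _) zero_le_one
  rw [sum_norm_sq_const] at h4
  rw [hR.dual_zero, hR.ref_zero]
  linarith

end IsStochasticRun

/-! ### The transient time -/

lemma param_bounds {C α γ lam m : ℝ} (hC : 1 / 12 ≤ C) (hα : α = alphaParam C)
    (hγ : γ = gammaParam C α lam) (hm : m = γ * (1 - lam) / 2) (hlam : lam < 1)
    (hlam' : -1 ≤ lam) :
    0 < α ∧ α ≤ 1 ∧ α * C = 1 / 12 ∧ 0 < γ ∧ γ ≤ 1 / 72 ∧ 0 < m ∧ m ≤ γ ∧ m * C ≤ 1 / 864 ∧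
      864 * (γ * (γ * C)) = α ^ 2 * m ∧ m = (1 - lam) ^ 2 / (497664 * C ^ 3) := by
  have hC0 : 0 < C := by linarith
  have hδ : 0 < 1 - lam := by linarith
  obtain ⟨h1, h2⟩ := gammaParam_eq hC hα hlam hlam'
  rw [← hγ] at h1 h2
  have hγ0 : 0 < γ := by rw [h1]; positivity
  have hm0 : 0 < m := by rw [hm]; positivity
  have hα' : α = 1 / (12 * C) := hα
  have hmγ : m ≤ γ := by rw [hm]; nlinarith
  have hγC : γ * C ≤ 1 / 864 := by
    have hC2 : (1 / 12) ^ 2 ≤ C ^ 2 := by gcongr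
    rw [h1, div_mul_eq_mul_div, div_le_iff₀ (by positivity)]
    have h := mul_le_mul_of_nonneg_right hC2 hC0.le
    have h' := mul_le_mul_of_nonneg_right (show 1 - lam ≤ 2 by linarith) hC0.le
    linarith
  refine ⟨by rw [hα']; positivity, ?_, by rw [hα']; field_simp, hγ0, h2, hm0, hmγ,
    (mul_le_mul_of_nonneg_right hmγ hC0.le).trans hγC, ?_, ?_⟩
  · rw [hα', div_le_one (by positivity)]
    linarith
  · rw [hm, h1, hα']
    field_simp
    norm_num
  · rw [hm, h1]
    field_simp
    norm_num

namespace IsStochasticRun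

open RandomVec

variable {Ω Ξ S : Type*} [mΩ : MeasurableSpace Ω] [StandardBorelSpace Ω] [MeasurableSpace Ξ]
  [MeasurableSpace S] {n p : ℕ} {μ : Measure Ω} [IsProbabilityMeasure μ] {ν : Measure S}
  {G : SimpleGraph (Fin n)} {W : Matrix (Fin n) (Fin n) ℝ} {L σ C α γ η : ℝ}
  {f : Fin n → Vec p → ℝ} {fLow : Fin n → ℝ} {xInit hInit : Fin n → Vec p}
  {oracle : Fin n → Vec p → Ξ → Vec p} {compress : Vec p → S → Vec p} {ξ : ℕ → Fin n → Ω → Ξ}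
  {s : ℕ → Fin n → Ω → S} {Z : ℕ → Ω → State n p} {K : ℕ}

lemma mul_sum_norm_sq_mean_gradAvg_le [IsProbabilityMeasure ν]
    (hR : IsStochasticRun μ ν G W L σ C α γ η f fLow xInit hInit oracle compress ξ s Z K)
    {m b Δ : ℝ} (hC : 1 / 12 ≤ C) (hα : α = alphaParam C) (hγ : γ = gammaParam C α (lambda2 W))
    (hm : m = γ * (1 - lambda2 W) / 2) (hη : 0 < η) (hL : 0 < L) (hηm : n * η ≤ m)
    (hηL : η * L ≤ m / 8) (hΔ : avgFun f (avg xInit) - (n : ℝ)⁻¹ * ∑ i, fLow i ≤ Δ)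
    (hb : 0 ≤ b) (hx : stackedNormSq xInit ≤ b * (n : ℝ) ^ 2)
    (hh : stackedNormSq hInit ≤ b * (n : ℝ) ^ 2)
    (hg : stackedNormSq (fun i => gradient (f i) (xInit i)) ≤ b * (n : ℝ) ^ 2) :
    η * ∑ k ∈ Finset.range K, ‖mean (gradAvg μ f Z k)‖ ^ 2
      ≤ 4 * (Δ + 2 * L ^ 2 * b + L * σ ^ 2 / 2
          + 2 * L ^ 2 * ((1 + L ^ 2) * (28 * b + 16 * σ ^ 2)))
        + (2 * L * σ ^ 2 + 24 * L ^ 2 * σ ^ 2) * (K * η ^ 2 / n) := by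
  have hn : (1 : ℝ) ≤ n := by exact_mod_cast one_le_two.trans hR.two_le
  have hn0 : (0 : ℝ) < n := one_pos.trans_le hn
  obtain ⟨hlam2, hlam2', U, lam, i₀, hU⟩ := hR.mixing.exists_isModeBasis hR.two_le
  obtain ⟨hα0, hα1, hαC, hγ0, hγ1, hm0, hmγ, -, hγC, -⟩ := param_bounds hC hα hγ hm hlam2 hlam2'
  obtain ⟨-, hκ1, hκ0, -⟩ := lyapunov_coeff_bounds hm0 hmγ hα0 hα1 hαC hγC
  have hm1 : m ≤ 1 := by linarith
  have hηL1 : η * L ≤ 1 := by linarith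
  have hη1 : η ≤ 1 := (le_mul_of_one_le_left hη.le hn).trans (hηm.trans hm1)
  have hlow : (n : ℝ)⁻¹ * ∑ i, fLow i ≤ ∫ ω, avgFun f (avg (Z K ω).x) ∂μ := by
    have h := integral_mono (integrable_const ((n : ℝ)⁻¹ * ∑ i, fLow i))
      (hR.smooth.integrable_avgFun (zero_lt_two.trans_le hR.two_le) (hR.memLp_avg le_rfl))
      fun ω => hR.smooth.le_avgFun (avg (Z K ω).x)
    rwa [integral_const, probReal_univ, one_smul] at h
  have hsum := sum_le_of_coupled_recursion (F := fun k => ∫ ω, avgFun f (avg (Z k ω).x) ∂μ)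
    (Φ := fun k => networkLyapunov U lam i₀ C α γ η (sol μ Z k) (dual μ Z k) (ref μ Z k)
      (gradAvg μ f Z k)) (g := fun k => ‖mean (gradAvg μ f Z k)‖ ^ 2) hη hL hn0 hm0 hm1 hηL hlow
    (networkLyapunov_nonneg hU hlam2 hγ0 hγ1 hκ0 _ _ _ _) (fun _ => sq_nonneg _)
    (fun k hk => hR.descent_succ_le hη.le hL.le hηL1 hk)
    (fun k hk => hR.lyapunov_succ_le hU hlam2 hlam2' hm hγ0 hγ1 hα0 hα1 hαC hγC hη.le hL.le hηL hk)
  have hΦ := hR.lyapunov_zero_le hU hlam2 hm hm1 hγ0 hγ1 (hκ1.trans (by norm_num)) hη.le hηm hL.le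
    hx hh hg
  have hF := hR.descent_init_le hη.le hL.le hηL1
  set M := (1 + L ^ 2) * (28 * b + 16 * σ ^ 2) with hM
  have hM0 : 0 ≤ M := by positivity
  have h1 : η * L ^ 2 / (2 * n) * (4 * stackedNormSq xInit) ≤ 2 * L ^ 2 * b := by
    calc η * L ^ 2 / (2 * n) * (4 * stackedNormSq xInit)
        ≤ η * L ^ 2 / (2 * n) * (4 * (b * (n : ℝ) ^ 2)) := by gcongr
      _ = 2 * L ^ 2 * b * (n * η) := by field_simp; ring
      _ ≤ 2 * L ^ 2 * b * 1 := by gcongr; exact hηm.trans hm1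
      _ = _ := mul_one _
  have h2 : L * η ^ 2 * σ ^ 2 / (2 * n) ≤ L * σ ^ 2 / 2 := by
    rw [div_le_div_iff₀ (by positivity) two_pos]
    have h : η ^ 2 * 1 ≤ 1 * (n : ℝ) :=
      mul_le_mul (pow_le_one₀ hη.le hη1) hn zero_le_one zero_le_one
    have h' := mul_le_mul_of_nonneg_left h (show 0 ≤ L * σ ^ 2 * 2 by positivity)
    linarith
  -- The initial Lyapunov value is of order `n²`, so this contribution is of order `n η / m`.
  -- Keeping it bounded is what forces the horizon to be of order `n³ / m²`.
  have h3 : 2 * η * L ^ 2 / (n * m) * networkLyapunov U lam i₀ C α γ η (sol μ Z 0) (dual μ Z 0)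
      (ref μ Z 0) (gradAvg μ f Z 0) ≤ 2 * L ^ 2 * M := by
    calc _ ≤ 2 * η * L ^ 2 / (n * m) * (M * (n : ℝ) ^ 2) := by gcongr
      _ = 2 * L ^ 2 * M * (n * η / m) := by field_simp
      _ ≤ 2 * L ^ 2 * M * 1 := by gcongr; exact (div_le_one hm0).2 hηm
      _ = _ := mul_one _
  -- The noise coming from the consensus error is of higher order in `η`; the condition `n η ≤ m`
  -- reduces it to the order of the averaged noise.
  have h4 : (K : ℝ) * (L * η ^ 2 * σ ^ 2 / (2 * n) + 6 * η ^ 3 * L ^ 2 * σ ^ 2 / m)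
      ≤ (L * σ ^ 2 / 2 + 6 * L ^ 2 * σ ^ 2) * (K * η ^ 2 / n) := by
    have h : η / m ≤ 1 / n := by
      rw [div_le_div_iff₀ hm0 hn0]
      linarith
    calc (K : ℝ) * (L * η ^ 2 * σ ^ 2 / (2 * n) + 6 * η ^ 3 * L ^ 2 * σ ^ 2 / m)
        = K * (L * η ^ 2 * σ ^ 2 / (2 * n) + 6 * η ^ 2 * L ^ 2 * σ ^ 2 * (η / m)) := by
          field_simp
      _ ≤ K * (L * η ^ 2 * σ ^ 2 / (2 * n) + 6 * η ^ 2 * L ^ 2 * σ ^ 2 * (1 / n)) := by gcongr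
      _ = _ := by field_simp
  linarith

end IsStochasticRun

/-- The average squared gradient of a run in terms of the random vectors of the run. -/
lemma meanGradSq_le {Ω Ξ S : Type*} [MeasurableSpace Ω] [StandardBorelSpace Ω] [MeasurableSpace Ξ]
    [MeasurableSpace S] {n p : ℕ} {μ : Measure Ω} [IsProbabilityMeasure μ] {ν : Measure S}
    [IsProbabilityMeasure ν] {G : SimpleGraph (Fin n)} {W : Matrix (Fin n) (Fin n) ℝ}
    {L σ C α γ η : ℝ} {f : Fin n → Vec p → ℝ} {fLow : Fin n → ℝ} {xInit hInit : Fin n → Vec p}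
    {oracle : Fin n → Vec p → Ξ → Vec p} {compress : Vec p → S → Vec p} {ξ : ℕ → Fin n → Ω → Ξ}
    {s : ℕ → Fin n → Ω → S} {Z : ℕ → Ω → State n p} {K : ℕ}
    (hR : IsStochasticRun μ ν G W L σ C α γ η f fLow xInit hInit oracle compress ξ s Z K)
    (hK : 0 < K) {r : ℝ}
    (hr : ∑ k ∈ Finset.range K, ‖mean (IsStochasticRun.gradAvg μ f Z k)‖ ^ 2 ≤ r * K) :
    meanGradSq μ f (fun t ω => (Z t ω).x) K ≤ ENNReal.ofReal r := by
  have hK0 : (0 : ℝ) < K := Nat.cast_pos.2 hK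
  have h : ∀ t ∈ Finset.range K, ∫⁻ ω, ‖gradient (avgFun f) (avg (Z t ω).x)‖ₑ ^ 2 ∂μ
      = ENNReal.ofReal (‖mean (IsStochasticRun.gradAvg μ f Z t)‖ ^ 2) := fun t ht => by
    have ht' := (Finset.mem_range.1 ht).le
    rw [RandomVec.norm_sq_eq, ← lintegral_enorm_sq_eq (RandomVec.memLp _)]
    exact lintegral_congr fun ω => by rw [hR.mean_gradAvg_apply ht']
  unfold meanGradSq
  rw [Finset.sum_congr rfl h, ← ENNReal.ofReal_sum_of_nonneg fun _ _ => sq_nonneg _]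
  refine ENNReal.div_le_of_le_mul ?_
  rw [← ENNReal.ofReal_natCast, ← ENNReal.ofReal_mul' hK0.le]
  exact ENNReal.ofReal_le_ofReal hr

/-- In terms of `m`, the second lower bound on the horizon is exactly `64 L² n / m²`, and the first
is dominated since `C m²` is small. -/
lemma minHorizon_le {n : ℕ} {L C α γ lam m : ℝ} (hn : 1 ≤ n) (hC : 1 / 12 ≤ C)
    (hα : α = alphaParam C) (hm : m = γ * (1 - lam) / 2) (hm0 : 0 < m)
    (hmC : m * C ≤ 1 / 864) : minHorizon n L α γ lam ≤ 64 * L ^ 2 * n ^ 3 / m ^ 2 := by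
  have hn' : (1 : ℝ) ≤ n := by exact_mod_cast hn
  have hC0 : 0 < C := by linarith
  have hα' : α = 1 / (12 * C) := hα
  have hn3 : (n : ℝ) ≤ n ^ 3 := by
    calc (n : ℝ) = n ^ 1 := (pow_one _).symm
      _ ≤ n ^ 3 := pow_le_pow_right₀ hn' (by norm_num)
  refine max_le ?_ ?_
  · rw [hα', le_div_iff₀ (by positivity)]
    have h1 : C * m ^ 2 ≤ 1 / 864 := by nlinarith
    calc 12 * L ^ 2 * n / (1 / (12 * C)) * m ^ 2 = 144 * L ^ 2 * n * (C * m ^ 2) := by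
          field_simp; ring
      _ ≤ 144 * L ^ 2 * n * (1 / 864) := by gcongr
      _ ≤ 64 * L ^ 2 * n := by linarith [show 0 ≤ L ^ 2 * (n : ℝ) by positivity]
      _ ≤ 64 * L ^ 2 * n ^ 3 := by gcongr
  · have h1 : γ ^ 2 * (1 - lam) ^ 2 = 4 * m ^ 2 := by rw [hm]; ring
    rw [h1]
    calc 256 * (n : ℝ) * L ^ 2 / (4 * m ^ 2) = 64 * L ^ 2 * n / m ^ 2 := by field_simp; ring
      _ ≤ _ := by gcongr

end CEDAS

end

theorem corollary4 (L σ Δ c q : ℝ) (hL : 0 < L) (hσ : 0 < σ) (hΔ : 0 ≤ Δ) (hc : 0 < c)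
    (hq : 0 < q) :
    ∃ A B : ℝ, 0 < A ∧ 0 < B ∧
      ∀ (n p : ℕ) (_ : 2 ≤ n)
        -- the network
        (G : SimpleGraph (Fin n)) (W : Matrix (Fin n) (Fin n) ℝ)
        (_ : CEDAS.IsMixingMatrix G W)
        -- the objective functions
        (f : Fin n → CEDAS.Vec p → ℝ) (fLow : Fin n → ℝ)
        (_ : CEDAS.IsSmoothBddBelow L f fLow)
        -- the compressor, and the parameters of the algorithm
        (S : Type*) [MeasurableSpace S] (ν : Measure S) [IsProbabilityMeasure ν]
        (compress : CEDAS.Vec p → S → CEDAS.Vec p) (C α γ : ℝ) (_ : 1 / 12 ≤ C)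
        (_ : CEDAS.IsUnbiasedCompressor ν compress C)
        (_ : α = CEDAS.alphaParam C) (_ : γ = CEDAS.gammaParam C α (CEDAS.lambda2 W))
        -- the stochastic gradient oracles
        (Ξ : Type*) [MeasurableSpace Ξ] (oracle : Fin n → CEDAS.Vec p → Ξ → CEDAS.Vec p)
        (_ : ∀ i, Measurable (Function.uncurry (oracle i)))
        -- the initial values
        (xInit hInit : Fin n → CEDAS.Vec p)
        (_ : CEDAS.avgFun f (CEDAS.avg xInit) - (n : ℝ)⁻¹ * ∑ i, fLow i ≤ Δ)
        (_ : CEDAS.stackedNormSq xInit ≤ c * (n : ℝ) ^ 2)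
        (_ : CEDAS.stackedNormSq hInit ≤ c * (n : ℝ) ^ 2)
        (_ : CEDAS.stackedNormSq (fun i => gradient (f i) (xInit i)) ≤ c * (n : ℝ) ^ 2)
        (_ : 1 / (1 - CEDAS.lambda2 W) ≤ c * (n : ℝ) ^ q)
        -- the gradient samples and the compressor seeds
        (Ω : Type*) [MeasurableSpace Ω] [StandardBorelSpace Ω] (μ : Measure Ω)
        [IsProbabilityMeasure μ] (ξ : ℕ → Fin n → Ω → Ξ) (s : ℕ → Fin n → Ω → S)
        (_ : ∀ t i, Measurable (ξ t i))
        (_ : CEDAS.IsFreshSeeds μ ν ξ s)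
        (_ : ∀ K : ℕ, 1 ≤ K → ∀ t : ℕ, t ≤ K →
          CEDAS.IsGoodGradientSample μ (CEDAS.historyGrad ξ s t) f oracle σ
            (fun i ω => CEDAS.queryPoint G W α γ (CEDAS.etaParam n K) xInit hInit oracle compress
              (fun u j => ξ u j ω) (fun l j => s l j ω) t i)
            (ξ t)),
        CEDAS.transientTime n A (CEDAS.minHorizon n L α γ (CEDAS.lambda2 W))
          (fun K => CEDAS.meanGradSq μ f
            (fun t ω => (CEDAS.state G W α γ (CEDAS.etaParam n K) xInit hInit oracle compress
              (fun u j => ξ u j ω) (fun l j => s l j ω) t).x) K)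
          ≤ ENNReal.ofReal (B * ((n : ℝ) ^ 3 * C ^ 6 / (1 - CEDAS.lambda2 W) ^ 4)) := by
  set M := (1 + L ^ 2) * (28 * c + 16 * σ ^ 2) with hM
  -- `A` is the bound of `mul_sum_norm_sq_mean_gradAvg_le` with `K η² / n = 1`. In `B`, the square
  -- of 497664 comes from `m = (1 - λ₂)² / (497664 C³)`, and the factor 2 pays for rounding up.
  refine ⟨4 * (Δ + 2 * L ^ 2 * c + L * σ ^ 2 / 2 + 2 * L ^ 2 * M)
    + (2 * L * σ ^ 2 + 24 * L ^ 2 * σ ^ 2), 2 * (1 + 64 * L ^ 2) * 497664 ^ 2, by positivity,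
    by positivity, ?_⟩
  intro n p hn G W hW f fLow hf S _ ν _ compress C α γ hC hcomp hα hγ Ξ _ oracle horacle
    xInit hInit hx1 hx2 hh hg _ Ω _ _ μ _ ξ s hξ hs hgood
  obtain ⟨hlam2, hlam2', -⟩ := hW.exists_isModeBasis hn
  obtain ⟨-, -, -, hγ0, hγ1, hm0, hmγ, hmC, -, hmeq⟩ :=
    CEDAS.param_bounds hC hα hγ rfl hlam2 hlam2'
  set m := γ * (1 - CEDAS.lambda2 W) / 2 with hm
  have hn1 : (1 : ℝ) ≤ n := by exact_mod_cast one_le_two.trans hn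
  have hn0 : (0 : ℝ) < n := one_pos.trans_le hn1
  have hC0 : 0 < C := by linarith
  have hδ : 0 < 1 - CEDAS.lambda2 W := by linarith
  -- The summand 1 serves `n η ≤ m`; the summand `64 L²` serves `η L ≤ m / 8` and admissibility.
  set R := (1 + 64 * L ^ 2) * n ^ 3 / m ^ 2 with hR
  have hR1 : 1 ≤ R := by
    rw [hR, one_le_div (by positivity)]
    calc m ^ 2 ≤ 1 := pow_le_one₀ hm0.le (by linarith)
      _ ≤ (n : ℝ) ^ 3 := one_le_pow₀ hn1
      _ ≤ (1 + 64 * L ^ 2) * n ^ 3 := le_mul_of_one_le_left (by positivity) (by nlinarith)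
  have hceil : (⌈R⌉₊ : ℝ≥0∞) ≤ ENNReal.ofReal (2 * R) := by
    rw [← ENNReal.ofReal_natCast]
    exact ENNReal.ofReal_le_ofReal (by linarith [Nat.ceil_lt_add_one (zero_le_one.trans hR1)])
  have hB : 2 * (1 + 64 * L ^ 2) * 497664 ^ 2 * ((n : ℝ) ^ 3 * C ^ 6 / (1 - CEDAS.lambda2 W) ^ 4)
      = 2 * R := by
    rw [hR, hmeq]; field_simp
  rw [hB]
  refine le_trans (sInf_le ⟨⌈R⌉₊, rfl, Nat.one_le_ceil_iff.2 (one_pos.trans_le hR1), ?_, ?_⟩) hceil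
  · refine (CEDAS.minHorizon_le (one_le_two.trans hn) hC hα hm hm0 hmC).trans
      (le_trans ?_ (Nat.le_ceil R))
    rw [hR]
    gcongr
    linarith
  · intro K hK
    have hKR : R ≤ K := (Nat.le_ceil R).trans (by exact_mod_cast hK)
    have hK0 : (0 : ℝ) < K := by linarith
    have hK1 : 1 ≤ K := by exact_mod_cast hR1.trans hKR
    set η := CEDAS.etaParam n K with hη
    have hη0 : 0 < η := Real.sqrt_pos.2 (by positivity)
    have hη2 : K * η ^ 2 = n := by
      rw [hη, CEDAS.etaParam, Real.sq_sqrt (by positivity)]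
      field_simp
    have hbound : (1 + 64 * L ^ 2) * (n : ℝ) ^ 3 ≤ K * m ^ 2 := by
      rwa [hR, div_le_iff₀ (by positivity)] at hKR
    have hηm : n * η ≤ m := by
      refine le_of_sq_le_sq ?_ hm0.le
      refine le_of_mul_le_mul_left ?_ hK0
      calc K * (n * η) ^ 2 = n ^ 2 * (K * η ^ 2) := by ring
        _ = 1 * (n : ℝ) ^ 3 := by rw [hη2]; ring
        _ ≤ (1 + 64 * L ^ 2) * (n : ℝ) ^ 3 := by gcongr; nlinarith
        _ ≤ _ := hbound
    have hηL : η * L ≤ m / 8 := by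
      refine le_of_sq_le_sq ?_ (by positivity)
      refine le_of_mul_le_mul_left ?_ hK0
      calc K * (η * L) ^ 2 = L ^ 2 * (K * η ^ 2) := by ring
        _ = L ^ 2 * (n : ℝ) ^ 1 := by rw [hη2, pow_one]
        _ ≤ L ^ 2 * (n : ℝ) ^ 3 := by gcongr; norm_num
        _ ≤ ((1 + 64 * L ^ 2) * (n : ℝ) ^ 3) / 64 := by
          linarith [show 0 ≤ (n : ℝ) ^ 3 by positivity]
        _ ≤ K * m ^ 2 / 64 := by gcongr
        _ = _ := by ring
    have hrun : CEDAS.IsStochasticRun μ ν G W L σ C α γ η f fLow xInit hInit oracle compress ξ s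
        (fun t ω => CEDAS.state G W α γ η xInit hInit oracle compress
          (fun u j => ξ u j ω) (fun l j => s l j ω) t) K :=
      { mixing := hW
        zero := fun _ => rfl
        succ := fun _ _ => rfl
        two_le := hn
        nonneg_C := hC0.le
        smooth := hf
        compressor := hcomp
        seeds := hs
        measurable_oracle := horacle
        measurable_sample := hξ
        good_init := hgood K hK1 0 (Nat.zero_le K)
        good := fun k hk => hgood K hK1 (k + 1) hk }
    have hsum := hrun.mul_sum_norm_sq_mean_gradAvg_le hC hα hγ hm hη0 hL hηm hηL hx1 hc.le hx2 hh hg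
    rw [hη2, div_self hn0.ne', mul_one] at hsum
    refine CEDAS.meanGradSq_le hrun hK1 ?_
    -- Dividing the summed bound by `K η` hence gives exactly the target `A / √(n K)`.
    have hsqrt : √((n : ℝ) * K) = K * η := by
      rw [← hη2, show (K : ℝ) * η ^ 2 * K = (K * η) ^ 2 by ring, Real.sqrt_sq (by positivity)]
    rw [hsqrt, div_mul_eq_mul_div, le_div_iff₀ (by positivity)]
    calc _ = K * (η * ∑ k ∈ Finset.range K,
          ‖CEDAS.mean (CEDAS.IsStochasticRun.gradAvg μ f _ k)‖ ^ 2) := by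
          ring
      _ ≤ K * _ := mul_le_mul_of_nonneg_left hsum hK0.le
      _ = _ := mul_comm _ _
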